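/- Let $T>0$, $L>0$, $0<\nu<L$, and let $\rho\in C^\infty(0,L)$ satisfy $\rho(x)=0$ for $0<x<L-\nu$ and $\rho(x)=1$ for $L-\frac{\nu}{2}<x<L$. All functions are real-valued. Set $$H=L^2_{\frac{1}{L-x}dx}(0,L),\quad \|u\|_H=\|(L-x)^{-1/2}u\|_{L^2(0,L)},$$ $$V=\Big\{u\in H^2_0(0,L):\ \tfrac{u_{xx}}{L-x}\in L^2(0,L)\Big\},\quad \|u\|_V=\|(L-x)^{-1}u_{xx}\|_{L^2(0,L)}.$$ For $u_0\in H$ and $h\in L^2(0,T;L^2(0,L))$ put $f:=(\rho(x)h)_{xx}$ and consider the linear Kawahara system $$\begin{cases}u_t+u_x+u_{xxx}-u_{xxxxx}=f & \text{in }(0,T)\times(0,L),\\ u(t,0)=u(t,L)=u_x(t,0)=u_x(t,L)=u_{xx}(t,L)=0 & \text{in }(0,T),\\ u(0,x)=u_0(x)& \text{in }(0,L).\end{cases}$$ A function $u\in C([0,T];H)\cap L^2(0,T;V)$ is called a solution if $u(0)=u_0$ and, for every $\psi\in C^\infty([0,L])$ with $\psi(0)=\psi(L)=\psi'(0)=\psi'(L)=\psi''(0)=0$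 and every $t\in[0,T]$, $$\int_0^L u(t)\psi\,dx=\int_0^L u_0\psi\,dx+\int_0^t\!\!\int_0^L u(s)\,(\psi'+\psi'''-\psi^{(5)})\,dx\,ds+\int_0^t\!\!\int_0^L \rho\,h(s)\,\psi''\,dx\,ds .$$ Then there is a constant $C>0$, depending only on $T$, $L$, $\nu$ and $\rho$, such that for all $u_0\in H$ and $h\in L^2(0,T;L^2(0,L))$ the system has a unique solution $u\in C([0,T];H)\cap L^2(0,T;V)$, and $$\|u\|_{L^\infty(0,T;H)}+\|u\|_{L^2(0,T;V)}\le C\big(\|u_0\|_H+\|h\|_{L^2(0,T;L^2(0,L))}\big).$$ -/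

import Mathlib

open MeasureTheory Set
open scoped ContDiff

namespace Kawahara

/-- Lebesgue measure on the interval `(0, L)`. -/
noncomputable abbrev leb (L : ℝ) : Measure ℝ := volume.restrict (Ioo 0 L)

/-- The weighted space `L²_{w(x)dx}(0, L)`, with norm `(∫₀ᴸ u² w dx)^{1/2}`. -/
abbrev WeightedL2 (L : ℝ) (w : ℝ → ℝ) : Type :=
  Lp ℝ 2 ((leb L).withDensity fun x => ENNReal.ofReal (w x))

/-- `H = L²_{dx/(L-x)}(0, L)`, with `‖u‖_H = ‖(L-x)^{-1/2} u‖_{L²}`. -/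
abbrev H (L : ℝ) : Type := WeightedL2 L fun x => 1 / (L - x)

/-- `L²_{dx/(L-x)²}(0, L)`, the space in which the second derivative of an element of `V` lies. -/
abbrev DV (L : ℝ) : Type := WeightedL2 L fun x => 1 / (L - x) ^ 2

/-- Lebesgue measure on `[0, T]`, as a measure on the subtype. -/
noncomputable abbrev lebT (T : ℝ) : Measure (Icc (0 : ℝ) T) :=
  Measure.comap Subtype.val volume

/-- `L²(0, T; X)` (Bochner space). -/
abbrev L2Time (T : ℝ) (X : Type) [NormedAddCommGroup X] : Type :=
  Lp X 2 (lebT T)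

/-- `g` is the weak derivative of `f` on `(0, L)`. -/
def HasWeakDeriv (L : ℝ) (f g : ℝ → ℝ) : Prop :=
  LocallyIntegrableOn f (Ioo 0 L) ∧ LocallyIntegrableOn g (Ioo 0 L) ∧
    ∀ φ : ℝ → ℝ, ContDiff ℝ ∞ φ → HasCompactSupport φ → tsupport φ ⊆ Ioo 0 L →
      ∫ x in Ioo 0 L, f x * deriv φ x = -∫ x in Ioo 0 L, g x * φ x

/-- `v ∈ H²₀(0, L)` with weak second derivative `v_xx = g ∈ L²(0, L)`: the (continuous
representatives of the) functions `v` and `v_x` vanish at both endpoints. -/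
def MemH20With (L : ℝ) (v g : ℝ → ℝ) : Prop :=
  MemLp g 2 (leb L) ∧
    ∃ w w₁ : ℝ → ℝ, v =ᵐ[leb L] w ∧
      ContinuousOn w (Icc 0 L) ∧ ContinuousOn w₁ (Icc 0 L) ∧
      HasWeakDeriv L w w₁ ∧ HasWeakDeriv L w₁ g ∧
      w 0 = 0 ∧ w L = 0 ∧ w₁ 0 = 0 ∧ w₁ L = 0

/-- `u ∈ L²(0, T; V)` with `u_xx = U`, where
`V = {v ∈ H²₀(0, L) : v_xx ∈ L²_{dx/(L-x)²}}` and `‖v‖_V = ‖(L-x)^{-1} v_xx‖_{L²}`.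
As `v ↦ v_xx` is an isometry of `V` into `L²_{dx/(L-x)²}`, being in `L²(0, T; V)` means that
`u(t) ∈ V` for almost every `t` and `U = u_xx ∈ L²(0, T; L²_{dx/(L-x)²})`, and the norm of `u` in
`L²(0, T; V)` is the norm of `U`. -/
def MemL2VWith {T L : ℝ} (u : C(Icc (0 : ℝ) T, H L)) (U : L2Time T (DV L)) : Prop :=
  ∀ᵐ t ∂lebT T, MemH20With L (u t) (U t)

/-- A smooth cut-off near the right endpoint: `ρ ∈ C^∞(0, L)`, `ρ = 0` on `(0, L - ν)` and
`ρ = 1` on `(L - ν/2, L)`. -/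
def IsCutoff (L ν : ℝ) (ρ : ℝ → ℝ) : Prop :=
  ContDiffOn ℝ ∞ ρ (Ioo 0 L) ∧ (∀ x ∈ Ioo 0 (L - ν), ρ x = 0) ∧
    ∀ x ∈ Ioo (L - ν / 2) L, ρ x = 1

/-- Test functions: `ψ ∈ C^∞([0, L])` with the boundary conditions of the adjoint problem,
`ψ(0) = ψ(L) = ψ'(0) = ψ'(L) = ψ''(0) = 0` (`ψ''(L)` is free, because `u_xx(t, L) = 0` is
imposed on the solution). -/
def IsTest (L : ℝ) (ψ : ℝ → ℝ) : Prop :=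
  ContDiff ℝ ∞ ψ ∧ ψ 0 = 0 ∧ ψ L = 0 ∧ iteratedDeriv 1 ψ 0 = 0 ∧ iteratedDeriv 1 ψ L = 0 ∧
    iteratedDeriv 2 ψ 0 = 0

/-- `u ∈ C([0, T]; H)` is a (weak) solution of
`u_t + u_x + u_xxx - u_xxxxx = (ρ h)_xx` in `(0, T) × (0, L)`,
`u(t,0) = u(t,L) = u_x(t,0) = u_x(t,L) = u_xx(t,L) = 0`, `u(0, ·) = u₀`:
the equation multiplied by a test function in `x`, with all `x`-derivatives moved onto the test
function by means of the boundary conditions, and integrated in time from `0` to `t`. -/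
def IsSolution {T L : ℝ} (ρ : ℝ → ℝ) (u₀ : H L) (h : L2Time T (Lp ℝ 2 (leb L)))
    (u : C(Icc (0 : ℝ) T, H L)) : Prop :=
  (∀ t : Icc (0 : ℝ) T, (t : ℝ) = 0 → u t = u₀) ∧
  ∀ ψ : ℝ → ℝ, IsTest L ψ → ∀ t : Icc (0 : ℝ) T,
    ∫ x in Ioo 0 L, u t x * ψ x =
      (∫ x in Ioo 0 L, u₀ x * ψ x) +
        ∫ s in Iic t,
          ((∫ x in Ioo 0 L,
              u s x * (iteratedDeriv 1 ψ x + iteratedDeriv 3 ψ x - iteratedDeriv 5 ψ x)) +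
            ∫ x in Ioo 0 L, ρ x * h s x * iteratedDeriv 2 ψ x) ∂lebT T

end Kawahara

/-! The equation is tested with `v / (L - x)`. All derivatives of this weight are positive, so
integrating the fifth-order term by parts leaves `5/2 ∫ v_xx² / (L - x)²` together with lower terms
of the same homogeneity, of which the one in `v_x²` has the wrong sign. Completing squares in the
manner of Hardy's inequality keeps `1/10 ∫ v_xx² / (L - x)²`, up to `‖v‖_H²`; this is
`IsProfile.energy`. In the source term both derivatives of `(ρ h)_xx` are moved onto `v / (L - x)`,
whose second derivative is bounded by the `V` norm through `IsProfile.hardy`; Young's inequality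
then absorbs it.

The `L²` pairing with a test function `ψ` is the `H` inner product with `(L - x) ψ`, and `(L - x) ψ`
satisfies the boundary conditions of the operator itself. Hence the same energy inequality gives
coercivity of the adjoint (`IsTest.coercive`), and Lions' projection argument
(`exists_weak_solution`) produces a weak solution in `L²(0, T; V)`.

Such a solution need not be continuous in time, nor is the energy estimate known for it. For smooth
compatible data the argument is therefore applied to the equation of `u_tt`, and two integrations in
time give `u` of class `C¹` with values in `V` (`Frame.exists_isRegularSol`). At each time `u`
weakly solves a stationary equation with continuous right-hand side. By `exists_isProfile` it is
then classical, including the natural condition `u_xx(L) = 0`, so the energy inequality applies and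
gives the a priori estimate.

The data of regular solutions span a dense space, and the estimate passes to limits, so every datum
is attained (`Frame.wellPosed`). For uniqueness, the difference of two solutions integrated twice in
time is a regular solution with zero data. The evolution argument is carried out for an abstract
`Frame`; in `kawaharaFrame` an element `v` of `V` is represented by `G = v_xx`, and `v` is recovered
by integrating `G` twice from `L`. -/

namespace Kawahara

/-! ### Tail integrals. -/

/-- The primitive of `-f` vanishing at `L`. -/
noncomputable def tailInt (L : ℝ) (f : ℝ → ℝ) (x : ℝ) : ℝ := ∫ s in x..L, f s

@[simp] lemma tailInt_self (L : ℝ) (f : ℝ → ℝ) : tailInt L f L = 0 := by simp [tailInt]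

lemma intervalIntegral_eq_Ioo {L : ℝ} (hL : 0 ≤ L) (f : ℝ → ℝ) :
    ∫ x in (0 : ℝ)..L, f x = ∫ x in Ioo 0 L, f x := by
  rw [intervalIntegral.integral_of_le hL, integral_Ioc_eq_integral_Ioo]

lemma intervalIntegrable_iff_Ioo {L : ℝ} (hL : 0 ≤ L) {f : ℝ → ℝ} :
    IntervalIntegrable f volume 0 L ↔ IntegrableOn f (Ioo 0 L) := by
  rw [intervalIntegrable_iff_integrableOn_Ioo_of_le hL]

lemma tailInt_eq {L : ℝ} (hL : 0 ≤ L) {f : ℝ → ℝ} (hf : IntervalIntegrable f volume 0 L) {x : ℝ}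
    (hx : x ∈ Icc 0 L) : tailInt L f x = tailInt L f 0 - ∫ s in (0 : ℝ)..x, f s := by
  have h1 : IntervalIntegrable f volume 0 x :=
    hf.mono_set (by rw [uIcc_of_le hx.1, uIcc_of_le hL]; exact Icc_subset_Icc le_rfl hx.2)
  have h2 : IntervalIntegrable f volume x L :=
    hf.mono_set (by rw [uIcc_of_le hx.2, uIcc_of_le hL]; exact Icc_subset_Icc hx.1 le_rfl)
  have := intervalIntegral.integral_add_adjacent_intervals h1 h2
  unfold tailInt
  linarith

lemma continuousOn_tailInt {L : ℝ} (hL : 0 ≤ L) {f : ℝ → ℝ}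
    (hf : IntervalIntegrable f volume 0 L) : ContinuousOn (tailInt L f) (Icc 0 L) := by
  have h : ContinuousOn (fun x => ∫ s in (0 : ℝ)..x, f s) (Icc 0 L) := by
    have := intervalIntegral.continuousOn_primitive_interval' hf left_mem_uIcc
    rwa [uIcc_of_le hL] at this
  exact (continuousOn_const.sub h).congr fun x hx => tailInt_eq hL hf hx

lemma hasDerivAt_tailInt {L : ℝ} {f : ℝ → ℝ} (hf : ContinuousOn f (Icc 0 L)) {x : ℝ}
    (hx : x ∈ Ioo 0 L) : HasDerivAt (tailInt L f) (-f x) x := by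
  have hnhds : Icc 0 L ∈ nhds x := Icc_mem_nhds hx.1 hx.2
  refine intervalIntegral.integral_hasDerivAt_left ?_ ?_ (hf.continuousAt hnhds)
  · exact (hf.mono (by rw [uIcc_of_le hx.2.le]; exact Icc_subset_Icc hx.1.le le_rfl)).intervalIntegrable
  · exact ⟨Icc 0 L, hnhds, hf.aestronglyMeasurable measurableSet_Icc⟩

/-- Integration by parts against a primitive of an integrable function. -/
lemma integral_tailInt_mul_deriv {L : ℝ} (hL : 0 ≤ L) {f η : ℝ → ℝ}
    (hf : IntervalIntegrable f volume 0 L) (hη : ContDiff ℝ 1 η) :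
    ∫ x in (0 : ℝ)..L, tailInt L f x * deriv η x =
      (∫ x in (0 : ℝ)..L, f x * η x) - tailInt L f 0 * η 0 := by
  -- Since `f` is only integrable, the integration by parts is the one for absolutely continuous
  -- functions, with `F' = f` almost everywhere.
  set F : ℝ → ℝ := fun x => ∫ s in (0 : ℝ)..x, f s
  have hF : AbsolutelyContinuousOnInterval F 0 L :=
    hf.absolutelyContinuousOnInterval_intervalIntegral (c := 0) left_mem_uIcc
  have hη' : AbsolutelyContinuousOnInterval η 0 L := by
    obtain ⟨K, hK⟩ := (isCompact_uIcc (a := (0 : ℝ)) (b := L)).exists_bound_of_continuousOn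
      (hη.continuous_deriv le_rfl).continuousOn
    have : LipschitzOnWith (Real.toNNReal K) η (uIcc 0 L) := by
      refine (convex_uIcc 0 L).lipschitzOnWith_of_nnnorm_deriv_le
        (fun x _ => (hη.differentiable one_ne_zero).differentiableAt) fun x hx => ?_
      rw [← NNReal.coe_le_coe, coe_nnnorm]
      exact (hK x hx).trans (Real.le_coe_toNNReal K)
    exact this.absolutelyContinuousOnInterval
  have key := hF.integral_mul_deriv_eq_deriv_mul hη'
  have e1 : ∫ x in (0 : ℝ)..L, deriv F x * η x = ∫ x in (0 : ℝ)..L, f x * η x := by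
    apply intervalIntegral.integral_congr_ae
    filter_upwards [hf.ae_hasDerivAt_integral] with x hx hx'
    rw [(hx (uIoc_subset_uIcc hx') 0 left_mem_uIcc).deriv]
  have e2 : ∫ x in (0 : ℝ)..L, tailInt L f x * deriv η x =
      ∫ x in (0 : ℝ)..L, (tailInt L f 0 * deriv η x - F x * deriv η x) := by
    apply intervalIntegral.integral_congr
    intro x hx
    rw [uIcc_of_le hL] at hx
    simp only [tailInt_eq hL hf hx, F]
    ring
  have hc : Continuous (deriv η) := hη.continuous_deriv le_rfl
  rw [e2, intervalIntegral.integral_sub, intervalIntegral.integral_const_mul, key, e1,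
    intervalIntegral.integral_deriv_eq_sub]
  · simp only [F, intervalIntegral.integral_same, tailInt]; ring
  · exact fun x _ => (hη.differentiable one_ne_zero).differentiableAt
  · exact hc.intervalIntegrable _ _
  · exact (hc.intervalIntegrable _ _).const_mul _
  · exact (hF.continuousOn.mul hc.continuousOn).intervalIntegrable

/-! ### Order of vanishing at `L`, and products divided by powers of `L - x`. -/

/-- `f` is continuous on `[0, L]` and `O((L - x)ⁿ)`. -/
def VanishesTo (L : ℝ) (n : ℕ) (f : ℝ → ℝ) : Prop :=
  ContinuousOn f (Icc 0 L) ∧ ∃ M, ∀ x ∈ Icc 0 L, |f x| ≤ M * (L - x) ^ n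

lemma ContinuousOn.vanishesTo_zero {L : ℝ} {f : ℝ → ℝ} (hf : ContinuousOn f (Icc 0 L)) :
    VanishesTo L 0 f := by
  obtain ⟨M, hM⟩ := isCompact_Icc.exists_bound_of_continuousOn hf
  exact ⟨hf, M, fun x hx => by simpa using hM x hx⟩

/-- The mean value theorem gives `f x = -f' c * (L - x)` for some `c` between `x` and `L`, and `L -
c ≤ L - x`. Each boundary condition at `L` thus gains one order. -/
lemma VanishesTo.of_hasDerivAt {L : ℝ} {n : ℕ} {f f' : ℝ → ℝ} (hf : ContinuousOn f (Icc 0 L))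
    (hd : ∀ x ∈ Ioo 0 L, HasDerivAt f (f' x) x) (hL : f L = 0) (hf' : VanishesTo L n f') :
    VanishesTo L (n + 1) f := by
  obtain ⟨M, hM⟩ := hf'.2
  refine ⟨hf, M, fun x hx => ?_⟩
  rcases hx.2.eq_or_lt with rfl | hlt
  · simp [hL]
  obtain ⟨c, hc, hc'⟩ := exists_hasDerivAt_eq_slope f f' hlt
    (hf.mono (Icc_subset_Icc hx.1 le_rfl)) fun z hz => hd z ⟨hx.1.trans_lt hz.1, hz.2⟩
  have hpos : 0 < L - x := sub_pos.2 hlt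
  have h1 : f x = -(f' c * (L - x)) := by
    rw [hc', hL]; field_simp; ring
  have h2 := hM c ⟨hx.1.trans hc.1.le, hc.2.le⟩
  have hM0 : 0 ≤ M := by
    have h3 : 0 < (L - c) ^ n := pow_pos (sub_pos.2 hc.2) _
    by_contra hneg
    nlinarith [abs_nonneg (f' c)]
  have h4 : (L - c) ^ n ≤ (L - x) ^ n := by
    have := hc.2; have := hc.1
    gcongr
  rw [h1, abs_neg, abs_mul, abs_of_pos hpos, pow_succ, ← mul_assoc]
  gcongr
  exact h2.trans (by gcongr)

lemma VanishesTo.abs_mul_div_le {L : ℝ} {a b n k : ℕ} {f g : ℝ → ℝ} (hf : VanishesTo L a f)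
    (hg : VanishesTo L b g) (hab : n + k ≤ a + b) :
    ∃ M, ∀ x ∈ Ico 0 L, |f x * g x / (L - x) ^ n| ≤ M * (L - x) ^ k := by
  obtain ⟨M, hM⟩ := hf.2
  obtain ⟨N, hN⟩ := hg.2
  refine ⟨|M| * |N| * L ^ (a + b - n - k), fun x hx => ?_⟩
  have hpos : 0 < L - x := sub_pos.2 hx.2
  have e : a + b = n + k + (a + b - n - k) := by omega
  have h1 : |f x| ≤ |M| * (L - x) ^ a :=
    (hM x ⟨hx.1, hx.2.le⟩).trans (by gcongr; exact le_abs_self M)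
  have h2 : |g x| ≤ |N| * (L - x) ^ b :=
    (hN x ⟨hx.1, hx.2.le⟩).trans (by gcongr; exact le_abs_self N)
  rw [abs_div, abs_mul, abs_of_pos (pow_pos hpos n), div_le_iff₀ (pow_pos hpos n)]
  calc |f x| * |g x| ≤ (|M| * (L - x) ^ a) * (|N| * (L - x) ^ b) := by gcongr
    _ = |M| * |N| * (L - x) ^ (a + b - n - k) * (L - x) ^ k * (L - x) ^ n := by
        have : (L - x) ^ a * (L - x) ^ b
          = (L - x) ^ (a + b - n - k) * (L - x) ^ k * (L - x) ^ n := by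
          rw [← pow_add, ← pow_add, ← pow_add]; congr 1; omega
        linear_combination |M| * |N| * this
    _ ≤ |M| * |N| * L ^ (a + b - n - k) * (L - x) ^ k * (L - x) ^ n := by
        gcongr
        linarith [hx.1]

lemma continuousOn_mul_div_pow {L : ℝ} (n : ℕ) {f g : ℝ → ℝ} (hf : ContinuousOn f (Icc 0 L))
    (hg : ContinuousOn g (Icc 0 L)) :
    ContinuousOn (fun x => f x * g x / (L - x) ^ n) (Ico 0 L) := by
  refine ((hf.mono Ico_subset_Icc_self).mul (hg.mono Ico_subset_Icc_self)).div (by fun_prop)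
    fun x hx => ?_
  exact pow_ne_zero _ (sub_pos.2 hx.2).ne'

/-- The quotient is `O(L - x)`, hence tends to `0` at `L`. For `n ≠ 0` this limit agrees with the
value `0` that division by zero assigns at `x = L`, so continuity holds up to the endpoint. -/
lemma VanishesTo.continuousOn_mul_div {L : ℝ} {a b : ℕ} (n : ℕ) {f g : ℝ → ℝ}
    (hf : VanishesTo L a f) (hg : VanishesTo L b g) (hn : n ≠ 0) (hab : n + 1 ≤ a + b) :
    ContinuousOn (fun x => f x * g x / (L - x) ^ n) (Icc 0 L) := by
  obtain ⟨M, hM⟩ := hf.abs_mul_div_le hg hab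
  intro x hx
  rcases hx.2.eq_or_lt with rfl | hlt
  · rw [ContinuousWithinAt]
    simp only [sub_self, zero_pow hn, div_zero]
    refine squeeze_zero_norm' (a := fun z => |M| * (x - z)) ?_ ?_
    · filter_upwards [self_mem_nhdsWithin] with z hz
      rcases hz.2.eq_or_lt with rfl | hz'
      · simp [zero_pow hn]
      · refine (hM z ⟨hz.1, hz'⟩).trans ?_
        rw [pow_one]
        have := sub_pos.2 hz'
        gcongr
        exact le_abs_self M
    · have : ContinuousAt (fun z : ℝ => |M| * (x - z)) x := by fun_prop
      have h := this.tendsto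
      simp only [sub_self, mul_zero] at h
      exact h.mono_left nhdsWithin_le_nhds
  · have h := (continuousOn_mul_div_pow n hf.1 hg.1) x ⟨hx.1, hlt⟩
    refine h.mono_of_mem_nhdsWithin ?_
    filter_upwards [self_mem_nhdsWithin, nhdsWithin_le_nhds (Iio_mem_nhds hlt)] with z hz hz'
    exact ⟨hz.1, hz'⟩

lemma VanishesTo.intervalIntegrable_mul_div {L : ℝ} (hL : 0 ≤ L) {a b : ℕ} (n : ℕ) {f g : ℝ → ℝ}
    (hf : VanishesTo L a f) (hg : VanishesTo L b g) (hab : n ≤ a + b) :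
    IntervalIntegrable (fun x => f x * g x / (L - x) ^ n) volume 0 L := by
  obtain ⟨M, hM⟩ := hf.abs_mul_div_le hg (k := 0) (by simpa using hab)
  rw [intervalIntegrable_iff_integrableOn_Ico_of_le hL]
  refine IntegrableOn.of_bound (C := M) (by simp)
    ((continuousOn_mul_div_pow n hf.1 hg.1).aestronglyMeasurable measurableSet_Ico) ?_
  filter_upwards [ae_restrict_mem measurableSet_Ico] with x hx
  rw [Real.norm_eq_abs]
  simpa only [pow_zero, mul_one] using hM x hx

lemma hasDerivAt_mul_div_pow {L : ℝ} (n : ℕ) {f g : ℝ → ℝ} {f' g' x : ℝ} (hx : x < L)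
    (hf : HasDerivAt f f' x) (hg : HasDerivAt g g' x) :
    HasDerivAt (fun x => f x * g x / (L - x) ^ n)
      ((f' * g x + f x * g') / (L - x) ^ n + n * (f x * g x) / (L - x) ^ (n + 1)) x := by
  have hpos : 0 < L - x := sub_pos.2 hx
  have h1 : HasDerivAt (fun x => (L - x) ^ n) (n * (L - x) ^ (n - 1) * (-1)) x :=
    ((hasDerivAt_id x).const_sub L).fun_pow n
  refine ((hf.fun_mul hg).fun_div h1 (pow_ne_zero n hpos.ne')).congr_deriv ?_
  rcases n with _ | n
  · simp
  · simp only [Nat.add_sub_cancel, Nat.cast_add, Nat.cast_one]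
    field_simp
    ring

/-! ### The energy and Hardy inequalities for classical functions. -/

/-- A classical function with the boundary conditions of the Kawahara operator; the `vᵢ` are its
derivatives. -/
structure IsProfile (L : ℝ) (v v1 v2 v3 v4 v5 : ℝ → ℝ) : Prop where
  c0 : ContinuousOn v (Icc 0 L)
  c1 : ContinuousOn v1 (Icc 0 L)
  c2 : ContinuousOn v2 (Icc 0 L)
  c3 : ContinuousOn v3 (Icc 0 L)
  c4 : ContinuousOn v4 (Icc 0 L)
  c5 : ContinuousOn v5 (Icc 0 L)
  d0 : ∀ x ∈ Ioo 0 L, HasDerivAt v (v1 x) x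
  d1 : ∀ x ∈ Ioo 0 L, HasDerivAt v1 (v2 x) x
  d2 : ∀ x ∈ Ioo 0 L, HasDerivAt v2 (v3 x) x
  d3 : ∀ x ∈ Ioo 0 L, HasDerivAt v3 (v4 x) x
  d4 : ∀ x ∈ Ioo 0 L, HasDerivAt v4 (v5 x) x
  z0 : v 0 = 0
  z1 : v1 0 = 0
  l0 : v L = 0
  l1 : v1 L = 0
  l2 : v2 L = 0

namespace IsProfile

variable {L : ℝ} {v v1 v2 v3 v4 v5 : ℝ → ℝ}

lemma o2 (h : IsProfile L v v1 v2 v3 v4 v5) : VanishesTo L 1 v2 :=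
  .of_hasDerivAt h.c2 h.d2 h.l2 (ContinuousOn.vanishesTo_zero h.c3)

lemma o1 (h : IsProfile L v v1 v2 v3 v4 v5) : VanishesTo L 2 v1 :=
  .of_hasDerivAt h.c1 h.d1 h.l1 h.o2

lemma o0 (h : IsProfile L v v1 v2 v3 v4 v5) : VanishesTo L 3 v :=
  .of_hasDerivAt h.c0 h.d0 h.l0 h.o1

end IsProfile

/-- The pointwise form of the energy inequality: the integrand dominates an exact derivative. -/
lemma energy_pointwise {y v v1 v2 v3 v4 v5 : ℝ} (hy : 0 < y) :
    -((v5 * v + v4 * v1) / y ^ 1 + (1 : ℕ) * (v4 * v) / y ^ 2)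
      + ((v4 * v1 + v3 * v2) / y ^ 1 + (1 : ℕ) * (v3 * v1) / y ^ 2)
      + ((v4 * v + v3 * v1) / y ^ 2 + (2 : ℕ) * (v3 * v) / y ^ 3)
      - 1 / 2 * ((v3 * v2 + v2 * v3) / y ^ 1 + (1 : ℕ) * (v2 * v2) / y ^ 2)
      - 2 * ((v3 * v1 + v2 * v2) / y ^ 2 + (2 : ℕ) * (v2 * v1) / y ^ 3)
      - 2 * ((v3 * v + v2 * v1) / y ^ 3 + (3 : ℕ) * (v2 * v) / y ^ 4)
      - 33 / 5 * ((v2 * v1 + v1 * v2) / y ^ 3 + (3 : ℕ) * (v1 * v1) / y ^ 4)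
      - 24 * ((v1 * v1 + v * v2) / y ^ 4 + (4 : ℕ) * (v * v1) / y ^ 5)
      - 51 / 2 * ((v1 * v + v * v1) / y ^ 5 + (5 : ℕ) * (v * v) / y ^ 6)
      + ((v3 * v + v2 * v1) / y ^ 1 + (1 : ℕ) * (v2 * v) / y ^ 2)
      - 1 / 2 * ((v2 * v1 + v1 * v2) / y ^ 1 + (1 : ℕ) * (v1 * v1) / y ^ 2)
      - ((v1 * v1 + v * v2) / y ^ 2 + (2 : ℕ) * (v * v1) / y ^ 3)
      - 5 / 4 * ((v1 * v + v * v1) / y ^ 3 + (3 : ℕ) * (v * v) / y ^ 4)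
      + 1 / 2 * ((v1 * v + v * v1) / y ^ 1 + (1 : ℕ) * (v * v) / y ^ 2)
      ≤ (v1 + v3 - v5) * v / y ^ 1 + v * v / y ^ 1 - 1 / 10 * (v2 * v2 / y ^ 2) := by
  -- This expression is exactly the difference of the two sides. The coefficient `12/5` is `5/2 -
  -- 1/10`. The first two squares vanish for `v = y ^ (5/2)` and the third for `v = y ^ (3/2)`, the
  -- critical powers in the Hardy inequalities of the fifth- and third-order terms. The last term
  -- collects what is left of the third-order term, the transport term and the added `v² / y`.
  have h1 : 0 ≤ 12 / 5 * (v2 / y + 4 * (v1 / y ^ 2) + 25 / 4 * (v / y ^ 3)) ^ 2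
      + 27 / 5 * (v1 / y ^ 2 + 5 / 2 * (v / y ^ 3)) ^ 2 + 3 / 2 * (v1 / y + 3 / 2 * (v / y ^ 2)) ^ 2
      + v ^ 2 / y ^ 4 * (3 / 8 - y ^ 2 / 2 + y ^ 3) := by
    -- For `y > 0` the cubic is smallest at `y = 1/3`.
    have : 0 ≤ 3 / 8 - y ^ 2 / 2 + y ^ 3 := by
      nlinarith [mul_nonneg hy.le (sq_nonneg (y - 1 / 3)), sq_nonneg (y - 1 / 3)]
    positivity
  rw [← sub_nonneg]
  refine h1.trans (le_of_eq ?_)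
  push_cast
  field_simp
  ring

/-- With `a = v2 / y`, `b = v1 / y²`, `c = v / y³`, adding the derivatives of `v1² / y³` and `v² /
y⁵` amounts to adding `2ab + 3b²` and `2bc + 5c²`. The coefficients `232/25` and `24/5` make the
resulting quadratic form nonnegative. -/
lemma hardy_pointwise {y v v1 v2 : ℝ} (hy : 0 < y) :
    -(232 / 25 * ((v2 * v1 + v1 * v2) / y ^ 3 + (3 : ℕ) * (v1 * v1) / y ^ 4)
      + 24 / 5 * ((v1 * v + v * v1) / y ^ 5 + (5 : ℕ) * (v * v) / y ^ 6))
      ≤ 10 * (v2 * v2 / y ^ 2) - (v2 / y + 2 * v1 / y ^ 2 + 2 * v / y ^ 3) ^ 2 := by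
  set a := v2 / y with ha
  set b := v1 / y ^ 2 with hb
  set c := v / y ^ 3 with hc
  have e : 10 * (v2 * v2 / y ^ 2) - (a + 2 * v1 / y ^ 2 + 2 * v / y ^ 3) ^ 2
      + (232 / 25 * ((v2 * v1 + v1 * v2) / y ^ 3 + (3 : ℕ) * (v1 * v1) / y ^ 4)
      + 24 / 5 * ((v1 * v + v * v1) / y ^ 5 + (5 : ℕ) * (v * v) / y ^ 6))
      = 10 * a ^ 2 - (a + 2 * b + 2 * c) ^ 2 + (232 / 25 * (2 * a * b + 3 * b ^ 2)
        + 24 / 5 * (2 * b * c + 5 * c ^ 2)) := by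
    rw [ha, hb, hc]; push_cast; field_simp; ring
  have : 0 ≤ 10 * a ^ 2 - (a + 2 * b + 2 * c) ^ 2 + (232 / 25 * (2 * a * b + 3 * b ^ 2)
        + 24 / 5 * (2 * b * c + 5 * c ^ 2)) := by
    nlinarith [sq_nonneg (a + 3 / 2 * b), sq_nonneg (b + 5 / 2 * c), sq_nonneg (a - 2 * b),
      sq_nonneg (a - 2 * c), sq_nonneg (b - c), sq_nonneg a]
  linarith

section
variable {L : ℝ} {v v1 v2 v3 v4 v5 : ℝ → ℝ}

/-- The energy inequality: coercivity of the Kawahara operator in `L²(dx/(L-x))`, up to a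
zeroth-order term. -/
theorem IsProfile.energy (hL : 0 < L) (h : IsProfile L v v1 v2 v3 v4 v5) :
    1 / 10 * ∫ x in (0 : ℝ)..L, v2 x * v2 x / (L - x) ^ 2 ≤
      (∫ x in (0 : ℝ)..L, (v1 x + v3 x - v5 x) * v x / (L - x) ^ 1) +
        ∫ x in (0 : ℝ)..L, v x * v x / (L - x) ^ 1 := by
  have o0 := h.o0
  have o1 := h.o1
  have o2 := h.o2
  have o3 := ContinuousOn.vanishesTo_zero h.c3
  have o4 := ContinuousOn.vanishesTo_zero h.c4
  have of : VanishesTo L 0 fun x => v1 x + v3 x - v5 x :=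
    ContinuousOn.vanishesTo_zero ((h.c1.add h.c3).sub h.c5)
  let t : ℕ → (ℝ → ℝ) → (ℝ → ℝ) → ℝ → ℝ := fun n f g x => f x * g x / (L - x) ^ n
  -- `Q` collects the boundary terms of all the integrations by parts, including those used to
  -- complete the squares. Its derivative is the left side of `energy_pointwise`, so only its
  -- endpoint values matter.
  let Q : ℝ → ℝ := fun x => -t 1 v4 v x + t 1 v3 v1 x + t 2 v3 v x - 1 / 2 * t 1 v2 v2 x
    - 2 * t 2 v2 v1 x - 2 * t 3 v2 v x - 33 / 5 * t 3 v1 v1 x - 24 * t 4 v v1 x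
    - 51 / 2 * t 5 v v x + t 1 v2 v x - 1 / 2 * t 1 v1 v1 x - t 2 v v1 x - 5 / 4 * t 3 v v x
    + 1 / 2 * t 1 v v x
  have hQ : ContinuousOn Q (Icc 0 L) := by
    refine .add (.sub (.sub (.sub (.add
      (.sub (.sub (.sub (.sub (.sub (.sub (.add (.add (.neg ?_) ?_) ?_) (.mul
      continuousOn_const ?_)) (.mul continuousOn_const ?_)) (.mul continuousOn_const
      ?_)) (.mul continuousOn_const ?_)) (.mul continuousOn_const ?_)) (.mul
      continuousOn_const ?_)) ?_) (.mul continuousOn_const ?_)) ?_) (.mul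
      continuousOn_const ?_)) (.mul continuousOn_const ?_)
    · exact o4.continuousOn_mul_div 1 o0 (by simp) (by simp)
    · exact o3.continuousOn_mul_div 1 o1 (by simp) (by simp)
    · exact o3.continuousOn_mul_div 2 o0 (by simp) (by simp)
    · exact o2.continuousOn_mul_div 1 o2 (by simp) (by simp)
    · exact o2.continuousOn_mul_div 2 o1 (by simp) (by simp)
    · exact o2.continuousOn_mul_div 3 o0 (by simp) (by simp)
    · exact o1.continuousOn_mul_div 3 o1 (by simp) (by simp)
    · exact o0.continuousOn_mul_div 4 o1 (by simp) (by simp)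
    · exact o0.continuousOn_mul_div 5 o0 (by simp) (by simp)
    · exact o2.continuousOn_mul_div 1 o0 (by simp) (by simp)
    · exact o1.continuousOn_mul_div 1 o1 (by simp) (by simp)
    · exact o0.continuousOn_mul_div 2 o1 (by simp) (by simp)
    · exact o0.continuousOn_mul_div 3 o0 (by simp) (by simp)
    · exact o0.continuousOn_mul_div 1 o0 (by simp) (by simp)
  have i1 := of.intervalIntegrable_mul_div hL.le 1 o0 (by simp)
  have i2 := o0.intervalIntegrable_mul_div hL.le 1 o0 (by simp)
  have i3 := o2.intervalIntegrable_mul_div hL.le 2 o2 (by simp)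
  have key := intervalIntegral.sub_le_integral_of_hasDeriv_right_of_le hL.le hQ
    (φ := fun x => (v1 x + v3 x - v5 x) * v x / (L - x) ^ 1 + v x * v x / (L - x) ^ 1
      - 1 / 10 * (v2 x * v2 x / (L - x) ^ 2)) (g' := fun x => _)
    (fun x hx => by
      have d0 := h.d0 x hx
      have d1 := h.d1 x hx
      have d2 := h.d2 x hx
      have d3 := h.d3 x hx
      have d4 := h.d4 x hx
      have p {f g : ℝ → ℝ} {f' g' : ℝ} (n : ℕ) (hf : HasDerivAt f f' x) (hg : HasDerivAt g g' x) :=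
        hasDerivAt_mul_div_pow n hx.2 hf hg
      exact HasDerivAt.hasDerivWithinAt ((((((((((((((p 1 d4 d0).neg.add (p 1 d3 d1)).add
        (p 2 d3 d0)).sub ((p 1 d2 d2).const_mul (1 / 2))).sub ((p 2 d2 d1).const_mul 2)).sub
        ((p 3 d2 d0).const_mul 2)).sub ((p 3 d1 d1).const_mul (33 / 5))).sub
        ((p 4 d0 d1).const_mul 24)).sub ((p 5 d0 d0).const_mul (51 / 2))).add
        (p 1 d2 d0)).sub ((p 1 d1 d1).const_mul (1 / 2))).sub (p 2 d0 d1)).sub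
        ((p 3 d0 d0).const_mul (5 / 4))).add ((p 1 d0 d0).const_mul (1 / 2))))
    (by
      have := (i1.add i2).sub (i3.const_mul (1 / 10))
      rwa [intervalIntegrable_iff_integrableOn_Icc_of_le hL.le] at this)
    (fun x hx => energy_pointwise (sub_pos.2 hx.2))
  rw [intervalIntegral.integral_sub (i1.add i2) (i3.const_mul _),
    intervalIntegral.integral_add i1 i2, intervalIntegral.integral_const_mul] at key
  -- No boundary contribution arises at `L`: every term of `Q` has limit `0` there, which is also
  -- its value by division by zero.
  have hQL : Q L = 0 := by simp [Q, t]
  -- At `0` only `-v_xx(0)² / (2L)` survives, and its sign is favourable.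
  have hQ0 : Q 0 ≤ 0 := by
    simp only [Q, t, h.z0, h.z1, mul_zero, zero_div, sub_zero, add_zero, zero_sub,
      neg_zero, pow_one]
    have : 0 ≤ v2 0 * v2 0 / L := div_nonneg (mul_self_nonneg _) hL.le
    linarith
  linarith

/-- Hardy's inequality for the second derivative of `v / (L - x)`. -/
theorem IsProfile.hardy (hL : 0 < L) (h : IsProfile L v v1 v2 v3 v4 v5) :
    ∫ x in (0 : ℝ)..L, (v2 x / (L - x) + 2 * v1 x / (L - x) ^ 2 + 2 * v x / (L - x) ^ 3) ^ 2 ≤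
      10 * ∫ x in (0 : ℝ)..L, v2 x * v2 x / (L - x) ^ 2 := by
  have o0 := h.o0
  have o1 := h.o1
  have o2 := h.o2
  let t : ℕ → (ℝ → ℝ) → (ℝ → ℝ) → ℝ → ℝ := fun n f g x => f x * g x / (L - x) ^ n
  -- Both boundary terms vanish: at `L` by the order of vanishing, at `0` because `v` and `v_x`
  -- vanish there.
  let Q : ℝ → ℝ := fun x => -(232 / 25 * t 3 v1 v1 x + 24 / 5 * t 5 v v x)
  have hQ : ContinuousOn Q (Icc 0 L) := by
    refine .neg (.add (.mul continuousOn_const ?_) (.mul continuousOn_const ?_))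
    · exact o1.continuousOn_mul_div 3 o1 (by simp) (by simp)
    · exact o0.continuousOn_mul_div 5 o0 (by simp) (by simp)
  have i3 := o2.intervalIntegrable_mul_div hL.le 2 o2 (by simp)
  have i4 : IntervalIntegrable (fun x => (v2 x / (L - x) + 2 * v1 x / (L - x) ^ 2
      + 2 * v x / (L - x) ^ 3) ^ 2) volume 0 L := by
    have := ((((((i3.add ((o1.intervalIntegrable_mul_div hL.le 4 o1 (by simp)).const_mul 4)).add
      ((o0.intervalIntegrable_mul_div hL.le 6 o0 (by simp)).const_mul 4)).add
      ((o2.intervalIntegrable_mul_div hL.le 3 o1 (by simp)).const_mul 4)).add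
      ((o2.intervalIntegrable_mul_div hL.le 4 o0 (by simp)).const_mul 4)).add
      ((o1.intervalIntegrable_mul_div hL.le 5 o0 (by simp)).const_mul 8)))
    rw [intervalIntegrable_iff_integrableOn_Ioo_of_le hL.le] at this ⊢
    refine this.congr_fun (fun x hx => ?_) measurableSet_Ioo
    have : L - x ≠ 0 := (sub_pos.2 hx.2).ne'
    field_simp
    ring
  have key := intervalIntegral.sub_le_integral_of_hasDeriv_right_of_le hL.le hQ
    (φ := fun x => 10 * (v2 x * v2 x / (L - x) ^ 2) -
      (v2 x / (L - x) + 2 * v1 x / (L - x) ^ 2 + 2 * v x / (L - x) ^ 3) ^ 2) (g' := fun x => _)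
    (fun x hx => by
      have d0 := h.d0 x hx
      have d1 := h.d1 x hx
      exact HasDerivAt.hasDerivWithinAt (((hasDerivAt_mul_div_pow 3 hx.2 d1
        (h.d1 x hx)).const_mul (232 / 25)).add ((hasDerivAt_mul_div_pow 5 hx.2 d0
        (h.d0 x hx)).const_mul (24 / 5))).neg)
    (by
      have := (i3.const_mul 10).sub i4
      rwa [intervalIntegrable_iff_integrableOn_Icc_of_le hL.le] at this)
    (fun x hx => hardy_pointwise (sub_pos.2 hx.2))
  rw [intervalIntegral.integral_sub (i3.const_mul _) i4, intervalIntegral.integral_const_mul] at key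
  have hQL : Q L = 0 := by simp [Q, t]
  have hQ0 : Q 0 = 0 := by simp [Q, t, h.z0, h.z1]
  linarith

end

/-! ### The adjoint operator and its coercivity on test functions. -/

lemma hasDerivAt_iteratedDeriv {f : ℝ → ℝ} (hf : ContDiff ℝ ∞ f) (n : ℕ) (x : ℝ) :
    HasDerivAt (iteratedDeriv n f) (iteratedDeriv (n + 1) f x) x := by
  rw [iteratedDeriv_succ]
  exact ((hf.differentiable_iteratedDeriv n (by exact_mod_cast WithTop.coe_lt_top _)) x).hasDerivAt

lemma contDiff_iteratedDeriv {f : ℝ → ℝ} (hf : ContDiff ℝ ∞ f) (n : ℕ) :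
    ContDiff ℝ ∞ (iteratedDeriv n f) := by
  induction n with
  | zero => simpa using hf
  | succ n ih => rw [iteratedDeriv_succ]; exact (contDiff_infty_iff_deriv.1 ih).2

lemma continuous_iteratedDeriv {f : ℝ → ℝ} (hf : ContDiff ℝ ∞ f) (n : ℕ) :
    Continuous (iteratedDeriv n f) := (contDiff_iteratedDeriv hf n).continuous

/-- Integration by parts for the Kawahara operator. -/
lemma integral_kawahara_adjoint {L : ℝ} {c0 c1 c2 c3 c4 c5 p0 p1 p2 p3 p4 p5 : ℝ → ℝ}
    (hc0 : ∀ x, HasDerivAt c0 (c1 x) x) (hc1 : ∀ x, HasDerivAt c1 (c2 x) x)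
    (hc2 : ∀ x, HasDerivAt c2 (c3 x) x) (hc3 : ∀ x, HasDerivAt c3 (c4 x) x)
    (hc4 : ∀ x, HasDerivAt c4 (c5 x) x) (hc5 : Continuous c5)
    (hp0 : ∀ x, HasDerivAt p0 (p1 x) x) (hp1 : ∀ x, HasDerivAt p1 (p2 x) x)
    (hp2 : ∀ x, HasDerivAt p2 (p3 x) x) (hp3 : ∀ x, HasDerivAt p3 (p4 x) x)
    (hp4 : ∀ x, HasDerivAt p4 (p5 x) x) (hp5 : Continuous p5)
    (b0 : c0 0 = 0) (b0' : c0 L = 0) (b1 : c1 0 = 0) (b1' : c1 L = 0) (b2 : c2 L = 0)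
    (e0 : p0 0 = 0) (e0' : p0 L = 0) (e1 : p1 0 = 0) (e1' : p1 L = 0) (e2 : p2 0 = 0) :
    ∫ x in (0 : ℝ)..L, (c1 x + c3 x - c5 x) * p0 x =
      ∫ x in (0 : ℝ)..L, c0 x * -(p1 x + p3 x - p5 x) := by
  have k {f f' : ℝ → ℝ} (h : ∀ x, HasDerivAt f (f' x) x) : Continuous f :=
    continuous_iff_continuousAt.2 fun x => (h x).continuousAt
  have := k hc0; have := k hc1; have := k hc2; have := k hc3; have := k hc4
  have := k hp0; have := k hp1; have := k hp2; have := k hp3; have := k hp4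
  -- In each boundary product one factor vanishes: at `0` the orders `0, 1` of `c` and `0, 1, 2` of
  -- `p`, at `L` the orders `0, 1, 2` of `c` and `0, 1` of `p`. The two sets of boundary conditions
  -- are dual to each other.
  have key := intervalIntegral.integral_eq_sub_of_hasDerivAt (a := 0) (b := L)
    (f := fun x => c0 x * p0 x + (c2 x * p0 x - c1 x * p1 x + c0 x * p2 x)
      - (c4 x * p0 x - c3 x * p1 x + c2 x * p2 x - c1 x * p3 x + c0 x * p4 x))
    (f' := fun x => (c1 x + c3 x - c5 x) * p0 x - c0 x * -(p1 x + p3 x - p5 x))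
    (fun x _ => by
      have h := ((((hc0 x).fun_mul (hp0 x)).fun_add ((((hc2 x).fun_mul (hp0 x)).fun_sub
        ((hc1 x).fun_mul (hp1 x))).fun_add ((hc0 x).fun_mul (hp2 x)))).fun_sub
        ((((((hc4 x).fun_mul (hp0 x)).fun_sub ((hc3 x).fun_mul (hp1 x))).fun_add
          ((hc2 x).fun_mul (hp2 x))).fun_sub ((hc1 x).fun_mul (hp3 x))).fun_add
          ((hc0 x).fun_mul (hp4 x))))
      exact h.congr_deriv (by ring))
    (Continuous.intervalIntegrable (by fun_prop) _ _)
  rw [intervalIntegral.integral_sub (Continuous.intervalIntegrable (by fun_prop) _ _)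
    (Continuous.intervalIntegrable (by fun_prop) _ _)] at key
  simp only [b0, b0', b1, b1', b2, e0, e0', e1, e1', e2] at key
  linarith

/-- This lets the energy inequality be reused for the adjoint. For `v = (L - x) ψ` one has `v / (L -
x) = ψ`, and `v_xx(L) = -2 ψ'(L) = 0` without any condition on `ψ''(L)`. The condition `ψ''(0) = 0`
enters only in the integral identity. -/
lemma isProfile_mul_test {L : ℝ} {ψ : ℝ → ℝ} (hψ : IsTest L ψ) :
    IsProfile L (fun x => (L - x) * ψ x)
      (fun x => (L - x) * iteratedDeriv 1 ψ x - ψ x)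
      (fun x => (L - x) * iteratedDeriv 2 ψ x - 2 * iteratedDeriv 1 ψ x)
      (fun x => (L - x) * iteratedDeriv 3 ψ x - 3 * iteratedDeriv 2 ψ x)
      (fun x => (L - x) * iteratedDeriv 4 ψ x - 4 * iteratedDeriv 3 ψ x)
      (fun x => (L - x) * iteratedDeriv 5 ψ x - 5 * iteratedDeriv 4 ψ x) ∧
    ∫ x in (0 : ℝ)..L, ((((L - x) * iteratedDeriv 1 ψ x - ψ x)
        + ((L - x) * iteratedDeriv 3 ψ x - 3 * iteratedDeriv 2 ψ x)
        - ((L - x) * iteratedDeriv 5 ψ x - 5 * iteratedDeriv 4 ψ x)) * ψ x) =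
      ∫ x in (0 : ℝ)..L, (L - x) * ψ x *
        -(iteratedDeriv 1 ψ x + iteratedDeriv 3 ψ x - iteratedDeriv 5 ψ x) := by
  obtain ⟨hs, a0, aL, b0, bL, c0⟩ := hψ
  have hc (n : ℕ) := continuous_iteratedDeriv hs n
  have h0 (x : ℝ) : HasDerivAt ψ (iteratedDeriv 1 ψ x) x := by
    simpa using hasDerivAt_iteratedDeriv hs 0 x
  have hcψ := hs.continuous
  have hy (x : ℝ) : HasDerivAt (fun x => L - x) (-1) x := by
    simpa using (hasDerivAt_id x).const_sub L
  have d0 (x : ℝ) : HasDerivAt (fun x => (L - x) * ψ x)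
      ((L - x) * iteratedDeriv 1 ψ x - ψ x) x :=
    ((hy x).fun_mul (h0 x)).congr_deriv (by ring)
  have d (n : ℕ) (x : ℝ) : HasDerivAt
      (fun x => (L - x) * iteratedDeriv (n + 1) ψ x - (n + 1 : ℕ) * iteratedDeriv n ψ x)
      ((L - x) * iteratedDeriv (n + 2) ψ x - (n + 2 : ℕ) * iteratedDeriv (n + 1) ψ x) x :=
    (((hy x).fun_mul (hasDerivAt_iteratedDeriv hs (n + 1) x)).fun_sub
      ((hasDerivAt_iteratedDeriv hs n x).const_mul _)).congr_deriv (by push_cast; ring)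
  have d1 : ∀ x, HasDerivAt (fun x => (L - x) * iteratedDeriv 1 ψ x - ψ x)
      ((L - x) * iteratedDeriv 2 ψ x - 2 * iteratedDeriv 1 ψ x) x := by simpa using d 0
  have d2 := d 1
  have d3 := d 2
  have d4 := d 3
  norm_num [-iteratedDeriv_one] at d2 d3 d4
  have k2 := hc 1; have k3 := hc 2; have k4 := hc 3; have k5 := hc 4; have k6 := hc 5
  refine ⟨⟨?_, ?_, ?_, ?_, ?_, ?_, fun x _ => d0 x, fun x _ => d1 x, fun x _ => d2 x,
    fun x _ => d3 x, fun x _ => d4 x, ?_, ?_, ?_, ?_, ?_⟩, ?_⟩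
  iterate 6 exact Continuous.continuousOn (by fun_prop)
  iterate 5 simp [a0, aL, b0, bL]
  refine integral_kawahara_adjoint d0 d1 d2 d3 d4 (by fun_prop) h0
    (hasDerivAt_iteratedDeriv hs 1) (hasDerivAt_iteratedDeriv hs 2)
    (hasDerivAt_iteratedDeriv hs 3) (hasDerivAt_iteratedDeriv hs 4) k6 ?_ ?_ ?_ ?_ ?_ a0 aL b0 bL c0
  all_goals simp [a0, aL, b0, bL]

/-- Coercivity of the adjoint Kawahara operator on test functions. -/
theorem IsTest.coercive {L : ℝ} (hL : 0 < L) {ψ : ℝ → ℝ} (hψ : IsTest L ψ) :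
    1 / 10 * ∫ x in (0 : ℝ)..L,
        ((L - x) * iteratedDeriv 2 ψ x - 2 * iteratedDeriv 1 ψ x) ^ 2 / (L - x) ^ 2 ≤
      (∫ x in (0 : ℝ)..L, (L - x) * ψ x *
        -(iteratedDeriv 1 ψ x + iteratedDeriv 3 ψ x - iteratedDeriv 5 ψ x)) +
        ∫ x in (0 : ℝ)..L, (L - x) * ψ x ^ 2 := by
  obtain ⟨hp, hadj⟩ := isProfile_mul_test hψ
  have h := hp.energy hL
  rw [← hadj]
  have e (f g : ℝ → ℝ) (hfg : ∀ x ∈ Ioo 0 L, f x = g x) :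
      ∫ x in (0 : ℝ)..L, f x = ∫ x in (0 : ℝ)..L, g x := by
    rw [intervalIntegral_eq_Ioo hL.le, intervalIntegral_eq_Ioo hL.le]
    exact setIntegral_congr_fun measurableSet_Ioo hfg
  refine (le_of_eq ?_).trans (h.trans (le_of_eq ?_))
  · simp only [sq]
  · congr 1 <;> refine e _ _ fun x hx => ?_
    all_goals
      have : L - x ≠ 0 := (sub_pos.2 hx.2).ne'
      field_simp

/-! ### Transfer of derivatives from the source. -/

/-- Moving two derivatives off a function with compact support in `(0, L)`. -/
lemma integral_deriv2_mul {L : ℝ} {e p p1 p2 : ℝ → ℝ} (he : ContDiff ℝ ∞ e)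
    (hs : tsupport e ⊆ Ioo 0 L) (hp : ∀ x ∈ Ioo 0 L, HasDerivAt p (p1 x) x)
    (hp1 : ∀ x ∈ Ioo 0 L, HasDerivAt p1 (p2 x) x) (hp2 : ContinuousOn p2 (Ioo 0 L)) :
    ∫ x in (0 : ℝ)..L, iteratedDeriv 2 e x * p x = ∫ x in (0 : ℝ)..L, e x * p2 x := by
  have hs1 : tsupport (iteratedDeriv 1 e) ⊆ tsupport e := by
    rw [iteratedDeriv_one]; exact tsupport_deriv_subset
  have hs2 : tsupport (iteratedDeriv 2 e) ⊆ tsupport e := by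
    rw [iteratedDeriv_succ]; exact tsupport_deriv_subset.trans hs1
  have hcp : ContinuousOn p (Ioo 0 L) := fun x hx => (hp x hx).continuousAt.continuousWithinAt
  have key (f g : ℝ → ℝ) (hf : Continuous f) (hg : ContinuousOn g (Ioo 0 L))
      (hfe : tsupport f ⊆ tsupport e) : Continuous fun x => f x * g x := by
    refine continuous_of_tsupport fun x hx => ?_
    have hx' : x ∈ Ioo 0 L := hs (hfe (tsupport_mul_subset_left hx))
    exact hf.continuousAt.mul (hg.continuousAt (Ioo_mem_nhds hx'.1 hx'.2))
  have c1 := key _ p (continuous_iteratedDeriv he 2) hcp hs2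
  have c2 := key e p2 he.continuous hp2 le_rfl
  have e0 {x : ℝ} (hx : x ∉ tsupport e) : e x = 0 := image_eq_zero_of_notMem_tsupport hx
  have e1 {x : ℝ} (hx : x ∉ tsupport e) : iteratedDeriv 1 e x = 0 :=
    image_eq_zero_of_notMem_tsupport fun h => hx (hs1 h)
  have e2 {x : ℝ} (hx : x ∉ tsupport e) : iteratedDeriv 2 e x = 0 :=
    image_eq_zero_of_notMem_tsupport fun h => hx (hs2 h)
  have k := intervalIntegral.integral_eq_sub_of_hasDerivAt (a := 0) (b := L)
    (f := fun x => iteratedDeriv 1 e x * p x - e x * p1 x)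
    (f' := fun x => iteratedDeriv 2 e x * p x - e x * p2 x)
    (fun x _ => by
      by_cases hx : x ∈ tsupport e
      · have h0 : HasDerivAt e (iteratedDeriv 1 e x) x := by
          simpa using hasDerivAt_iteratedDeriv he 0 x
        exact (((hasDerivAt_iteratedDeriv he 1 x).fun_mul (hp x (hs hx))).fun_sub
          (h0.fun_mul (hp1 x (hs hx)))).congr_deriv (by ring)
      · rw [e0 hx, e2 hx]
        have : (fun x => iteratedDeriv 1 e x * p x - e x * p1 x) =ᶠ[nhds x] fun _ => 0 := by
          filter_upwards [(isClosed_tsupport e).isOpen_compl.mem_nhds hx] with z hz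
          simp [e0 hz, e1 hz]
        simpa using (hasDerivAt_const x (0 : ℝ)).congr_of_eventuallyEq this)
    ((c1.sub c2).intervalIntegrable _ _)
  rw [intervalIntegral.integral_sub (c1.intervalIntegrable _ _) (c2.intervalIntegrable _ _)] at k
  have h0 : (0 : ℝ) ∉ tsupport e := fun h => (hs h).1.false
  have h1 : L ∉ tsupport e := fun h => (hs h).2.false
  rw [e0 h0, e1 h0, e0 h1, e1 h1] at k
  linarith

/-- The second derivative of `v / (L - x)`. -/
lemma hasDerivAt_div_sub {L : ℝ} {v v1 v2 : ℝ → ℝ} (hv : ∀ x ∈ Ioo 0 L, HasDerivAt v (v1 x) x)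
    (hv1 : ∀ x ∈ Ioo 0 L, HasDerivAt v1 (v2 x) x) :
    (∀ x ∈ Ioo 0 L, HasDerivAt (fun x => v x / (L - x)) (v1 x / (L - x) + v x / (L - x) ^ 2) x) ∧
    ∀ x ∈ Ioo 0 L, HasDerivAt (fun x => v1 x / (L - x) + v x / (L - x) ^ 2)
      (v2 x / (L - x) + 2 * v1 x / (L - x) ^ 2 + 2 * v x / (L - x) ^ 3) x := by
  have k (n : ℕ) {f : ℝ → ℝ} {f' x : ℝ} (hx : x ∈ Ioo 0 L) (hf : HasDerivAt f f' x) :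
      HasDerivAt (fun x => f x / (L - x) ^ n)
        (f' / (L - x) ^ n + n * f x / (L - x) ^ (n + 1)) x := by
    simpa using hasDerivAt_mul_div_pow n hx.2 hf (hasDerivAt_const x (1 : ℝ))
  refine ⟨fun x hx => ?_, fun x hx => ?_⟩
  · simpa using k 1 hx (hv x hx)
  · have := (k 1 hx (hv1 x hx)).fun_add (k 2 hx (hv x hx))
    norm_num at this
    exact this.congr_deriv (by ring)

/-! ### Regularity of weak solutions of the stationary equation. -/

/-- The primitive of a smooth function vanishing at `0`. -/
lemma exists_smooth_primitive {f : ℝ → ℝ} (hf : ContDiff ℝ ∞ f) :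
    ∃ F : ℝ → ℝ, ContDiff ℝ ∞ F ∧ (∀ x, HasDerivAt F (f x) x) ∧ F 0 = 0 := by
  have h (x : ℝ) : HasDerivAt (fun x => ∫ s in (0 : ℝ)..x, f s) (f x) x :=
    hf.continuous.integral_hasStrictDerivAt 0 x |>.hasDerivAt
  refine ⟨_, contDiff_infty_iff_deriv.2 ⟨fun x => (h x).differentiableAt, ?_⟩, h, by simp⟩
  rwa [funext fun x => (h x).deriv]

lemma iteratedDeriv_succ_of_hasDerivAt {F f : ℝ → ℝ} (h : ∀ x, HasDerivAt F (f x) x) (n : ℕ) :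
    iteratedDeriv (n + 1) F = iteratedDeriv n f := by
  rw [iteratedDeriv_succ', funext fun x => (h x).deriv]

/-- A function annihilating all smooth functions orthogonal to `L - x` and `(L - x)²` is a
combination of these two. -/
lemma exists_ae_eq_of_forall_integral {L : ℝ} (hL : 0 < L) {r : ℝ → ℝ}
    (hr : IntervalIntegrable r volume 0 L)
    (h : ∀ η : ℝ → ℝ, ContDiff ℝ ∞ η → ∫ x in (0 : ℝ)..L, (L - x) * η x = 0 →
      ∫ x in (0 : ℝ)..L, (L - x) ^ 2 * η x = 0 → ∫ x in (0 : ℝ)..L, r x * η x = 0) :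
    ∃ a b : ℝ, ∀ᵐ x ∂leb L, r x = a * (L - x) + b * (L - x) ^ 2 := by
  -- `e1, e2` is the basis dual to `L - x, (L - x)²` in their span. Its coefficients are the entries
  -- of the inverse of the Gram matrix, whose entries are `L³/3, L⁴/4, L⁵/5`.
  let e1 : ℝ → ℝ := fun x => 48 / L ^ 3 * (L - x) - 60 / L ^ 4 * (L - x) ^ 2
  let e2 : ℝ → ℝ := fun x => -60 / L ^ 4 * (L - x) + 80 / L ^ 5 * (L - x) ^ 2
  have he1 : ContDiff ℝ ∞ e1 := by fun_prop
  have he2 : ContDiff ℝ ∞ e2 := by fun_prop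
  have hp (a b c : ℝ) : ∫ x in (0 : ℝ)..L, (a * (L - x) ^ 2 + b * (L - x) ^ 3 + c * (L - x) ^ 4)
      = a * L ^ 3 / 3 + b * L ^ 4 / 4 + c * L ^ 5 / 5 := by
    rw [intervalIntegral.integral_eq_sub_of_hasDerivAt
      (f := fun x => -(a * (L - x) ^ 3 / 3 + b * (L - x) ^ 4 / 4 + c * (L - x) ^ 5 / 5))]
    · simp
    · intro x _
      have hy : HasDerivAt (fun x => L - x) (-1) x := by
        simpa using (hasDerivAt_id x).const_sub L
      refine (((((hy.fun_pow 3).const_mul a).div_const 3).fun_add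
        (((hy.fun_pow 4).const_mul b).div_const 4)).fun_add
        (((hy.fun_pow 5).const_mul c).div_const 5)).fun_neg.congr_deriv ?_
      push_cast
      ring
    · exact Continuous.intervalIntegrable (by fun_prop) _ _
  have hL0 := hL.ne'
  have hp' {f : ℝ → ℝ} (a b c : ℝ) (hf : ∀ x, f x = a * (L - x) ^ 2 + b * (L - x) ^ 3 +
      c * (L - x) ^ 4) : ∫ x in (0 : ℝ)..L, f x = a * L ^ 3 / 3 + b * L ^ 4 / 4 + c * L ^ 5 / 5 := by
    rw [← hp, funext hf]
  have p11 : ∫ x in (0 : ℝ)..L, (L - x) * e1 x = 1 := by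
    rw [hp' (48 / L ^ 3) (-60 / L ^ 4) 0 (fun x => by simp only [e1]; ring)]
    field_simp
    norm_num
  have p12 : ∫ x in (0 : ℝ)..L, (L - x) * e2 x = 0 := by
    rw [hp' (-60 / L ^ 4) (80 / L ^ 5) 0 (fun x => by simp only [e2]; ring)]
    field_simp
    norm_num
  have p21 : ∫ x in (0 : ℝ)..L, (L - x) ^ 2 * e1 x = 0 := by
    rw [hp' 0 (48 / L ^ 3) (-60 / L ^ 4) (fun x => by simp only [e1]; ring)]
    field_simp
    norm_num
  have p22 : ∫ x in (0 : ℝ)..L, (L - x) ^ 2 * e2 x = 1 := by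
    rw [hp' 0 (-60 / L ^ 4) (80 / L ^ 5) (fun x => by simp only [e2]; ring)]
    field_simp
    norm_num
  have im {ξ : ℝ → ℝ} (hξ : Continuous ξ) : IntervalIntegrable (fun x => r x * ξ x) volume 0 L :=
    hr.mul_continuousOn hξ.continuousOn
  have three (g θ : ℝ → ℝ) (hθ : Continuous θ) (α β : ℝ)
      (ig : ∀ ξ : ℝ → ℝ, Continuous ξ → IntervalIntegrable (fun x => g x * ξ x) volume 0 L) :
      ∫ x in (0 : ℝ)..L, g x * (θ x - α * e1 x - β * e2 x) = (∫ x in (0 : ℝ)..L, g x * θ x)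
        - α * (∫ x in (0 : ℝ)..L, g x * e1 x) - β * ∫ x in (0 : ℝ)..L, g x * e2 x := by
    have k0 := ig θ hθ
    have k1 := (ig e1 he1.continuous).const_mul α
    have k2 := (ig e2 he2.continuous).const_mul β
    rw [← intervalIntegral.integral_const_mul, ← intervalIntegral.integral_const_mul,
      ← intervalIntegral.integral_sub k0 k1, ← intervalIntegral.integral_sub (k0.sub k1) k2]
    congr 1; ext x; ring
  set a := ∫ x in (0 : ℝ)..L, r x * e1 x
  set b := ∫ x in (0 : ℝ)..L, r x * e2 x
  refine ⟨a, b, ?_⟩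
  let r0 : ℝ → ℝ := fun x => r x - (a * (L - x) + b * (L - x) ^ 2)
  have hr0 : IntervalIntegrable r0 volume 0 L :=
    hr.sub (Continuous.intervalIntegrable (by fun_prop) _ _)
  have hzero (θ : ℝ → ℝ) (hθ : ContDiff ℝ ∞ θ) : ∫ x in (0 : ℝ)..L, r0 x * θ x = 0 := by
    have cθ := hθ.continuous
    set α := ∫ x in (0 : ℝ)..L, (L - x) * θ x with hα
    set β := ∫ x in (0 : ℝ)..L, (L - x) ^ 2 * θ x with hβ
    -- Subtracting the components along `e1` and `e2` makes an arbitrary smooth `θ` admissible in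
    -- `h`.
    have k := h (fun x => θ x - α * e1 x - β * e2 x) (by fun_prop)
      (by
        rw [three _ θ cθ, ← hα, p11, p12]
        · ring
        · exact fun ξ hξ => Continuous.intervalIntegrable (by fun_prop) _ _)
      (by
        rw [three _ θ cθ, ← hβ, p21, p22]
        · ring
        · exact fun ξ hξ => Continuous.intervalIntegrable (by fun_prop) _ _)
    rw [three r θ cθ _ _ fun ξ hξ => im hξ] at k
    have i1 : IntervalIntegrable (fun x => a * ((L - x) * θ x)) volume 0 L :=
      Continuous.intervalIntegrable (by fun_prop) _ _
    have i2 : IntervalIntegrable (fun x => b * ((L - x) ^ 2 * θ x)) volume 0 L :=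
      Continuous.intervalIntegrable (by fun_prop) _ _
    have e : ∫ x in (0 : ℝ)..L, r0 x * θ x = (∫ x in (0 : ℝ)..L, r x * θ x) - a * α - b * β := by
      rw [hα, hβ, ← intervalIntegral.integral_const_mul, ← intervalIntegral.integral_const_mul,
        ← intervalIntegral.integral_sub (im cθ) i1,
        ← intervalIntegral.integral_sub ((im cθ).sub i1) i2]
      congr 1; ext x; simp only [r0]; ring
    rw [e]
    linarith
  have := isOpen_Ioo.ae_eq_zero_of_integral_contDiff_smul_eq_zero (U := Ioo 0 L) (f := r0)
    (μ := volume) ((intervalIntegrable_iff_Ioo hL.le).1 hr0).locallyIntegrableOn (by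
      intro g hg _ hgs
      rw [← setIntegral_eq_integral_of_forall_compl_eq_zero (s := Ioo 0 L)]
      · refine Eq.trans ?_ (hzero g hg)
        rw [intervalIntegral_eq_Ioo hL.le]
        simp only [smul_eq_mul, mul_comm]
      · intro x hx
        rw [image_eq_zero_of_notMem_tsupport fun hx' => hx (hgs hx'), zero_smul])
  rw [ae_restrict_iff' measurableSet_Ioo]
  filter_upwards [this] with x hx hx'
  have := hx hx'
  simp only [r0] at this
  linarith

/-- A weak solution of `v' + v''' - v⁽⁵⁾ = f`, with the boundary conditions encoded in the test
functions, is classical if `f` is continuous. -/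
theorem exists_isProfile {L : ℝ} (hL : 0 < L) {G f : ℝ → ℝ} (hG : IntervalIntegrable G volume 0 L)
    (hG0 : tailInt L G 0 = 0) (hG1 : tailInt L (tailInt L G) 0 = 0)
    (hf : ContinuousOn f (Icc 0 L))
    (hweak : ∀ ψ, IsTest L ψ → ∫ x in (0 : ℝ)..L, tailInt L (tailInt L G) x *
      -(iteratedDeriv 1 ψ x + iteratedDeriv 3 ψ x - iteratedDeriv 5 ψ x) =
        ∫ x in (0 : ℝ)..L, f x * ψ x) :
    ∃ v1 v2 v3 v4 v5 : ℝ → ℝ, IsProfile L (tailInt L (tailInt L G)) v1 v2 v3 v4 v5 ∧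
      v2 =ᵐ[leb L] G ∧ ∀ x, f x = v1 x + v3 x - v5 x := by
  set J := tailInt L with hJ
  set v := J (J G) with hv
  have ii {g : ℝ → ℝ} (hg : ContinuousOn g (Icc 0 L)) : IntervalIntegrable g volume 0 L :=
    ContinuousOn.intervalIntegrable (by rwa [uIcc_of_le hL.le])
  have cJ {g : ℝ → ℝ} (hg : ContinuousOn g (Icc 0 L)) : ContinuousOn (J g) (Icc 0 L) :=
    continuousOn_tailInt hL.le (ii hg)
  have cJG : ContinuousOn (J G) (Icc 0 L) := continuousOn_tailInt hL.le hG
  have cv : ContinuousOn v (Icc 0 L) := cJ cJG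
  have dJ {g : ℝ → ℝ} (hg : ContinuousOn g (Icc 0 L)) {x : ℝ} (hx : x ∈ Ioo 0 L) :
      HasDerivAt (J g) (-g x) x := hasDerivAt_tailInt hg hx
  -- `r` is the equation integrated three times from `L`. Showing that it is a combination of `L -
  -- x` and `(L - x)²` expresses `G = v_xx` through continuous functions.
  let r : ℝ → ℝ := fun x => G x - (v x + J (J v) x + J (J (J f)) x)
  have cr : ContinuousOn (fun x => v x + J (J v) x + J (J (J f)) x) (Icc 0 L) :=
    (cv.add (cJ (cJ cv))).add (cJ (cJ (cJ hf)))
  have hr : IntervalIntegrable r volume 0 L := hG.sub (ii cr)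
  obtain ⟨a, b, hab⟩ := exists_ae_eq_of_forall_integral hL hr (by
    intro η hη h1 h2
    -- The test function is the triple primitive of `η` from `0`. Then `ψ'(L) = ∫ (L - x) η` and `2
    -- ψ(L) = ∫ (L - x)² η`, so the conditions at `L` are precisely the two orthogonality relations.
    -- As `ψ''(L) = ∫ η` is free, no constant appears in the combination.
    obtain ⟨ψ2, s2, d2, z2⟩ := exists_smooth_primitive hη
    obtain ⟨ψ1, s1, d1, z1⟩ := exists_smooth_primitive s2
    obtain ⟨ψ, s0, d0, z0⟩ := exists_smooth_primitive s1
    have y (x : ℝ) : HasDerivAt (fun x => L - x) (-1) x := by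
      simpa using (hasDerivAt_id x).const_sub L
    have l1 : ψ1 L = 0 := by
      have := intervalIntegral.integral_eq_sub_of_hasDerivAt (a := 0) (b := L)
        (f := fun x => (L - x) * ψ2 x + ψ1 x) (f' := fun x => (L - x) * η x)
        (fun x _ => (((y x).fun_mul (d2 x)).fun_add (d1 x)).congr_deriv (by ring))
        (Continuous.intervalIntegrable (by have := hη.continuous; fun_prop) _ _)
      simpa [h1, z2, z1, eq_comm] using this
    have l0 : ψ L = 0 := by
      have := intervalIntegral.integral_eq_sub_of_hasDerivAt (a := 0) (b := L)
        (f := fun x => (L - x) ^ 2 * ψ2 x + 2 * ((L - x) * ψ1 x + ψ x))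
        (f' := fun x => (L - x) ^ 2 * η x)
        (fun x _ => ((((y x).fun_pow 2).fun_mul (d2 x)).fun_add
          ((((y x).fun_mul (d1 x)).fun_add (d0 x)).const_mul 2)).congr_deriv (by push_cast; ring))
        (Continuous.intervalIntegrable (by have := hη.continuous; fun_prop) _ _)
      simpa [h2, z2, z1, z0, eq_comm] using this
    have i1 : iteratedDeriv 1 ψ = ψ1 := by simpa using iteratedDeriv_succ_of_hasDerivAt d0 0
    have i2 : iteratedDeriv 2 ψ = ψ2 := by
      rw [iteratedDeriv_succ_of_hasDerivAt d0]
      simpa using iteratedDeriv_succ_of_hasDerivAt d1 0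
    have i3 : iteratedDeriv 3 ψ = η := by
      rw [iteratedDeriv_succ_of_hasDerivAt d0, iteratedDeriv_succ_of_hasDerivAt d1]
      simpa using iteratedDeriv_succ_of_hasDerivAt d2 0
    have i5 : iteratedDeriv 5 ψ = deriv (deriv η) := by
      rw [iteratedDeriv_succ_of_hasDerivAt d0, iteratedDeriv_succ_of_hasDerivAt d1,
        iteratedDeriv_succ_of_hasDerivAt d2, iteratedDeriv_succ, iteratedDeriv_one]
    have key := hweak ψ ⟨s0, z0, l0, by rw [i1, z1], by rw [i1, l1], by rw [i2, z2]⟩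
    rw [i1, i3, i5] at key
    have one {g ξ ξ' : ℝ → ℝ} (hg : ContinuousOn g (Icc 0 L)) (hξ : ContDiff ℝ ∞ ξ)
        (hd : ∀ x, HasDerivAt ξ (ξ' x) x) (h0 : ξ 0 = 0) :
        ∫ x in (0 : ℝ)..L, g x * ξ x = ∫ x in (0 : ℝ)..L, J g x * ξ' x := by
      have := integral_tailInt_mul_deriv hL.le (ii hg) (hξ.of_le (by exact_mod_cast le_top))
      rw [h0, mul_zero, sub_zero] at this
      rw [← this]
      simp only [fun x => (hd x).deriv, hJ]
    have sη : ContDiff ℝ ∞ (deriv η) := (contDiff_infty_iff_deriv.1 hη).2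
    have sη' : ContDiff ℝ ∞ (deriv (deriv η)) := (contDiff_infty_iff_deriv.1 sη).2
    have k5 : ∫ x in (0 : ℝ)..L, v x * deriv (deriv η) x = ∫ x in (0 : ℝ)..L, G x * η x := by
      have e1 := integral_tailInt_mul_deriv hL.le (ii cJG) (sη.of_le (by exact_mod_cast le_top))
      have e2 := integral_tailInt_mul_deriv hL.le hG (hη.of_le (by exact_mod_cast le_top))
      rw [← hJ, hG0, zero_mul, sub_zero] at e2
      rw [← hJ, ← hv, hG1, zero_mul, sub_zero] at e1
      exact e1.trans e2
    have k1 : ∫ x in (0 : ℝ)..L, v x * ψ1 x = ∫ x in (0 : ℝ)..L, J (J v) x * η x := by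
      rw [one cv s1 d1 z1, one (cJ cv) s2 d2 z2]
    have kf : ∫ x in (0 : ℝ)..L, f x * ψ x = ∫ x in (0 : ℝ)..L, J (J (J f)) x * η x := by
      rw [one hf s0 d0 z0, one (cJ hf) s1 d1 z1, one (cJ (cJ hf)) s2 d2 z2]
    have im {g ξ : ℝ → ℝ} (hg : IntervalIntegrable g volume 0 L) (hξ : ContDiff ℝ ∞ ξ) :
        IntervalIntegrable (fun x => g x * ξ x) volume 0 L :=
      hg.mul_continuousOn hξ.continuous.continuousOn
    have e1 : ∫ x in (0 : ℝ)..L, v x * -(ψ1 x + η x - deriv (deriv η) x) =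
        (∫ x in (0 : ℝ)..L, v x * deriv (deriv η) x) - (∫ x in (0 : ℝ)..L, v x * ψ1 x)
          - ∫ x in (0 : ℝ)..L, v x * η x := by
      rw [← intervalIntegral.integral_sub (im (ii cv) sη') (im (ii cv) s1),
        ← intervalIntegral.integral_sub ((im (ii cv) sη').sub (im (ii cv) s1)) (im (ii cv) hη)]
      congr 1; ext x; ring
    have e2 : ∫ x in (0 : ℝ)..L, r x * η x =
        (∫ x in (0 : ℝ)..L, G x * η x) - ((∫ x in (0 : ℝ)..L, v x * η x)
          + (∫ x in (0 : ℝ)..L, J (J v) x * η x) + ∫ x in (0 : ℝ)..L, J (J (J f)) x * η x) := by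
      rw [← intervalIntegral.integral_add (im (ii cv) hη) (im (ii (cJ (cJ cv))) hη),
        ← intervalIntegral.integral_add ((im (ii cv) hη).add (im (ii (cJ (cJ cv))) hη))
          (im (ii (cJ (cJ (cJ hf)))) hη), ← intervalIntegral.integral_sub (im hG hη)
          (((im (ii cv) hη).add (im (ii (cJ (cJ cv))) hη)).add (im (ii (cJ (cJ (cJ hf)))) hη))]
      congr 1; ext x; simp only [r]; ring
    rw [e1, k5, k1, kf] at key
    rw [e2]
    linarith)
  let v1 : ℝ → ℝ := fun x => -J G x
  -- Every term vanishes at `L`; this is how the natural condition `v_xx(L) = 0` is recovered. The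
  -- functions `v3`, `v4` and the fifth derivative follow by differentiating this formula.
  let v2 : ℝ → ℝ := fun x =>
    v x + J (J v) x + J (J (J f)) x + a * (L - x) + b * (L - x) ^ 2
  let v3 : ℝ → ℝ := fun x => v1 x - J v x - J (J f) x - a - 2 * b * (L - x)
  let v4 : ℝ → ℝ := fun x => v2 x + v x + J f x + 2 * b
  have c2 : ContinuousOn v2 (Icc 0 L) :=
    (cr.add (by fun_prop)).add (by fun_prop)
  have c1 : ContinuousOn v1 (Icc 0 L) := cJG.neg
  have c3 : ContinuousOn v3 (Icc 0 L) :=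
    (((c1.sub (cJ cv)).sub (cJ (cJ hf))).sub continuousOn_const).sub (by fun_prop)
  have c4 : ContinuousOn v4 (Icc 0 L) := ((c2.add cv).add (cJ hf)).add continuousOn_const
  have h2 : v2 =ᵐ[leb L] G := by
    filter_upwards [hab] with x hx
    simp only [r] at hx
    simp only [v2]
    linarith
  have hJ2 : EqOn (J G) (J v2) (Icc 0 L) := fun x hx => by
    refine intervalIntegral.integral_congr_ae ?_
    have := (ae_restrict_iff' measurableSet_Ioo).1 h2
    filter_upwards [this, compl_mem_ae_iff.2 (measure_singleton L)] with z hz hzL hz'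
    rw [uIoc_of_le hx.2] at hz'
    exact (hz ⟨hx.1.trans_lt hz'.1, lt_of_le_of_ne hz'.2 hzL⟩).symm
  have y (x : ℝ) : HasDerivAt (fun x => L - x) (-1) x := by
    simpa using (hasDerivAt_id x).const_sub L
  have d0 {x : ℝ} (hx : x ∈ Ioo 0 L) : HasDerivAt v (v1 x) x := dJ cJG hx
  have d1 {x : ℝ} (hx : x ∈ Ioo 0 L) : HasDerivAt v1 (v2 x) x := by
    have : HasDerivAt (J G) (-v2 x) x := by
      refine (dJ c2 hx).congr_of_eventuallyEq ?_
      filter_upwards [Icc_mem_nhds hx.1 hx.2] with z hz using hJ2 hz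
    simpa using this.fun_neg
  have d2 {x : ℝ} (hx : x ∈ Ioo 0 L) : HasDerivAt v2 (v3 x) x := by
    refine (((((d0 hx).fun_add (dJ (cJ cv) hx)).fun_add (dJ (cJ (cJ hf)) hx)).fun_add
      ((y x).const_mul a)).fun_add (((y x).fun_pow 2).const_mul b)).congr_deriv ?_
    simp only [v3]; push_cast; ring
  have d3 {x : ℝ} (hx : x ∈ Ioo 0 L) : HasDerivAt v3 (v4 x) x := by
    refine (((((d1 hx).fun_sub (dJ cv hx)).fun_sub (dJ (cJ hf) hx)).sub_const a).fun_sub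
      ((y x).const_mul (2 * b))).congr_deriv ?_
    simp only [v4]; ring
  have d4 {x : ℝ} (hx : x ∈ Ioo 0 L) : HasDerivAt v4 (v3 x + v1 x - f x) x := by
    refine ((((d2 hx).fun_add (d0 hx)).fun_add (dJ hf hx)).add_const (2 * b)).congr_deriv ?_
    ring
  refine ⟨v1, v2, v3, v4, fun x => v3 x + v1 x - f x, ⟨cv, c1, c2, c3, c4, (c3.add c1).sub hf,
    fun x => d0, fun x => d1, fun x => d2, fun x => d3, fun x => d4, hG1, ?_, ?_, ?_, ?_⟩, h2,
    fun x => by ring⟩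
  · simp [v1, hG0]
  all_goals simp [v, v1, v2, J]

/-! ### Integrals over the time interval, as a subtype and as a subset of the line. -/

instance (T : ℝ) : IsFiniteMeasure (lebT T) := by
  refine ⟨?_⟩
  rw [lebT, comap_subtype_coe_apply measurableSet_Icc, image_univ, Subtype.range_coe,
    Real.volume_Icc]
  exact ENNReal.ofReal_lt_top

lemma map_lebT (T : ℝ) : (lebT T).map Subtype.val = volume.restrict (Icc 0 T) :=
  map_comap_subtype_coe measurableSet_Icc volume

lemma measurableEmbedding_lebT (T : ℝ) : MeasurableEmbedding (Subtype.val : Icc (0 : ℝ) T → ℝ) :=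
  MeasurableEmbedding.subtype_coe measurableSet_Icc

section time

variable {E : Type*} [NormedAddCommGroup E] {T : ℝ} (hT : 0 ≤ T)

lemma integral_lebT_Iic [NormedSpace ℝ E] (f : Icc (0 : ℝ) T → E) (t : Icc (0 : ℝ) T) :
    ∫ s in Iic t, f s ∂lebT T = ∫ s in (0 : ℝ)..t, IccExtend hT f s := by
  have h : Iic t = Subtype.val ⁻¹' Iic (t : ℝ) := rfl
  have h2 : Iic (t : ℝ) ∩ Icc 0 T = Icc 0 (t : ℝ) := by
    ext x
    exact ⟨fun hx => ⟨hx.2.1, hx.1⟩, fun hx => ⟨hx.2, hx.1, hx.2.trans t.2.2⟩⟩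
  have := (measurableEmbedding_lebT T).setIntegral_map (μ := lebT T) (IccExtend hT f) (Iic (t : ℝ))
  rw [map_lebT, Measure.restrict_restrict measurableSet_Iic, h2, integral_Icc_eq_integral_Ioc,
    ← intervalIntegral.integral_of_le t.2.1] at this
  rw [this, h]
  simp only [IccExtend_val]

lemma integral_lebT [NormedSpace ℝ E] (f : Icc (0 : ℝ) T → E) :
    ∫ s, f s ∂lebT T = ∫ s in (0 : ℝ)..T, IccExtend hT f s := by
  have := integral_lebT_Iic hT f ⟨T, hT, le_rfl⟩
  rw [← this, show Iic (⟨T, hT, le_rfl⟩ : Icc (0 : ℝ) T) = univ from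
    eq_univ_of_forall fun s => s.2.2, Measure.restrict_univ]

lemma ae_lebT_of_ae {p : ℝ → Prop} (h : ∀ᵐ s, s ∈ Ioo 0 T → p s) :
    ∀ᵐ t : Icc (0 : ℝ) T ∂lebT T, p t := by
  have h2 : ∀ᵐ s ∂(lebT T).map Subtype.val, p s := by
    rw [map_lebT, ae_restrict_iff' measurableSet_Icc]
    filter_upwards [h, compl_mem_ae_iff.2 (measure_singleton (0 : ℝ)),
      compl_mem_ae_iff.2 (measure_singleton T)] with s hs h0 hT' hs'
    exact hs ⟨lt_of_le_of_ne hs'.1 (Ne.symm h0), lt_of_le_of_ne hs'.2 hT'⟩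
  exact ae_of_ae_map (measurableEmbedding_lebT T).measurable.aemeasurable h2

lemma ae_of_ae_lebT {p : Icc (0 : ℝ) T → Prop} (h : ∀ᵐ t ∂lebT T, p t) :
    ∀ᵐ s, s ∈ Ioc 0 T → p (projIcc 0 T hT s) := by
  have h2 : ∀ᵐ s ∂(lebT T).map Subtype.val, p (projIcc 0 T hT s) := by
    rw [(measurableEmbedding_lebT T).ae_map_iff]
    filter_upwards [h] with t ht
    rwa [projIcc_val]
  rw [map_lebT, ae_restrict_iff' measurableSet_Icc] at h2
  filter_upwards [h2] with s hs hs'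
  exact hs ⟨hs'.1.le, hs'.2⟩

lemma intervalIntegrable_IccExtend {f : Icc (0 : ℝ) T → E} (hf : Integrable f (lebT T)) :
    IntervalIntegrable (IccExtend hT f) volume 0 T := by
  rw [intervalIntegrable_iff_integrableOn_Icc_of_le hT, IntegrableOn, ← map_lebT,
    (measurableEmbedding_lebT T).integrable_map_iff]
  exact hf.congr (Filter.Eventually.of_forall fun t => (IccExtend_val hT f t).symm)

end time

/-! ### Lions' projection method. -/

section lions

/-- Solvability of a variational problem from an a priori estimate on the test space. -/
lemma exists_inner_eq_of_abs_le {S F : Type*} [AddCommGroup S] [Module ℝ S]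
    [NormedAddCommGroup F] [InnerProductSpace ℝ F] [CompleteSpace F] (K : S →ₗ[ℝ] F)
    (ℓ : S →ₗ[ℝ] ℝ) (M : ℝ) (h : ∀ s, |ℓ s| ≤ M * ‖K s‖) :
    ∃ u : F, ∀ s, inner ℝ u (K s) = ℓ s := by
  -- The functional is defined on the range of `K` through a linear section `g` of `K`, then
  -- extended by Hahn–Banach and represented by Riesz.
  obtain ⟨g, hg⟩ := K.rangeRestrict.exists_rightInverse_of_surjective K.range_rangeRestrict
  have hg' (z : LinearMap.range K) : K (g z) = z := by
    have := LinearMap.congr_fun hg z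
    simpa using congrArg Subtype.val this
  let f : LinearMap.range K →L[ℝ] ℝ := (ℓ.comp g).mkContinuous M fun z => by
    have := h (g z)
    rw [hg'] at this
    simpa using this
  obtain ⟨f', hf', -⟩ := exists_extension_norm_eq (LinearMap.range K) f
  refine ⟨(InnerProductSpace.toDual ℝ F).symm f', fun s => ?_⟩
  rw [InnerProductSpace.toDual_symm_apply]
  have h1 : f' (K s) = ℓ (g ⟨K s, s, rfl⟩) := hf' ⟨K s, s, rfl⟩
  -- The element `g (K s) - s` is killed by `K`, so the bound forces `ℓ` to vanish on it: the choice
  -- of section does not matter.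
  have h2 := h (g ⟨K s, s, rfl⟩ - s)
  rw [map_sub K, hg'] at h2
  simp only [sub_self, norm_zero, mul_zero, abs_nonpos_iff, map_sub] at h2
  rw [h1]
  linarith

variable {V H D : Type*} [NormedAddCommGroup V] [InnerProductSpace ℝ V] [CompleteSpace V]
  [NormedAddCommGroup H] [InnerProductSpace ℝ H] [CompleteSpace H] [AddCommGroup D] [Module ℝ D]
  (j : V →L[ℝ] H) (d : D →ₗ[ℝ] V) (adj : D →ₗ[ℝ] H)

/-- Time-dependent test functions vanishing at the final time. -/
def timeTest (T : ℝ) : Submodule ℝ (ℝ → D) where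
  carrier := {Φ | ContDiff ℝ 1 (fun t => j (d (Φ t))) ∧ Continuous (fun t => d (Φ t)) ∧
    Continuous (fun t => adj (Φ t)) ∧ Φ T = 0}
  add_mem' := by
    rintro Φ Ψ ⟨h1, h2, h3, h4⟩ ⟨k1, k2, k3, k4⟩
    simp only [mem_ofPred_eq, Pi.add_apply, map_add, h4, k4, add_zero, and_true]
    exact ⟨h1.add k1, h2.add k2, h3.add k3⟩
  zero_mem' := by
    simp only [mem_ofPred_eq, Pi.zero_apply, map_zero, and_true]
    exact ⟨contDiff_const, continuous_const, continuous_const⟩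
  smul_mem' := by
    rintro c Φ ⟨h1, h2, h3, h4⟩
    simp only [mem_ofPred_eq, Pi.smul_apply, map_smul, h4, smul_zero, and_true]
    exact ⟨h1.const_smul c, h2.const_smul c, h3.const_smul c⟩

variable {j d adj}

/-- Existence of a weak solution in `L²(0, T; V)` of an abstract evolution equation whose adjoint
is coercive on test elements. -/
theorem exists_weak_solution {T : ℝ} (hT : 0 ≤ T) {c : ℝ} (hc : 0 < c)
    (hcoer : ∀ φ, c * ‖d φ‖ ^ 2 ≤ inner ℝ (j (d φ)) (adj φ) + ‖j (d φ)‖ ^ 2)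
    (W₀ : H) {F : ℝ → H} (hF : Continuous F) :
    ∃ W : Lp V 2 (lebT T), ∀ φ, ∀ᵐ t ∂lebT T, inner ℝ (j (W t)) (j (d φ)) =
      inner ℝ W₀ (j (d φ)) + ∫ s in (0 : ℝ)..t,
        (inner ℝ (F s) (j (d φ)) - inner ℝ (j (IccExtend hT W s)) (adj φ)) := by
  let g : timeTest j d adj T → ℝ → H := fun Φ t => j (d (Φ.1 t))
  have hg (Φ : timeTest j d adj T) : ContDiff ℝ 1 (g Φ) := Φ.2.1
  have hg' (Φ : timeTest j d adj T) (t : ℝ) : HasDerivAt (g Φ) (deriv (g Φ) t) t :=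
    ((hg Φ).differentiable one_ne_zero t).hasDerivAt
  have cg' (Φ : timeTest j d adj T) : Continuous (deriv (g Φ)) := (hg Φ).continuous_deriv le_rfl
  have cg (Φ : timeTest j d adj T) : Continuous (g Φ) := (hg Φ).continuous
  have cd (Φ : timeTest j d adj T) : Continuous fun t => d (Φ.1 t) := Φ.2.2.1
  have ca (Φ : timeTest j d adj T) : Continuous fun t => adj (Φ.1 t) := Φ.2.2.2.1
  -- The Hilbert adjoint of `j` turns the pairing of `j u` with `adj Φ - (j d Φ)'` in `H` into an
  -- inner product in `V`. The weak formulation thereby reads `⟪u, K Φ⟫ = ℓ Φ` in `L²(0, T; V)`.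
  let k : timeTest j d adj T → C(Icc (0 : ℝ) T, V) := fun Φ =>
    ⟨fun t => j.adjoint (adj (Φ.1 t) - deriv (g Φ) t),
      j.adjoint.continuous.comp (((ca Φ).sub (cg' Φ)).comp continuous_subtype_val)⟩
  let K : timeTest j d adj T →ₗ[ℝ] Lp V 2 (lebT T) :=
    { toFun := fun Φ => ContinuousMap.toLp 2 (lebT T) ℝ (k Φ)
      map_add' := fun Φ Ψ => by
        rw [← map_add]
        congr 1
        ext t
        have : deriv (g (Φ + Ψ)) t = deriv (g Φ) t + deriv (g Ψ) t := by
          refine HasDerivAt.deriv (((hg' Φ t).fun_add (hg' Ψ t)).congr_of_eventuallyEq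
            (Filter.Eventually.of_forall fun s => ?_))
          simp [g]
        simp only [k, ContinuousMap.coe_mk, ContinuousMap.add_apply, this, ← map_add]
        congr 1
        simp only [Submodule.coe_add, Pi.add_apply, map_add]
        abel
      map_smul' := fun a Φ => by
        rw [RingHom.id_apply, ← map_smul]
        congr 1
        ext t
        have : deriv (g (a • Φ)) t = a • deriv (g Φ) t := by
          refine HasDerivAt.deriv (((hg' Φ t).fun_const_smul a).congr_of_eventuallyEq
            (Filter.Eventually.of_forall fun s => ?_))
          simp [g]
        simp only [k, ContinuousMap.coe_mk, ContinuousMap.smul_apply, this, ← map_smul]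
        congr 1
        simp only [Submodule.coe_smul, Pi.smul_apply, map_smul, smul_sub] }
  have hK (u : Lp V 2 (lebT T)) (Φ : timeTest j d adj T) : inner ℝ u (K Φ) =
      ∫ t, inner ℝ (j (u t)) (adj (Φ.1 t) - deriv (g Φ) t) ∂lebT T := by
    rw [L2.inner_def]
    refine integral_congr_ae ?_
    filter_upwards [ContinuousMap.coeFn_toLp (p := 2) (𝕜 := ℝ) (lebT T) (k Φ)] with t ht
    change inner ℝ (u t) ((ContinuousMap.toLp 2 (lebT T) ℝ (k Φ)) t) = _
    rw [ht]
    exact ContinuousLinearMap.adjoint_inner_right j _ _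
  have ci (Φ : timeTest j d adj T) : Continuous fun t => inner ℝ (F t) (g Φ t) :=
    hF.inner (cg Φ)
  let ℓ : timeTest j d adj T →ₗ[ℝ] ℝ :=
    { toFun := fun Φ => inner ℝ W₀ (g Φ 0) + ∫ t in (0 : ℝ)..T, inner ℝ (F t) (g Φ t)
      map_add' := fun Φ Ψ => by
        have : ∀ t, g (Φ + Ψ) t = g Φ t + g Ψ t := fun t => by simp [g]
        simp only [this, inner_add_right]
        rw [intervalIntegral.integral_add ((ci Φ).intervalIntegrable _ _)
          ((ci Ψ).intervalIntegrable _ _)]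
        ring
      map_smul' := fun a Φ => by
        have : ∀ t, g (a • Φ) t = a • g Φ t := fun t => by simp [g]
        simp only [this, inner_smul_right, RingHom.id_apply, intervalIntegral.integral_const_mul,
          smul_eq_mul]
        ring }
  have hbound : ∃ M, ∀ Φ, |ℓ Φ| ≤ M * ‖K Φ‖ := by
    let F' : Lp H 2 (lebT T) := ContinuousMap.toLp 2 (lebT T) ℝ ⟨fun t => F t, by fun_prop⟩
    let B := Real.exp (2 * T) * (1 + 2 / c)
    refine ⟨‖W₀‖ * B + ‖F'‖ * (‖j‖ * B), fun Φ => ?_⟩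
    let y : Lp V 2 (lebT T) := ContinuousMap.toLp 2 (lebT T) ℝ
      ⟨fun t => d (Φ.1 t), (cd Φ).comp continuous_subtype_val⟩
    have hy : y =ᵐ[lebT T] fun t => d (Φ.1 t) := ContinuousMap.coeFn_toLp (lebT T) _
    have hF' : F' =ᵐ[lebT T] fun t => F t := ContinuousMap.coeFn_toLp (lebT T) _
    -- `K Φ` is paired with `e^{2t} d Φ`. As `Φ` vanishes at `T`, the time derivative contributes
    -- `1/2 ‖j d Φ(0)‖²` and `∫ e^{2t} ‖j d Φ‖²`; the latter is the zeroth-order term required by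
    -- the coercivity hypothesis.
    let w : Lp V 2 (lebT T) := ContinuousMap.toLp 2 (lebT T) ℝ
      ⟨fun t => Real.exp (2 * t) • d (Φ.1 t), by
        have h := (cd Φ).comp (continuous_subtype_val (p := fun t => t ∈ Icc (0 : ℝ) T))
        exact Continuous.smul (by fun_prop) h⟩
    have hw : w =ᵐ[lebT T] fun t => Real.exp (2 * t) • d (Φ.1 t) :=
      ContinuousMap.coeFn_toLp (lebT T) _
    have hwy : ‖w‖ ≤ Real.exp (2 * T) * ‖y‖ := by
      refine Lp.norm_le_mul_norm_of_ae_le_mul ?_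
      filter_upwards [hy, hw] with t h1 h2
      rw [h1, h2, norm_smul, Real.norm_eq_abs, Real.abs_exp]
      have := t.2.2
      gcongr
    have hyy : ‖y‖ ^ 2 = ∫ t in (0 : ℝ)..T, ‖d (Φ.1 t)‖ ^ 2 := by
      rw [← real_inner_self_eq_norm_sq, L2.inner_def, ← (integral_lebT hT fun t => ‖d (Φ.1 t)‖ ^ 2 :
        _ = _) |>.trans (intervalIntegral.integral_congr fun s hs => ?_)]
      · refine integral_congr_ae ?_
        filter_upwards [hy] with t ht
        rw [ht, real_inner_self_eq_norm_sq]
      · rw [uIcc_of_le hT] at hs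
        simp only [IccExtend_of_mem hT _ hs]
    have cn : Continuous fun t => ‖g Φ t‖ ^ 2 := by have := cg Φ; fun_prop
    have cga : Continuous fun t => inner ℝ (g Φ t) (adj (Φ.1 t)) := (cg Φ).inner (ca Φ)
    have cgg : Continuous fun t => inner ℝ (g Φ t) (deriv (g Φ) t) := (cg Φ).inner (cg' Φ)
    have cexp : Continuous fun t : ℝ => Real.exp (2 * t) := by fun_prop
    have hE : inner ℝ w (K Φ) = 1 / 2 * ‖g Φ 0‖ ^ 2 +
        ∫ t in (0 : ℝ)..T, Real.exp (2 * t) *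
          (inner ℝ (g Φ t) (adj (Φ.1 t)) + ‖g Φ t‖ ^ 2) := by
      have h1 : inner ℝ w (K Φ) = ∫ t in (0 : ℝ)..T, (Real.exp (2 * t) *
          inner ℝ (g Φ t) (adj (Φ.1 t)) - Real.exp (2 * t) * inner ℝ (g Φ t) (deriv (g Φ) t)) := by
        rw [hK, ← (integral_lebT hT fun t => Real.exp (2 * t) * inner ℝ (g Φ t) (adj (Φ.1 t)) -
          Real.exp (2 * t) * inner ℝ (g Φ t) (deriv (g Φ) t) :
            _ = _) |>.trans (intervalIntegral.integral_congr fun s hs => ?_)]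
        · refine integral_congr_ae ?_
          filter_upwards [hw] with t ht
          rw [ht, map_smul, real_inner_smul_left, inner_sub_right, mul_sub]
        · rw [uIcc_of_le hT] at hs
          simp only [IccExtend_of_mem hT _ hs]
      have h2 := intervalIntegral.integral_eq_sub_of_hasDerivAt (a := 0) (b := T)
        (f := fun t => Real.exp (2 * t) * ‖g Φ t‖ ^ 2)
        (f' := fun t => 2 * (Real.exp (2 * t) * inner ℝ (g Φ t) (deriv (g Φ) t)) +
          2 * (Real.exp (2 * t) * ‖g Φ t‖ ^ 2)) (fun t _ => by
          have e1 : HasDerivAt (fun t : ℝ => Real.exp (2 * t)) (Real.exp (2 * t) * (2 * 1)) t :=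
            ((hasDerivAt_id t).const_mul 2).exp
          exact (e1.fun_mul (hg' Φ t).norm_sq).congr_deriv (by ring))
        (Continuous.intervalIntegrable (by fun_prop) _ _)
      have hΦT : g Φ T = 0 := by
        have : Φ.1 T = 0 := Φ.2.2.2.2
        simp [g, this]
      rw [intervalIntegral.integral_add (Continuous.intervalIntegrable (by fun_prop) _ _)
        (Continuous.intervalIntegrable (by fun_prop) _ _), intervalIntegral.integral_const_mul,
        intervalIntegral.integral_const_mul, hΦT] at h2
      rw [h1, intervalIntegral.integral_sub (Continuous.intervalIntegrable (by fun_prop) _ _)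
        (Continuous.intervalIntegrable (by fun_prop) _ _)]
      simp only [mul_add]
      rw [intervalIntegral.integral_add (Continuous.intervalIntegrable (by fun_prop) _ _)
        (Continuous.intervalIntegrable (by fun_prop) _ _)]
      simp only [norm_zero, mul_zero, Real.exp_zero, one_mul] at h2
      norm_num at h2
      linarith
    have hEge : 1 / 2 * ‖g Φ 0‖ ^ 2 + c * ‖y‖ ^ 2 ≤ inner ℝ w (K Φ) := by
      rw [hE, hyy, ← intervalIntegral.integral_const_mul]
      gcongr
      refine intervalIntegral.integral_mono_on hT
        (((cd Φ).norm.pow 2).const_mul c |>.intervalIntegrable _ _)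
        (Continuous.intervalIntegrable (by fun_prop) _ _) fun t ht => ?_
      have h1 := hcoer (Φ.1 t)
      have h2 : 1 ≤ Real.exp (2 * t) := Real.one_le_exp (by linarith [ht.1])
      have h3 : 0 ≤ c * ‖d (Φ.1 t)‖ ^ 2 := by positivity
      calc c * ‖d (Φ.1 t)‖ ^ 2 ≤ Real.exp (2 * t) * (c * ‖d (Φ.1 t)‖ ^ 2) := by nlinarith
        _ ≤ _ := by gcongr
    have hEle : inner ℝ w (K Φ) ≤ Real.exp (2 * T) * ‖y‖ * ‖K Φ‖ :=
      (real_inner_le_norm w (K Φ)).trans (by gcongr)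
    have hmain := hEge.trans hEle
    set e := Real.exp (2 * T)
    have he : 0 < e := Real.exp_pos _
    have hyB : ‖y‖ ≤ e / c * ‖K Φ‖ := by
      rcases (norm_nonneg y).eq_or_lt with h0 | h0
      · rw [← h0]; positivity
      · rw [div_mul_eq_mul_div, le_div_iff₀ hc]
        have : 0 ≤ ‖g Φ 0‖ ^ 2 := by positivity
        nlinarith
    -- `B` is large enough for both quantities in `ℓ`: it exceeds `e / c`, and `B²` exceeds `2 e² /
    -- c`.
    have hyB' : ‖y‖ ≤ B * ‖K Φ‖ := by
      refine hyB.trans ?_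
      gcongr
      simp only [B]
      have : 0 ≤ e / c := by positivity
      have h2 : e * (1 + 2 / c) = e + 2 * (e / c) := by ring
      rw [h2]
      linarith
    have hgB : ‖g Φ 0‖ ≤ B * ‖K Φ‖ := by
      refine abs_le_of_sq_le_sq' ?_ (by positivity) |>.2
      have h1 : ‖g Φ 0‖ ^ 2 ≤ 2 * (e * (e / c * ‖K Φ‖) * ‖K Φ‖) := by
        have h3 : e * ‖y‖ * ‖K Φ‖ ≤ e * (e / c * ‖K Φ‖) * ‖K Φ‖ := by gcongr
        have h4 : 0 ≤ c * ‖y‖ ^ 2 := by positivity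
        linarith
      refine h1.trans (sub_nonneg.1 ?_)
      have h2 : (B * ‖K Φ‖) ^ 2 - 2 * (e * (e / c * ‖K Φ‖) * ‖K Φ‖) =
          e ^ 2 * ‖K Φ‖ ^ 2 * ((1 + 2 / c) ^ 2 - 2 / c) := by simp only [B]; ring
      rw [h2]
      have h3 : 0 ≤ 2 / c := by positivity
      exact mul_nonneg (by positivity) (by nlinarith)
    have hFj : ∫ t in (0 : ℝ)..T, inner ℝ (F t) (g Φ t) =
        inner ℝ F' (j.compLpL 2 (lebT T) y) := by
      rw [L2.inner_def]
      refine (intervalIntegral.integral_congr fun s hs => ?_).trans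
        ((integral_lebT hT fun t => inner ℝ (F t) (g Φ t)).symm.trans (integral_congr_ae ?_))
      · rw [uIcc_of_le hT] at hs
        simp only [IccExtend_of_mem hT _ hs]
      · filter_upwards [hy, hF', j.coeFn_compLpL y] with t h1 h2 h3
        rw [h2, h3, h1]
    calc |ℓ Φ| = |inner ℝ W₀ (g Φ 0) + inner ℝ F' (j.compLpL 2 (lebT T) y)| := by
          rw [← hFj]; rfl
      _ ≤ |inner ℝ W₀ (g Φ 0)| + |inner ℝ F' (j.compLpL 2 (lebT T) y)| := abs_add_le _ _
      _ ≤ ‖W₀‖ * ‖g Φ 0‖ + ‖F'‖ * ‖j.compLpL 2 (lebT T) y‖ :=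
          add_le_add (abs_real_inner_le_norm _ _) (abs_real_inner_le_norm _ _)
      _ ≤ ‖W₀‖ * (B * ‖K Φ‖) + ‖F'‖ * (‖j‖ * (B * ‖K Φ‖)) := by
          have : ‖j.compLpL 2 (lebT T) y‖ ≤ ‖j‖ * ‖y‖ := j.norm_compLp_le y
          have h2 : ‖j‖ * ‖y‖ ≤ ‖j‖ * (B * ‖K Φ‖) := by gcongr
          gcongr
          exact this.trans h2
      _ = _ := by ring
  obtain ⟨M, hM⟩ := hbound
  obtain ⟨W, hW⟩ := exists_inner_eq_of_abs_le K ℓ M hM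
  refine ⟨W, fun φ => ?_⟩
  have iW (x : H) : IntervalIntegrable (fun s => inner ℝ (j (IccExtend hT W s)) x) volume 0 T := by
    have h1 : MemLp (fun t => inner ℝ (j (W t)) x) 2 (lebT T) :=
      ((j.comp_memLp W).inner_const x)
    simpa [Function.comp_def, IccExtend] using
      intervalIntegrable_IccExtend hT (h1.integrable (by norm_num))
  set r : ℝ → ℝ := fun s => inner ℝ (F s) (j (d φ)) - inner ℝ (j (IccExtend hT W s)) (adj φ)
    with hr
  have cF : Continuous fun s => inner ℝ (F s) (j (d φ)) := hF.inner continuous_const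
  have ir : IntervalIntegrable r volume 0 T := (cF.intervalIntegrable _ _).sub (iW _)
  have cR : ContinuousOn (fun t => ∫ s in (0 : ℝ)..t, r s) (Icc 0 T) := by
    have := intervalIntegral.continuousOn_primitive_interval' ir left_mem_uIcc
    rwa [uIcc_of_le hT] at this
  let z : ℝ → ℝ := fun t => inner ℝ (j (IccExtend hT W t)) (j (d φ)) -
    (inner ℝ W₀ (j (d φ)) + ∫ s in (0 : ℝ)..t, r s)
  have iz : IntervalIntegrable z volume 0 T :=
    (iW _).sub (ContinuousOn.intervalIntegrable (by
      rw [uIcc_of_le hT]; exact continuousOn_const.add cR))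
  have key : ∀ η : ℝ → ℝ, ContDiff ℝ ∞ η → ∫ t in (0 : ℝ)..T, η t * z t = 0 := by
    intro η hη
    -- Separated test functions `θ(t) φ` with `θ(T) = 0` and `θ' = -η`. Since `η` is arbitrary, they
    -- yield the equation integrated in time, initial value included, for almost every `t`.
    let θ := tailInt T η
    have dθ (t : ℝ) : HasDerivAt θ (-η t) t :=
      intervalIntegral.integral_hasDerivAt_left (hη.continuous.intervalIntegrable _ _)
        (hη.continuous.stronglyMeasurableAtFilter _ _) hη.continuous.continuousAt
    have hdθ : deriv θ = fun t => -η t := funext fun t => (dθ t).deriv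
    have sθ : ContDiff ℝ 1 θ :=
      contDiff_one_iff_deriv.2 ⟨fun t => (dθ t).differentiableAt, by
        rw [hdθ]; exact hη.continuous.neg⟩
    have cθ := sθ.continuous
    let Φ : timeTest j d adj T := ⟨fun t => θ t • φ, by
      refine ⟨?_, ?_, ?_, by simp [θ]⟩ <;> simp only [map_smul]
      · exact sθ.smul contDiff_const
      · fun_prop
      · fun_prop⟩
    have h1 := hW Φ
    have gΦ : g Φ = fun t => θ t • j (d φ) := by ext t; simp [g, Φ]
    have dgΦ (t : ℝ) : deriv (g Φ) t = -(η t • j (d φ)) := by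
      rw [gΦ, ((dθ t).smul_const _).deriv, neg_smul]
    have h2 : inner ℝ W (K Φ) = ∫ t in (0 : ℝ)..T,
        (θ t * inner ℝ (j (IccExtend hT W t)) (adj φ) +
          η t * inner ℝ (j (IccExtend hT W t)) (j (d φ))) := by
      rw [hK, integral_lebT hT]
      refine intervalIntegral.integral_congr fun s hs => ?_
      rw [uIcc_of_le hT] at hs
      simp only [IccExtend_of_mem hT _ hs, dgΦ, Φ, map_smul, inner_sub_right, inner_neg_right,
        real_inner_smul_right]
      ring
    have h3 : ℓ Φ = θ 0 * inner ℝ W₀ (j (d φ)) +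
        ∫ t in (0 : ℝ)..T, θ t * inner ℝ (F t) (j (d φ)) := by
      change inner ℝ W₀ (g Φ 0) + ∫ t in (0 : ℝ)..T, inner ℝ (F t) (g Φ t) = _
      simp only [gΦ, real_inner_smul_right]
    have h4 := integral_tailInt_mul_deriv hT ir sθ
    have hθ0 : θ 0 = ∫ t in (0 : ℝ)..T, η t := rfl
    have i1 := (iW (adj φ)).continuousOn_mul cθ.continuousOn
    have i2 := (iW (j (d φ))).continuousOn_mul hη.continuous.continuousOn
    have i3 : IntervalIntegrable (fun t => θ t * inner ℝ (F t) (j (d φ))) volume 0 T :=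
      (cθ.mul cF).intervalIntegrable _ _
    have i4 : IntervalIntegrable (fun t => η t * tailInt T r t) volume 0 T :=
      ContinuousOn.intervalIntegrable (by
        rw [uIcc_of_le hT]
        exact hη.continuous.continuousOn.mul (continuousOn_tailInt hT ir))
    have i5 : IntervalIntegrable (fun t => (inner ℝ W₀ (j (d φ)) + tailInt T r 0) * η t)
        volume 0 T := (hη.continuous.const_mul _).intervalIntegrable _ _
    have h5 : ∫ t in (0 : ℝ)..T, η t * z t =
        (∫ t in (0 : ℝ)..T, η t * inner ℝ (j (IccExtend hT W t)) (j (d φ)))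
          + (∫ t in (0 : ℝ)..T, η t * tailInt T r t)
          - ∫ t in (0 : ℝ)..T, (inner ℝ W₀ (j (d φ)) + tailInt T r 0) * η t := by
      rw [← intervalIntegral.integral_add i2 i4, ← intervalIntegral.integral_sub (i2.add i4) i5]
      refine intervalIntegral.integral_congr fun s hs => ?_
      rw [uIcc_of_le hT] at hs
      simp only [z, tailInt_eq hT ir hs]
      ring
    have h6 : ∫ t in (0 : ℝ)..T, r t * θ t = (∫ t in (0 : ℝ)..T, θ t * inner ℝ (F t) (j (d φ)))
        - ∫ t in (0 : ℝ)..T, θ t * inner ℝ (j (IccExtend hT W t)) (adj φ) := by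
      rw [← intervalIntegral.integral_sub i3 i1]
      refine intervalIntegral.integral_congr fun s _ => ?_
      simp only [r]
      ring
    have h7 : ∫ t in (0 : ℝ)..T, tailInt T r t * deriv θ t =
        -∫ t in (0 : ℝ)..T, η t * tailInt T r t := by
      rw [← intervalIntegral.integral_neg, hdθ]
      refine intervalIntegral.integral_congr fun s _ => ?_
      ring
    rw [h2, intervalIntegral.integral_add i1 i2, h3] at h1
    rw [h5, intervalIntegral.integral_const_mul, ← hθ0]
    linarith
  have := isOpen_Ioo.ae_eq_zero_of_integral_contDiff_smul_eq_zero (U := Ioo 0 T) (f := z)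
    (μ := volume) ((intervalIntegrable_iff_Ioo hT).1 iz).locallyIntegrableOn (by
      intro η hη _ hs
      rw [← setIntegral_eq_integral_of_forall_compl_eq_zero (s := Ioo 0 T)]
      · refine Eq.trans ?_ (key η hη)
        rw [intervalIntegral_eq_Ioo hT]
        simp only [smul_eq_mul]
      · intro x hx
        rw [image_eq_zero_of_notMem_tsupport fun hx' => hx (hs hx'), zero_smul])
  filter_upwards [ae_lebT_of_ae this] with t ht
  simp only [z, IccExtend_val, sub_eq_zero] at ht
  exact ht

end lions

/-! ### The abstract evolution equation and its regular solutions. -/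

/-- The functional-analytic data of an evolution equation `u' + A u = q h`, in weak form: `V` is
the energy space, `H` the pivot space, `D` the test elements with the adjoint operator `adj`, `C` a
space of regular elements on which the operator `A` and the source operator `q` are defined, and `X`
the space of the sources. -/
structure Frame (V H X D C : Type*) [NormedAddCommGroup V] [InnerProductSpace ℝ V]
    [NormedAddCommGroup H] [InnerProductSpace ℝ H] [NormedAddCommGroup X] [InnerProductSpace ℝ X]
    [AddCommGroup D] [Module ℝ D] [AddCommGroup C] [Module ℝ C] where
  /-- the embedding of the energy space into the pivot space -/
  j : V →L[ℝ] H
  /-- test elements as elements of the energy space -/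
  d : D →ₗ[ℝ] V
  /-- the adjoint operator -/
  adj : D →ₗ[ℝ] H
  /-- the adjoint of the source operator -/
  b : D →ₗ[ℝ] X
  /-- regular elements as elements of the energy space -/
  κ : C →ₗ[ℝ] V
  /-- regular elements as sources -/
  ι : C →ₗ[ℝ] X
  /-- the operator on regular elements -/
  A : C →ₗ[ℝ] C
  /-- the source operator on regular elements -/
  q : C →ₗ[ℝ] C
  /-- the coercivity constant -/
  c : ℝ
  /-- the bound of the source operator -/
  M : ℝ
  c_pos : 0 < c
  M_nonneg : 0 ≤ M
  coercive : ∀ φ, c * ‖d φ‖ ^ 2 ≤ inner ℝ (j (d φ)) (adj φ) + ‖j (d φ)‖ ^ 2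
  adj_κ : ∀ e φ, inner ℝ (j (κ (A e))) (j (d φ)) = inner ℝ (j (κ e)) (adj φ)
  q_κ : ∀ e φ, inner ℝ (j (κ (q e))) (j (d φ)) = inner ℝ (ι e) (b φ)
  -- The premise is the stationary weak equation with time derivative `g`. Coercivity on test
  -- elements does not imply this bound, as `v` need not be a test element; it rests on regularity,
  -- for which `g` is taken in `V` and `e` among the regular elements.
  energy : ∀ v g e, (∀ φ, inner ℝ (j v) (adj φ) = inner ℝ (ι e) (b φ) - inner ℝ (j g) (j (d φ))) →
    c * ‖v‖ ^ 2 ≤ -inner ℝ (j g) (j v) + ‖j v‖ ^ 2 + M * ‖ι e‖ ^ 2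
  denseRange_κ : DenseRange fun e => j (κ e)
  denseRange_ι : DenseRange ι
  j_injective : Function.Injective j

namespace Frame

variable {V H X D C : Type*} [NormedAddCommGroup V] [InnerProductSpace ℝ V]
    [NormedAddCommGroup H] [InnerProductSpace ℝ H] [NormedAddCommGroup X] [InnerProductSpace ℝ X]
    [AddCommGroup D] [Module ℝ D] [AddCommGroup C] [Module ℝ C] (𝓕 : Frame V H X D C)

/-- `u` is a `C¹` function with values in `V` and derivative `u₁`, solving the equation with
source `h` on `[0, T]`. -/
structure IsRegularSol (T : ℝ) (u u₁ : ℝ → V) (h : ℝ → C) : Prop where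
  hasDerivAt : ∀ t, HasDerivAt u (u₁ t) t
  continuous_deriv : Continuous u₁
  continuous_source : Continuous fun t => 𝓕.ι (h t)
  eqn : ∀ t ∈ Icc 0 T, ∀ φ, inner ℝ (𝓕.j (u₁ t)) (𝓕.j (𝓕.d φ)) + inner ℝ (𝓕.j (u t)) (𝓕.adj φ) =
    inner ℝ (𝓕.ι (h t)) (𝓕.b φ)

variable {𝓕}

lemma IsRegularSol.continuous {T : ℝ} {u u₁ : ℝ → V} {h : ℝ → C} (hu : 𝓕.IsRegularSol T u u₁ h) :
    Continuous u := continuous_iff_continuousAt.2 fun t => (hu.hasDerivAt t).continuousAt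

/-- Gronwall's argument: the factor `e^{-2t}` cancels the term `‖j u‖²` in `Frame.energy`. On `[0,
T]` the bounds `e^{-2T} ≤ e^{-2s} ≤ 1` then remove the factor from the two integrals. -/
lemma IsRegularSol.energy_le {T : ℝ} {u u₁ : ℝ → V} {h : ℝ → C} (hu : 𝓕.IsRegularSol T u u₁ h)
    {t : ℝ} (ht : t ∈ Icc 0 T) :
    Real.exp (-2 * t) * ‖𝓕.j (u t)‖ ^ 2 +
        2 * 𝓕.c * Real.exp (-2 * T) * ∫ s in (0 : ℝ)..t, ‖u s‖ ^ 2 ≤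
      ‖𝓕.j (u 0)‖ ^ 2 + 2 * 𝓕.M * ∫ s in (0 : ℝ)..t, ‖𝓕.ι (h s)‖ ^ 2 := by
  have cu := hu.continuous
  have ch := hu.continuous_source
  have d1 (s : ℝ) : HasDerivAt (fun s => Real.exp (-2 * s) * ‖𝓕.j (u s)‖ ^ 2)
      (2 * Real.exp (-2 * s) * (inner ℝ (𝓕.j (u s)) (𝓕.j (u₁ s)) - ‖𝓕.j (u s)‖ ^ 2)) s := by
    have e1 : HasDerivAt (fun t : ℝ => Real.exp (-2 * t)) (Real.exp (-2 * s) * (-2 * 1)) s :=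
      ((hasDerivAt_id s).const_mul (-2)).exp
    have e2 : HasDerivAt (fun t => 𝓕.j (u t)) (𝓕.j (u₁ s)) s :=
      𝓕.j.hasFDerivAt.comp_hasDerivAt s (hu.hasDerivAt s)
    exact (e1.fun_mul e2.norm_sq).congr_deriv (by ring)
  have i1 : IntervalIntegrable (fun s => 2 * 𝓕.M * ‖𝓕.ι (h s)‖ ^ 2) volume 0 t :=
    Continuous.intervalIntegrable (by fun_prop) _ _
  have i2 : IntervalIntegrable (fun s => 2 * 𝓕.c * Real.exp (-2 * T) * ‖u s‖ ^ 2) volume 0 t :=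
    Continuous.intervalIntegrable (by fun_prop) _ _
  have key := intervalIntegral.sub_le_integral_of_hasDeriv_right_of_le ht.1
    (fun s _ => (d1 s).continuousAt.continuousWithinAt) (fun s _ => (d1 s).hasDerivWithinAt)
    (φ := fun s => 2 * 𝓕.M * ‖𝓕.ι (h s)‖ ^ 2 - 2 * 𝓕.c * Real.exp (-2 * T) * ‖u s‖ ^ 2)
    (by
      have := i1.sub i2
      rwa [intervalIntegrable_iff_integrableOn_Icc_of_le ht.1] at this)
    (fun s hs => by
      have hs' : s ∈ Icc 0 T := ⟨hs.1.le, hs.2.le.trans ht.2⟩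
      have h1 := 𝓕.energy (u s) (u₁ s) (h s) fun φ => by linarith [hu.eqn s hs' φ]
      rw [real_inner_comm] at h1
      set N := ‖𝓕.ι (h s)‖ ^ 2
      have h2 : 0 ≤ 𝓕.M * N := mul_nonneg 𝓕.M_nonneg (by positivity)
      have h3 : Real.exp (-2 * s) ≤ 1 := Real.exp_le_one_iff.2 (by linarith [hs.1])
      have h4 : Real.exp (-2 * T) ≤ Real.exp (-2 * s) := Real.exp_le_exp.2 (by linarith [hs'.2])
      have h5 : 0 ≤ 𝓕.c * ‖u s‖ ^ 2 := mul_nonneg 𝓕.c_pos.le (by positivity)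
      have h6 : Real.exp (-2 * s) * (inner ℝ (𝓕.j (u s)) (𝓕.j (u₁ s)) - ‖𝓕.j (u s)‖ ^ 2) ≤
          Real.exp (-2 * s) * (𝓕.M * N - 𝓕.c * ‖u s‖ ^ 2) := by
        exact mul_le_mul_of_nonneg_left (by linarith) (Real.exp_pos _).le
      nlinarith [mul_le_mul_of_nonneg_right h3 h2, mul_le_mul_of_nonneg_right h4 h5])
  rw [intervalIntegral.integral_sub i1 i2, intervalIntegral.integral_const_mul,
    intervalIntegral.integral_const_mul] at key
  simp only [mul_zero, Real.exp_zero, one_mul] at key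
  linarith

section integral

/-- The continuous functional `v ↦ ⟪j v, x⟫`. -/
noncomputable def functional (𝓕 : Frame V H X D C) (x : H) : V →L[ℝ] ℝ := (innerSL ℝ x).comp 𝓕.j

lemma functional_apply (x : H) (v : V) : 𝓕.functional x v = inner ℝ (𝓕.j v) x := by
  simp [functional, real_inner_comm]

variable [CompleteSpace V]

/-- The primitive of a function on `[0, T]`, continued by constants. -/
lemma exists_primitive {T : ℝ} (hT : 0 ≤ T) (W : Lp V 2 (lebT T)) (e : V) :
    ∃ w : ℝ → V, Continuous w ∧ w 0 = e ∧ ∀ t ∈ Icc 0 T, ∀ ℓ : V →L[ℝ] ℝ,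
      IntervalIntegrable (fun s => ℓ (IccExtend hT W s)) volume 0 t ∧
      ℓ (w t) = ℓ e + ∫ s in (0 : ℝ)..t, ℓ (IccExtend hT W s) := by
  have h1 : IntervalIntegrable (IccExtend hT W) volume 0 T :=
    intervalIntegrable_IccExtend hT ((Lp.memLp W).integrable (by norm_num))
  have h2 : Integrable ((Ioc 0 T).indicator (IccExtend hT W)) := by
    rw [integrable_indicator_iff measurableSet_Ioc]
    exact (intervalIntegrable_iff_integrableOn_Ioc_of_le hT).1 h1
  refine ⟨fun t => e + ∫ s in (0 : ℝ)..t, (Ioc 0 T).indicator (IccExtend hT W) s,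
    continuous_const.add (intervalIntegral.continuous_primitive
      (fun _ _ => h2.intervalIntegrable) 0), by simp, fun t ht ℓ => ?_⟩
  have h3 : IntervalIntegrable (IccExtend hT W) volume 0 t :=
    h1.mono_set (by rw [uIcc_of_le ht.1, uIcc_of_le hT]; exact Icc_subset_Icc le_rfl ht.2)
  have h4 : IntervalIntegrable (fun s => ℓ (IccExtend hT W s)) volume 0 t :=
    And.intro (ℓ.integrable_comp h3.1) (ℓ.integrable_comp h3.2)
  refine ⟨h4, ?_⟩
  rw [map_add, ℓ.intervalIntegral_comp_comm h3]
  congr 2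
  refine intervalIntegral.integral_congr_ae (Filter.Eventually.of_forall fun s hs => ?_)
  rw [uIoc_of_le ht.1] at hs
  exact indicator_of_mem (show s ∈ Ioc 0 T from ⟨hs.1, hs.2.trans ht.2⟩) _

lemma clm_integral_eq {w : ℝ → V} (hw : Continuous w) (e : V) (ℓ : V →L[ℝ] ℝ) (t : ℝ) :
    ℓ (e + ∫ s in (0 : ℝ)..t, w s) = ℓ e + ∫ s in (0 : ℝ)..t, ℓ (w s) := by
  rw [map_add, ℓ.intervalIntegral_comp_comm (hw.intervalIntegrable _ _)]

lemma hasDerivAt_primitive {w : ℝ → V} (hw : Continuous w) (e : V) (t : ℝ) :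
    HasDerivAt (fun t => e + ∫ s in (0 : ℝ)..t, w s) (w t) t :=
  (hw.integral_hasStrictDerivAt 0 t).hasDerivAt.const_add e

/-- Regular solutions for compatible smooth data. -/
theorem exists_isRegularSol [CompleteSpace H] {T : ℝ} (hT : 0 ≤ T) (e₀ e₁ : V) (W₀ : H)
    {h : ℝ → C} {F F₁ F₂ : ℝ → H} (hF : ∀ t, HasDerivAt F (F₁ t) t)
    (hF₁ : ∀ t, HasDerivAt F₁ (F₂ t) t) (hF₂ : Continuous F₂)
    (hh : Continuous fun t => 𝓕.ι (h t))
    (hFh : ∀ t φ, inner ℝ (F t) (𝓕.j (𝓕.d φ)) = inner ℝ (𝓕.ι (h t)) (𝓕.b φ))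
    (h₀ : ∀ φ, inner ℝ (𝓕.j e₁) (𝓕.j (𝓕.d φ)) + inner ℝ (𝓕.j e₀) (𝓕.adj φ) =
      inner ℝ (F 0) (𝓕.j (𝓕.d φ)))
    (h₁ : ∀ φ, inner ℝ W₀ (𝓕.j (𝓕.d φ)) + inner ℝ (𝓕.j e₁) (𝓕.adj φ) =
      inner ℝ (F₁ 0) (𝓕.j (𝓕.d φ))) :
    ∃ u u₁, 𝓕.IsRegularSol T u u₁ h ∧ u 0 = e₀ := by
  -- `W` plays the role of `u_tt`, with initial value `W₀` and source `F₂ = F''`; `e₁` and `e₀` are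
  -- the initial values of `u_t` and `u`.
  obtain ⟨W, hW⟩ := exists_weak_solution hT 𝓕.c_pos 𝓕.coercive W₀ hF₂
  obtain ⟨u₁, cu₁, hu₁0, hu₁⟩ := exists_primitive hT W e₁
  let u : ℝ → V := fun t => e₀ + ∫ s in (0 : ℝ)..t, u₁ s
  have hu : ∀ t, HasDerivAt u (u₁ t) t := hasDerivAt_primitive cu₁ e₀
  have ftc {G G' : ℝ → H} (hG : ∀ t, HasDerivAt G (G' t) t) (hG' : Continuous G') (x : H) (t : ℝ) :
      ∫ s in (0 : ℝ)..t, inner ℝ (G' s) x = inner ℝ (G t) x - inner ℝ (G 0) x := by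
    refine intervalIntegral.integral_eq_sub_of_hasDerivAt (f := fun s => inner ℝ (G s) x)
      (fun s _ => ?_) ((hG'.inner continuous_const).intervalIntegrable _ _)
    simpa using (hG s).inner ℝ (hasDerivAt_const s x)
  have cF₁ : Continuous F₁ := continuous_iff_continuousAt.2 fun t => (hF₁ t).continuousAt
  -- The compatibility condition `h₁` removes the constant of integration, giving the once
  -- differentiated equation `W + A u₁ = F₁`. The same step with `h₀` gives the original equation
  -- below.
  have hWae (φ : D) : ∀ᵐ t : Icc (0 : ℝ) T ∂lebT T, inner ℝ (𝓕.j (W t)) (𝓕.j (𝓕.d φ)) =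
      inner ℝ (F₁ t) (𝓕.j (𝓕.d φ)) - inner ℝ (𝓕.j (u₁ t)) (𝓕.adj φ) := by
    filter_upwards [hW φ] with t ht
    have k := hu₁ t t.2 (𝓕.functional (𝓕.adj φ))
    simp only [functional_apply] at k
    rw [ht, intervalIntegral.integral_sub ((hF₂.inner continuous_const).intervalIntegrable _ _) k.1,
      ftc hF₁ hF₂]
    linarith [k.2, h₁ φ]
  refine ⟨u, u₁, ⟨hu, cu₁, hh, fun t ht φ => ?_⟩, by simp [u]⟩
  have k := (hu₁ t ht (𝓕.functional (𝓕.j (𝓕.d φ)))).2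
  simp only [functional_apply] at k
  have e1 : ∫ s in (0 : ℝ)..t, inner ℝ (𝓕.j (IccExtend hT W s)) (𝓕.j (𝓕.d φ)) =
      ∫ s in (0 : ℝ)..t, (inner ℝ (F₁ s) (𝓕.j (𝓕.d φ)) - inner ℝ (𝓕.j (u₁ s)) (𝓕.adj φ)) := by
    refine intervalIntegral.integral_congr_ae ?_
    filter_upwards [ae_of_ae_lebT hT (hWae φ)] with s hs hs'
    rw [uIoc_of_le ht.1] at hs'
    have hs2 : s ∈ Ioc 0 T := ⟨hs'.1, hs'.2.trans ht.2⟩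
    have := hs hs2
    rw [projIcc_of_mem hT ⟨hs2.1.le, hs2.2⟩] at this
    rwa [IccExtend, Function.comp_apply, projIcc_of_mem hT ⟨hs2.1.le, hs2.2⟩]
  have ci : Continuous fun s => inner ℝ (𝓕.j (u₁ s)) (𝓕.adj φ) :=
    (𝓕.j.continuous.comp cu₁).inner continuous_const
  rw [e1, intervalIntegral.integral_sub ((cF₁.inner continuous_const).intervalIntegrable _ _)
    (ci.intervalIntegrable _ _), ftc hF cF₁] at k
  have k2 := clm_integral_eq cu₁ e₀ (𝓕.functional (𝓕.adj φ)) t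
  simp only [functional_apply] at k2
  rw [← hFh, k]
  change _ + inner ℝ (𝓕.j (e₀ + ∫ s in (0 : ℝ)..t, u₁ s)) (𝓕.adj φ) = _
  rw [k2]
  linarith [h₀ φ]

/-- Uniqueness of weak solutions. -/
theorem eq_zero_of_weak {T : ℝ} (hT : 0 < T) (u : C(Icc (0 : ℝ) T, H)) (U : Lp V 2 (lebT T))
    (hU : ∀ᵐ t ∂lebT T, 𝓕.j (U t) = u t)
    (hu : ∀ φ t, inner ℝ (u t) (𝓕.j (𝓕.d φ)) = -∫ s in Iic t, inner ℝ (u s) (𝓕.adj φ) ∂lebT T) :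
    u = 0 ∧ U = 0 := by
  -- `v` and `z` are the first and second time primitives of `U`, so `j v` is the primitive of `u`.
  -- Integrating the weak equation once more shows that `z` is a regular solution with zero data, to
  -- which the energy estimate applies.
  obtain ⟨v, cv, hv0, hv⟩ := exists_primitive hT.le U 0
  let z : ℝ → V := fun t => 0 + ∫ s in (0 : ℝ)..t, v s
  have hz : ∀ t, HasDerivAt z (v t) t := hasDerivAt_primitive cv 0
  let û : ℝ → H := IccExtend hT.le u
  have cû : Continuous û := u.continuous.Icc_extend'
  have hju {t : ℝ} (ht : t ∈ Icc 0 T) (x : H) :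
      inner ℝ (𝓕.j (v t)) x = ∫ s in (0 : ℝ)..t, inner ℝ (û s) x := by
    have := (hv t ht (𝓕.functional x)).2
    simp only [functional_apply, map_zero, zero_add] at this
    rw [this]
    refine intervalIntegral.integral_congr_ae ?_
    filter_upwards [ae_of_ae_lebT hT.le hU] with s hs hs'
    rw [uIoc_of_le ht.1] at hs'
    have := hs ⟨hs'.1, hs'.2.trans ht.2⟩
    simp only [û, IccExtend, Function.comp_apply, this]
  have hweak {t : ℝ} (ht : t ∈ Icc 0 T) (φ : D) :
      inner ℝ (û t) (𝓕.j (𝓕.d φ)) = -inner ℝ (𝓕.j (v t)) (𝓕.adj φ) := by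
    have h1 := hu φ ⟨t, ht⟩
    rw [integral_lebT_Iic hT.le] at h1
    simp only [û, IccExtend_of_mem hT.le _ ht]
    rw [h1, hju ht]
    rfl
  have hreg : 𝓕.IsRegularSol T z v 0 := by
    refine ⟨hz, cv, by simpa using continuous_const, fun t ht φ => ?_⟩
    have k := clm_integral_eq cv 0 (𝓕.functional (𝓕.adj φ)) t
    simp only [functional_apply, map_zero, zero_add] at k
    simp only [z, zero_add, Pi.zero_apply, map_zero, inner_zero_left]
    rw [k, hju ht, ← intervalIntegral.integral_add ((cû.inner continuous_const).intervalIntegrable _ _)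
      (((𝓕.j.continuous.comp cv).inner continuous_const).intervalIntegrable _ _)]
    refine (intervalIntegral.integral_congr (g := fun _ => 0) fun s hs => ?_).trans (by simp)
    rw [uIcc_of_le ht.1] at hs
    rw [hweak ⟨hs.1, hs.2.trans ht.2⟩, neg_add_cancel]
  have hz0 {t : ℝ} (ht : t ∈ Icc 0 T) : z t = 0 := by
    have k := hreg.energy_le ht
    have h1 : 0 ≤ ∫ s in (0 : ℝ)..t, ‖z s‖ ^ 2 :=
      intervalIntegral.integral_nonneg ht.1 fun _ _ => by positivity
    have h2 : 0 ≤ 2 * 𝓕.c * Real.exp (-2 * T) * ∫ s in (0 : ℝ)..t, ‖z s‖ ^ 2 :=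
      mul_nonneg (mul_nonneg (mul_nonneg two_pos.le 𝓕.c_pos.le) (Real.exp_pos _).le) h1
    have h3 : z 0 = 0 := by simp [z]
    simp only [h3, map_zero, norm_zero, Pi.zero_apply, ne_eq, OfNat.ofNat_ne_zero,
      not_false_eq_true, zero_pow, intervalIntegral.integral_zero, mul_zero, add_zero] at k
    have h4 : ‖𝓕.j (z t)‖ ^ 2 ≤ 0 := by
      have := Real.exp_pos (-2 * t)
      by_contra hneg
      push Not at hneg
      have := mul_pos this hneg
      linarith
    have h5 : ‖𝓕.j (z t)‖ = 0 := pow_eq_zero_iff two_ne_zero |>.1 (le_antisymm h4 (by positivity))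
    exact 𝓕.j_injective (by rw [map_zero]; exact norm_eq_zero.1 h5)
  have hv0 {t : ℝ} (ht : t ∈ Ioo 0 T) : v t = 0 := by
    refine (hz t).unique ((hasDerivAt_const t (0 : V)).congr_of_eventuallyEq ?_)
    filter_upwards [Icc_mem_nhds ht.1 ht.2] with s hs using hz0 hs
  have hû {t : ℝ} (ht : t ∈ Ioo 0 T) : û t = 0 := by
    have h1 :=
      (Continuous.integral_hasStrictDerivAt (f := fun s => inner ℝ (û s) (û t))
        (cû.inner continuous_const) 0 t).hasDerivAt
    have h2 := h1.unique ((hasDerivAt_const t (0 : ℝ)).congr_of_eventuallyEq (by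
      filter_upwards [Ioo_mem_nhds ht.1 ht.2] with s hs
      rw [← hju (Ioo_subset_Icc_self hs), hv0 hs, map_zero, inner_zero_left]))
    exact inner_self_eq_zero.1 h2
  have hu0 : u = 0 := by
    have : Set.EqOn û (fun _ => 0) (closure (Ioo 0 T)) :=
      Set.EqOn.closure (fun t ht => hû ht) cû continuous_const
    rw [closure_Ioo hT.ne] at this
    ext t
    have h1 := this t.2
    simp only [û, IccExtend_val] at h1
    simpa using h1
  refine ⟨hu0, ?_⟩
  rw [Lp.eq_zero_iff_ae_eq_zero]
  filter_upwards [hU] with t ht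
  rw [hu0] at ht
  exact 𝓕.j_injective (by rw [ht]; simp)

end integral

end Frame

/-! ### Weak solutions: closedness and the a priori estimate. -/

namespace Frame

variable {V H X D C : Type*} [NormedAddCommGroup V] [InnerProductSpace ℝ V]
    [NormedAddCommGroup H] [InnerProductSpace ℝ H] [NormedAddCommGroup X] [InnerProductSpace ℝ X]
    [AddCommGroup D] [Module ℝ D] [AddCommGroup C] [Module ℝ C] (𝓕 : Frame V H X D C)

/-- Weak solutions with initial value `u₀` and source `h`. -/
structure IsWeakSol {T : ℝ} (u₀ : H) (h : Lp X 2 (lebT T)) (u : C(Icc (0 : ℝ) T, H))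
    (U : Lp V 2 (lebT T)) : Prop where
  init : ∀ t : Icc (0 : ℝ) T, (t : ℝ) = 0 → u t = u₀
  mem : ∀ᵐ t ∂lebT T, 𝓕.j (U t) = u t
  eqn : ∀ φ t, inner ℝ (u t) (𝓕.j (𝓕.d φ)) = inner ℝ u₀ (𝓕.j (𝓕.d φ)) -
    (∫ s in Iic t, inner ℝ (u s) (𝓕.adj φ) ∂lebT T) + ∫ s in Iic t, inner ℝ (h s) (𝓕.b φ) ∂lebT T

variable {𝓕}

/-- The integral is the inner product with the fixed element `x` times the indicator of `Iic t`. -/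
lemma continuous_setIntegral_inner {E : Type*} [NormedAddCommGroup E] [InnerProductSpace ℝ E]
    {T : ℝ} (x : E) (t : Icc (0 : ℝ) T) :
    Continuous fun f : Lp E 2 (lebT T) => ∫ s in Iic t, inner ℝ (f s) x ∂lebT T := by
  have (f : Lp E 2 (lebT T)) : ∫ s in Iic t, inner ℝ (f s) x ∂lebT T =
      inner ℝ (indicatorConstLp 2 measurableSet_Iic (measure_ne_top (lebT T) (Iic t)) x) f := by
    rw [L2.inner_indicatorConstLp_eq_setIntegral_inner]
    simp only [real_inner_comm]
  simp only [this]
  fun_prop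

/-- Each condition is an equality of continuous functions of the data and the solution, once `u` is
replaced under the integral by its class in `L²(0, T; H)`. -/
lemma isClosed_isWeakSol (𝓕 : Frame V H X D C) (T : ℝ) :
    IsClosed {p : (H × Lp X 2 (lebT T)) × (C(Icc (0 : ℝ) T, H) × Lp V 2 (lebT T)) |
      𝓕.IsWeakSol p.1.1 p.1.2 p.2.1 p.2.2} := by
  have hS : {p : (H × Lp X 2 (lebT T)) × (C(Icc (0 : ℝ) T, H) × Lp V 2 (lebT T)) |
      𝓕.IsWeakSol p.1.1 p.1.2 p.2.1 p.2.2} =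
      {p | ∀ t : Icc (0 : ℝ) T, (t : ℝ) = 0 → p.2.1 t = p.1.1} ∩
      {p | 𝓕.j.compLpL 2 (lebT T) p.2.2 = ContinuousMap.toLp 2 (lebT T) ℝ p.2.1} ∩
      {p | ∀ φ t, inner ℝ (p.2.1 t) (𝓕.j (𝓕.d φ)) = inner ℝ p.1.1 (𝓕.j (𝓕.d φ)) -
        (∫ s in Iic t, inner ℝ ((ContinuousMap.toLp 2 (lebT T) ℝ p.2.1) s) (𝓕.adj φ) ∂lebT T) +
        ∫ s in Iic t, inner ℝ (p.1.2 s) (𝓕.b φ) ∂lebT T} := by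
    ext p
    have e (φ : D) (t : Icc (0 : ℝ) T) :
        ∫ s in Iic t, inner ℝ ((ContinuousMap.toLp 2 (lebT T) ℝ p.2.1) s) (𝓕.adj φ) ∂lebT T =
        ∫ s in Iic t, inner ℝ (p.2.1 s) (𝓕.adj φ) ∂lebT T := by
      refine integral_congr_ae (ae_restrict_of_ae ?_)
      filter_upwards [ContinuousMap.coeFn_toLp (p := 2) (𝕜 := ℝ) (lebT T) p.2.1] with s hs
      rw [hs]
    have e2 : 𝓕.j.compLpL 2 (lebT T) p.2.2 = ContinuousMap.toLp 2 (lebT T) ℝ p.2.1 ↔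
        ∀ᵐ t ∂lebT T, 𝓕.j (p.2.2 t) = p.2.1 t := by
      rw [Lp.ext_iff]
      constructor <;> intro h
      all_goals
        filter_upwards [h, ContinuousMap.coeFn_toLp (p := 2) (𝕜 := ℝ) (lebT T) p.2.1,
          𝓕.j.coeFn_compLpL p.2.2] with s h1 h2 h3
        simp_all
    constructor
    · rintro ⟨h1, h2, h3⟩
      exact ⟨⟨h1, e2.2 h2⟩, fun φ t => by rw [e, h3 φ t]⟩
    · rintro ⟨⟨h1, h2⟩, h3⟩
      exact ⟨h1, e2.1 h2, fun φ t => by rw [← e, h3 φ t]⟩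
  rw [hS]
  refine (IsClosed.inter ?_ ?_).inter ?_
  · simp only [ofPred_forall]
    exact isClosed_iInter fun t => isClosed_iInter fun _ =>
      isClosed_eq ((continuous_eval_const t).comp (by fun_prop)) (by fun_prop)
  · exact isClosed_eq (by fun_prop) (by fun_prop)
  · simp only [ofPred_forall]
    refine isClosed_iInter fun φ => isClosed_iInter fun t => isClosed_eq ?_ ?_
    · exact ((continuous_eval_const t).comp (by fun_prop)).inner continuous_const
    · refine Continuous.add (Continuous.sub (by fun_prop) ?_) ?_
      · exact (continuous_setIntegral_inner (𝓕.adj φ) t).comp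
          ((ContinuousMap.toLp 2 (lebT T) ℝ).continuous.comp (by fun_prop))
      · exact (continuous_setIntegral_inner (𝓕.b φ) t).comp (by fun_prop)

/-- Regular solutions, with their data, as a subspace. -/
def regular (𝓕 : Frame V H X D C) (T : ℝ) :
    Submodule ℝ ((H × Lp X 2 (lebT T)) × (C(Icc (0 : ℝ) T, H) × Lp V 2 (lebT T))) where
  carrier := {p | ∃ u u₁ h, 𝓕.IsRegularSol T u u₁ h ∧ p.1.1 = 𝓕.j (u 0) ∧
    (∀ᵐ t ∂lebT T, p.1.2 t = 𝓕.ι (h t)) ∧ (∀ t : Icc (0 : ℝ) T, p.2.1 t = 𝓕.j (u t)) ∧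
    ∀ᵐ t ∂lebT T, p.2.2 t = u t}
  zero_mem' := by
    refine ⟨0, 0, 0, ⟨fun t => hasDerivAt_const t 0, continuous_const,
      by simpa using continuous_const, by simp⟩, by simp, ?_, by simp, ?_⟩
    · filter_upwards [Lp.coeFn_zero X 2 (lebT T)] with t ht
      simpa using ht
    · filter_upwards [Lp.coeFn_zero V 2 (lebT T)] with t ht
      simpa using ht
  add_mem' := by
    rintro p p' ⟨u, u₁, h, hu, h1, h2, h3, h4⟩ ⟨u', u₁', h', hu', h1', h2', h3', h4'⟩
    refine ⟨u + u', u₁ + u₁', h + h', ⟨fun t => (hu.1 t).add (hu'.1 t), hu.2.add hu'.2,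
      by simpa using hu.3.fun_add hu'.3, fun t ht φ => ?_⟩, by simp [h1, h1'], ?_, ?_, ?_⟩
    · simp only [Pi.add_apply, map_add, inner_add_left]
      linarith [hu.4 t ht φ, hu'.4 t ht φ]
    · filter_upwards [h2, h2', Lp.coeFn_add p.1.2 p'.1.2] with t e1 e2 e3
      simp only [Prod.fst_add, Prod.snd_add, e3, Pi.add_apply, e1, e2, map_add]
    · intro t
      simp [h3, h3']
    · filter_upwards [h4, h4', Lp.coeFn_add p.2.2 p'.2.2] with t e1 e2 e3
      simp only [Prod.snd_add, e3, Pi.add_apply, e1, e2]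
  smul_mem' := by
    rintro a p ⟨u, u₁, h, hu, h1, h2, h3, h4⟩
    refine ⟨a • u, a • u₁, a • h, ⟨fun t => (hu.1 t).const_smul a, hu.2.const_smul a,
      by simpa using hu.3.fun_const_smul a, fun t ht φ => ?_⟩, by simp [h1], ?_, ?_, ?_⟩
    · simp only [Pi.smul_apply, map_smul, real_inner_smul_left, ← hu.4 t ht φ]
      ring
    · filter_upwards [h2, Lp.coeFn_smul a p.1.2] with t e1 e3
      simp only [Prod.smul_fst, Prod.smul_snd, e3, Pi.smul_apply, e1, map_smul]
    · intro t
      simp [h3]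
    · filter_upwards [h4, Lp.coeFn_smul a p.2.2] with t e1 e3
      simp only [Prod.smul_snd, e3, Pi.smul_apply, e1]

lemma norm_sq_eq_integral {E : Type*} [NormedAddCommGroup E] [InnerProductSpace ℝ E] {T : ℝ}
    (hT : 0 ≤ T) {f : Lp E 2 (lebT T)} {g : ℝ → E} (hfg : ∀ᵐ t ∂lebT T, f t = g t) :
    ‖f‖ ^ 2 = ∫ s in (0 : ℝ)..T, ‖g s‖ ^ 2 := by
  rw [← real_inner_self_eq_norm_sq, L2.inner_def]
  refine (integral_congr_ae (g := fun t : Icc (0 : ℝ) T => ‖g t‖ ^ 2) ?_).trans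
    ((integral_lebT hT _).trans (intervalIntegral.integral_congr fun s hs => ?_))
  · filter_upwards [hfg] with t ht
    rw [ht, real_inner_self_eq_norm_sq]
  · rw [uIcc_of_le hT] at hs
    simp only [IccExtend_of_mem hT _ hs]

/-- The pointwise equation is integrated in time, the term with `u₁` by the fundamental theorem of
calculus. -/
lemma isWeakSol_of_mem_regular {T : ℝ} (hT : 0 ≤ T)
    {p : (H × Lp X 2 (lebT T)) × (C(Icc (0 : ℝ) T, H) × Lp V 2 (lebT T))}
    (hp : p ∈ 𝓕.regular T) : 𝓕.IsWeakSol p.1.1 p.1.2 p.2.1 p.2.2 := by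
  obtain ⟨u, u₁, h, hu, h1, h2, h3, h4⟩ := hp
  have cu := hu.continuous
  have c1 := hu.continuous_deriv
  have ch := hu.continuous_source
  refine ⟨fun t ht => by rw [h3, h1, ht], ?_, fun φ t => ?_⟩
  · filter_upwards [h4] with t ht
    rw [h3, ht]
  · have e1 : ∫ s in Iic t, inner ℝ (p.2.1 s) (𝓕.adj φ) ∂lebT T =
        ∫ s in (0 : ℝ)..t, inner ℝ (𝓕.j (u s)) (𝓕.adj φ) := by
      rw [integral_lebT_Iic hT]
      refine intervalIntegral.integral_congr fun s hs => ?_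
      rw [uIcc_of_le t.2.1] at hs
      simp only [IccExtend_of_mem hT _ ⟨hs.1, hs.2.trans t.2.2⟩, h3]
    have e2 : ∫ s in Iic t, inner ℝ (p.1.2 s) (𝓕.b φ) ∂lebT T =
        ∫ s in (0 : ℝ)..t, inner ℝ (𝓕.ι (h s)) (𝓕.b φ) := by
      rw [integral_congr_ae (g := fun s : Icc (0 : ℝ) T => inner ℝ (𝓕.ι (h s)) (𝓕.b φ))
        (ae_restrict_of_ae (by filter_upwards [h2] with s hs; rw [hs])), integral_lebT_Iic hT]
      refine intervalIntegral.integral_congr fun s hs => ?_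
      rw [uIcc_of_le t.2.1] at hs
      simp only [IccExtend_of_mem hT _ ⟨hs.1, hs.2.trans t.2.2⟩]
    have i1 : Continuous fun s => inner ℝ (𝓕.j (u s)) (𝓕.adj φ) := by fun_prop
    have i2 : Continuous fun s => inner ℝ (𝓕.ι (h s)) (𝓕.b φ) := by fun_prop
    have k : ∫ s in (0 : ℝ)..t, inner ℝ (𝓕.j (u₁ s)) (𝓕.j (𝓕.d φ)) =
        inner ℝ (𝓕.j (u t)) (𝓕.j (𝓕.d φ)) - inner ℝ (𝓕.j (u 0)) (𝓕.j (𝓕.d φ)) := by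
      refine intervalIntegral.integral_eq_sub_of_hasDerivAt
        (f := fun s => inner ℝ (𝓕.j (u s)) (𝓕.j (𝓕.d φ))) (fun s _ => ?_)
        (Continuous.intervalIntegrable (by fun_prop) _ _)
      simpa using (𝓕.j.hasFDerivAt.comp_hasDerivAt s (hu.hasDerivAt s)).inner ℝ
        (hasDerivAt_const s (𝓕.j (𝓕.d φ)))
    have k2 : ∫ s in (0 : ℝ)..t, inner ℝ (𝓕.j (u₁ s)) (𝓕.j (𝓕.d φ)) =
        (∫ s in (0 : ℝ)..t, inner ℝ (𝓕.ι (h s)) (𝓕.b φ)) -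
          ∫ s in (0 : ℝ)..t, inner ℝ (𝓕.j (u s)) (𝓕.adj φ) := by
      rw [← intervalIntegral.integral_sub (i2.intervalIntegrable _ _) (i1.intervalIntegrable _ _)]
      refine intervalIntegral.integral_congr fun s hs => ?_
      rw [uIcc_of_le t.2.1] at hs
      linarith [hu.eqn s ⟨hs.1, hs.2.trans t.2.2⟩ φ]
    rw [e1, e2, h1, h3]
    linarith

/-- The a priori estimate for regular solutions. -/
lemma exists_bound_regular (𝓕 : Frame V H X D C) {T : ℝ} (hT : 0 ≤ T) :
    ∃ K : ℝ, 0 < K ∧ ∀ p ∈ 𝓕.regular T, ‖p.2.1‖ + ‖p.2.2‖ ≤ K * (‖p.1.1‖ + ‖p.1.2‖) := by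
  have hM := 𝓕.M_nonneg
  have hc := 𝓕.c_pos
  -- `K₁` and `K₂` are the constants in the bounds for the squared norms. As `K₁ ≤ K₁²` and `K₂ ≤ (1
  -- + K₂)²`, square roots are avoided by using `K₁` and `1 + K₂` for the norms themselves.
  set K₁ := Real.exp (2 * T) * (1 + 2 * 𝓕.M) with hK₁
  set K₂ := K₁ / (2 * 𝓕.c) with hK₂
  have h1K : 1 ≤ K₁ := one_le_mul_of_one_le_of_one_le (Real.one_le_exp (by linarith)) (by linarith)
  have h2K : 0 ≤ K₂ := by positivity
  refine ⟨K₁ + (1 + K₂), by linarith, ?_⟩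
  rintro p ⟨u, u₁, h, hu, h1, h2, h3, h4⟩
  set R := ‖p.1.1‖ + ‖p.1.2‖ with hR
  have hR0 : 0 ≤ R := by positivity
  have ch := hu.continuous_source
  have cu := hu.continuous
  have hsq : ‖p.1.1‖ ^ 2 + 2 * 𝓕.M * ‖p.1.2‖ ^ 2 ≤ (1 + 2 * 𝓕.M) * R ^ 2 := by
    have a1 : ‖p.1.1‖ ^ 2 ≤ R ^ 2 := by gcongr; simp [hR]
    have a2 : ‖p.1.2‖ ^ 2 ≤ R ^ 2 := by gcongr; simp [hR]
    nlinarith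
  have hE {t : ℝ} (ht : t ∈ Icc 0 T) : Real.exp (-2 * t) * ‖𝓕.j (u t)‖ ^ 2 +
      2 * 𝓕.c * Real.exp (-2 * T) * ∫ s in (0 : ℝ)..t, ‖u s‖ ^ 2 ≤ (1 + 2 * 𝓕.M) * R ^ 2 := by
    refine (hu.energy_le ht).trans (le_trans ?_ hsq)
    rw [← h1, norm_sq_eq_integral hT (g := fun t => 𝓕.ι (h t)) h2]
    gcongr
    refine intervalIntegral.integral_mono_interval le_rfl ht.1 ht.2
      (Filter.Eventually.of_forall fun s => by positivity)
      (Continuous.intervalIntegrable (by fun_prop) _ _)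
  have hexp : Real.exp (2 * T) * Real.exp (-2 * T) = 1 := by
    rw [← Real.exp_add]; simp
  have hu1 : ‖p.2.1‖ ≤ K₁ * R := by
    refine (ContinuousMap.norm_le _ (by positivity)).2 fun t => ?_
    refine abs_le_of_sq_le_sq' ?_ (by positivity) |>.2
    have a1 : 0 ≤ ∫ s in (0 : ℝ)..t, ‖u s‖ ^ 2 :=
      intervalIntegral.integral_nonneg t.2.1 fun _ _ => by positivity
    have a2 : 0 ≤ 2 * 𝓕.c * Real.exp (-2 * T) * ∫ s in (0 : ℝ)..t, ‖u s‖ ^ 2 := by positivity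
    have a3 : Real.exp (-2 * T) ≤ Real.exp (-2 * t) :=
      Real.exp_le_exp.2 (by linarith [t.2.2])
    have a4 : Real.exp (-2 * T) * ‖𝓕.j (u t)‖ ^ 2 ≤ (1 + 2 * 𝓕.M) * R ^ 2 := by
      have := mul_le_mul_of_nonneg_right a3 (sq_nonneg ‖𝓕.j (u t)‖)
      linarith [hE t.2]
    have a5 : ‖𝓕.j (u t)‖ ^ 2 ≤ K₁ * R ^ 2 := by
      calc ‖𝓕.j (u t)‖ ^ 2 = Real.exp (2 * T) * (Real.exp (-2 * T) * ‖𝓕.j (u t)‖ ^ 2) := by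
            rw [← mul_assoc, hexp, one_mul]
        _ ≤ Real.exp (2 * T) * ((1 + 2 * 𝓕.M) * R ^ 2) := by gcongr
        _ = K₁ * R ^ 2 := by rw [hK₁]; ring
    rw [h3]
    refine a5.trans ?_
    rw [mul_pow]
    gcongr
    nlinarith
  have hu2 : ‖p.2.2‖ ≤ (1 + K₂) * R := by
    refine abs_le_of_sq_le_sq' ?_ (by positivity) |>.2
    have a0 := hE (t := T) ⟨hT, le_rfl⟩
    rw [← norm_sq_eq_integral hT h4] at a0
    have a1 : 0 ≤ Real.exp (-2 * T) * ‖𝓕.j (u T)‖ ^ 2 := by positivity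
    have a2 : 2 * 𝓕.c * Real.exp (-2 * T) * ‖p.2.2‖ ^ 2 ≤ (1 + 2 * 𝓕.M) * R ^ 2 := by linarith
    have a3 : ‖p.2.2‖ ^ 2 ≤ K₂ * R ^ 2 := by
      calc ‖p.2.2‖ ^ 2 = (Real.exp (2 * T) / (2 * 𝓕.c)) *
            (2 * 𝓕.c * Real.exp (-2 * T) * ‖p.2.2‖ ^ 2) := by
            have : Real.exp (2 * T) / (2 * 𝓕.c) * (2 * 𝓕.c * Real.exp (-2 * T) * ‖p.2.2‖ ^ 2) =
              (Real.exp (2 * T) * Real.exp (-2 * T)) * ‖p.2.2‖ ^ 2 := by field_simp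
            rw [this, hexp, one_mul]
        _ ≤ (Real.exp (2 * T) / (2 * 𝓕.c)) * ((1 + 2 * 𝓕.M) * R ^ 2) := by gcongr
        _ = K₂ * R ^ 2 := by rw [hK₂, hK₁]; ring
    refine a3.trans ?_
    rw [mul_pow]
    gcongr
    nlinarith
  calc ‖p.2.1‖ + ‖p.2.2‖ ≤ K₁ * R + (1 + K₂) * R := add_le_add hu1 hu2
    _ = _ := by ring

end Frame

/-! ### Density of the data and abstract well-posedness. -/

namespace Frame

variable {V H X D C : Type*} [NormedAddCommGroup V] [InnerProductSpace ℝ V]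
    [NormedAddCommGroup H] [InnerProductSpace ℝ H] [NormedAddCommGroup X] [InnerProductSpace ℝ X]
    [AddCommGroup D] [Module ℝ D] [AddCommGroup C] [Module ℝ C] {𝓕 : Frame V H X D C}

lemma exists_mem_regular {T : ℝ} {u u₁ : ℝ → V} {h : ℝ → C} (hu : 𝓕.IsRegularSol T u u₁ h)
    (y : Lp X 2 (lebT T)) (hy : ∀ᵐ t ∂lebT T, y t = 𝓕.ι (h t)) :
    ∃ p ∈ 𝓕.regular T, p.1 = (𝓕.j (u 0), y) := by
  have cu := hu.continuous
  let u' : C(Icc (0 : ℝ) T, H) := ⟨fun t => 𝓕.j (u t), by fun_prop⟩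
  let U : C(Icc (0 : ℝ) T, V) := ⟨fun t => u t, by fun_prop⟩
  refine ⟨((𝓕.j (u 0), y), (u', ContinuousMap.toLp 2 (lebT T) ℝ U)),
    ⟨u, u₁, h, hu, rfl, hy, fun t => rfl, ?_⟩, rfl⟩
  filter_upwards [ContinuousMap.coeFn_toLp (p := 2) (𝕜 := ℝ) (lebT T) U] with t ht
  exact ht

variable [CompleteSpace V] [CompleteSpace H]

/-- Without a source, `u_t = -A u` prescribes the initial values `e, -A e, A² e` of `u, u_t, u_tt`.
All are available because `A` maps the regular elements to themselves. -/
lemma exists_regular_initial (𝓕 : Frame V H X D C) {T : ℝ} (hT : 0 ≤ T) (e : C) :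
    ∃ p ∈ 𝓕.regular T, p.1 = (𝓕.j (𝓕.κ e), 0) := by
  obtain ⟨u, u₁, hu, hu0⟩ := 𝓕.exists_isRegularSol hT (𝓕.κ e) (-𝓕.κ (𝓕.A e))
    (𝓕.j (𝓕.κ (𝓕.A (𝓕.A e)))) (h := 0) (F := 0) (F₁ := 0) (F₂ := 0)
    (fun t => hasDerivAt_const t 0) (fun t => hasDerivAt_const t 0) continuous_const
    (by simpa using continuous_const) (by simp)
    (fun φ => by simp [𝓕.adj_κ]) (fun φ => by simp [𝓕.adj_κ])
  rw [← hu0]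
  refine exists_mem_regular hu 0 ?_
  filter_upwards [Lp.coeFn_zero X 2 (lebT T)] with t ht
  simpa using ht

/-- As `θ` and its derivative vanish at `0`, the zero initial values of `u, u_t, u_tt` are
compatible with the source. -/
lemma exists_regular_source (𝓕 : Frame V H X D C) {T : ℝ} (hT : 0 ≤ T) (e : C) {θ : ℝ → ℝ}
    (hθ : ContDiff ℝ ∞ θ) (h0 : θ 0 = 0) (h1 : deriv θ 0 = 0) (y : Lp X 2 (lebT T))
    (hy : ∀ᵐ t : Icc (0 : ℝ) T ∂lebT T, y t = θ t • 𝓕.ι e) : ∃ p ∈ 𝓕.regular T, p.1 = (0, y) := by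
  have hθ1 : ContDiff ℝ ∞ (deriv θ) := (contDiff_infty_iff_deriv.1 hθ).2
  have c0 := hθ.continuous
  have c2 : Continuous (deriv (deriv θ)) := (contDiff_infty_iff_deriv.1 hθ1).2.continuous
  have d0 (t : ℝ) : HasDerivAt θ (deriv θ t) t :=
    ((contDiff_infty_iff_deriv.1 hθ).1 t).hasDerivAt
  have d1 (t : ℝ) : HasDerivAt (deriv θ) (deriv (deriv θ) t) t :=
    ((contDiff_infty_iff_deriv.1 hθ1).1 t).hasDerivAt
  set f := 𝓕.j (𝓕.κ (𝓕.q e)) with hf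
  obtain ⟨u, u₁, hu, hu0⟩ := 𝓕.exists_isRegularSol hT 0 0 0
    (h := fun t => θ t • e) (F := fun t => θ t • f) (F₁ := fun t => deriv θ t • f)
    (F₂ := fun t => deriv (deriv θ) t • f)
    (fun t => (d0 t).smul_const f) (fun t => (d1 t).smul_const f) (by fun_prop)
    (by simp only [map_smul]; fun_prop)
    (fun t φ => by simp only [map_smul, real_inner_smul_left, hf, 𝓕.q_κ])
    (fun φ => by simp [h0]) (fun φ => by simp [h1])
  have := exists_mem_regular hu y (by simpa using hy)
  rwa [hu0, map_zero] at this

/-- Separated functions are dense in `L²(0, T; X)`. -/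
lemma dense_separated [CompleteSpace X] [TopologicalSpace.SeparableSpace X] {T : ℝ} (hT : 0 ≤ T)
    (ι : C →ₗ[ℝ] X) (hι : DenseRange ι) (N : Submodule ℝ (Lp X 2 (lebT T)))
    (hN : ∀ (θ : ℝ → ℝ) (e : C) (y : Lp X 2 (lebT T)), ContDiff ℝ ∞ θ → tsupport θ ⊆ Ioo 0 T →
      (∀ᵐ t : Icc (0 : ℝ) T ∂lebT T, y t = θ t • ι e) → y ∈ N) : N.topologicalClosure = ⊤ := by
  rw [Submodule.topologicalClosure_eq_top_iff, Submodule.eq_bot_iff]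
  intro g hg
  have ig (x : X) : Integrable (fun t => inner ℝ x (g t)) (lebT T) :=
    ((Lp.memLp g).const_inner x).integrable (by norm_num)
  have h1 (e : C) : ∀ᵐ t ∂lebT T, inner ℝ (ι e) (g t) = 0 := by
    have ii : IntervalIntegrable (fun s => inner ℝ (ι e) (IccExtend hT g s)) volume 0 T := by
      simpa [Function.comp_def, IccExtend] using intervalIntegrable_IccExtend hT (ig (ι e))
    have := isOpen_Ioo.ae_eq_zero_of_integral_contDiff_smul_eq_zero (U := Ioo 0 T)
      (f := fun s => inner ℝ (ι e) (IccExtend hT g s))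
      (μ := volume) ((intervalIntegrable_iff_Ioo hT).1 ii).locallyIntegrableOn (by
        intro θ hθ _ hs
        let y : C(Icc (0 : ℝ) T, X) := ⟨fun t => θ t • ι e, by
          have := hθ.continuous
          fun_prop⟩
        have hy : ∀ᵐ t : Icc (0 : ℝ) T ∂lebT T, ContinuousMap.toLp 2 (lebT T) ℝ y t = θ t • ι e :=
          ContinuousMap.coeFn_toLp (p := 2) (𝕜 := ℝ) (lebT T) y
        have k := (N.mem_orthogonal g).1 hg _ (hN θ e _ hθ hs hy)
        rw [L2.inner_def, integral_congr_ae (g := fun t : Icc (0 : ℝ) T =>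
          θ t * inner ℝ (ι e) (g t)) (by
            filter_upwards [hy] with t ht
            rw [ht, real_inner_smul_left]), integral_lebT hT] at k
        rw [← setIntegral_eq_integral_of_forall_compl_eq_zero (s := Ioo 0 T)]
        · refine Eq.trans ?_ k
          rw [intervalIntegral_eq_Ioo hT]
          refine setIntegral_congr_fun measurableSet_Ioo fun s hs => ?_
          simp only [IccExtend_of_mem hT _ (Ioo_subset_Icc_self hs), smul_eq_mul]
        · intro x hx
          rw [image_eq_zero_of_notMem_tsupport fun hx' => hx (hs hx'), zero_smul])
    filter_upwards [ae_lebT_of_ae this] with t ht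
    simpa using ht
  -- The null set obtained so far depends on `e`; separability leaves only countably many of them to
  -- discard.
  obtain ⟨s, hs, hsc, hsd⟩ := Dense.exists_countable_dense_subset hι
  have h2 : ∀ᵐ t ∂lebT T, ∀ x ∈ s, inner ℝ x (g t) = 0 := by
    rw [ae_ball_iff hsc]
    intro x hx
    obtain ⟨e, rfl⟩ := hs hx
    exact h1 e
  rw [Lp.eq_zero_iff_ae_eq_zero]
  filter_upwards [h2] with t ht
  have h3 : EqOn (fun x => inner ℝ x (g t)) (fun _ => (0 : ℝ)) (closure s) :=
    EqOn.closure (fun x hx => ht x hx) (by fun_prop) continuous_const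
  exact inner_self_eq_zero.1 (h3 (hsd (g t)))

/-- Well-posedness of the abstract evolution equation. -/
theorem wellPosed [CompleteSpace X] [TopologicalSpace.SeparableSpace X] (𝓕 : Frame V H X D C)
    {T : ℝ} (hT : 0 < T) :
    ∃ K : ℝ, 0 < K ∧ ∀ (u₀ : H) (h : Lp X 2 (lebT T)), ∃ u U, 𝓕.IsWeakSol u₀ h u U ∧
      ‖u‖ + ‖U‖ ≤ K * (‖u₀‖ + ‖h‖) ∧
      ∀ u' U', 𝓕.IsWeakSol u₀ h u' U' → u' = u ∧ U' = U := by
  obtain ⟨K, hK, hbound⟩ := 𝓕.exists_bound_regular hT.le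
  set R := 𝓕.regular T with hR
  set S := R.topologicalClosure with hS
  have hclos : ∀ p ∈ S, ‖p.2.1‖ + ‖p.2.2‖ ≤ K * (‖p.1.1‖ + ‖p.1.2‖) ∧
      𝓕.IsWeakSol p.1.1 p.1.2 p.2.1 p.2.2 := by
    have hc : IsClosed {p : (H × Lp X 2 (lebT T)) × (C(Icc (0 : ℝ) T, H) × Lp V 2 (lebT T)) |
        ‖p.2.1‖ + ‖p.2.2‖ ≤ K * (‖p.1.1‖ + ‖p.1.2‖)} := isClosed_le (by fun_prop) (by fun_prop)
    intro p hp
    have hsub : (R : Set _) ⊆ _ := fun p hp =>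
      mem_inter (hbound p hp) (isWeakSol_of_mem_regular hT.le hp)
    exact closure_minimal hsub (hc.inter (𝓕.isClosed_isWeakSol T)) hp
  -- On the closure the solution is still controlled by its data, so the projection to the data is
  -- bounded below. Since `S` is complete, the set of attained data is closed, and density suffices.
  let π : S →L[ℝ] (H × Lp X 2 (lebT T)) := (ContinuousLinearMap.fst ℝ _ _).comp S.subtypeL
  have hanti : AntilipschitzWith (Real.toNNReal (1 + 2 * K)) π := by
    refine ContinuousLinearMap.antilipschitz_of_bound π fun p => ?_
    rw [Real.coe_toNNReal _ (by positivity)]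
    have h1 := (hclos p.1 p.2).1
    have e1 : ‖p.1.1.1‖ ≤ ‖π p‖ := norm_fst_le p.1.1
    have e2 : ‖p.1.1.2‖ ≤ ‖π p‖ := norm_snd_le p.1.1
    have e3 : ‖p.1.1‖ = ‖π p‖ := rfl
    have h2 : K * (‖p.1.1.1‖ + ‖p.1.1.2‖) ≤ K * (‖π p‖ + ‖π p‖) := by gcongr
    have n1 := norm_nonneg p.1.2.1
    have n2 := norm_nonneg p.1.2.2
    have n3 := norm_nonneg (π p)
    have h3 : ‖p.1.2‖ ≤ 2 * K * ‖π p‖ := by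
      rw [Prod.norm_def, max_le_iff]
      constructor <;> linarith
    change ‖p.1‖ ≤ _
    rw [Prod.norm_def, max_le_iff, e3]
    have : 0 ≤ K * ‖π p‖ := by positivity
    constructor <;> nlinarith
  have hclosed : IsClosed (LinearMap.range π.toLinearMap : Set (H × Lp X 2 (lebT T))) := by
    have : CompleteSpace S := R.isClosed_topologicalClosure.completeSpace_coe
    rw [LinearMap.coe_range]
    exact hanti.isClosed_range π.uniformContinuous
  set Q := LinearMap.range π.toLinearMap with hQ
  have hRQ : ∀ p ∈ R, p.1 ∈ Q := fun p hp => ⟨⟨p, R.le_topologicalClosure hp⟩, rfl⟩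
  have hQ1 (x : H) : (x, (0 : Lp X 2 (lebT T))) ∈ Q := by
    have hsub : range (fun e => 𝓕.j (𝓕.κ e)) ⊆
        (fun x : H => (x, (0 : Lp X 2 (lebT T)))) ⁻¹' (Q : Set _) := by
      rintro _ ⟨e, rfl⟩
      obtain ⟨p, hp, hp'⟩ := 𝓕.exists_regular_initial hT.le e
      change (𝓕.j (𝓕.κ e), (0 : Lp X 2 (lebT T))) ∈ Q
      rw [← hp']
      exact hRQ p hp
    exact closure_minimal hsub (hclosed.preimage (by fun_prop)) (𝓕.denseRange_κ x)
  have hQ2 (y : Lp X 2 (lebT T)) : ((0 : H), y) ∈ Q := by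
    have h1 := dense_separated hT.le 𝓕.ι 𝓕.denseRange_ι
      (Q.comap (LinearMap.inr ℝ H (Lp X 2 (lebT T)))) (fun θ e y hθ hs hy => by
        have h0 : (0 : ℝ) ∉ tsupport θ := fun h => (hs h).1.false
        obtain ⟨p, hp, hp'⟩ := 𝓕.exists_regular_source hT.le e hθ
          (image_eq_zero_of_notMem_tsupport h0)
          (image_eq_zero_of_notMem_tsupport fun h => h0 (tsupport_deriv_subset h)) y hy
        rw [Submodule.mem_comap, LinearMap.inr_apply, ← hp']
        exact hRQ p hp)
    have h2 : IsClosed (Q.comap (LinearMap.inr ℝ H (Lp X 2 (lebT T))) : Set (Lp X 2 (lebT T))) :=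
      hclosed.preimage (f := fun y : Lp X 2 (lebT T) => ((0 : H), y)) (by fun_prop)
    rw [IsClosed.submodule_topologicalClosure_eq h2] at h1
    have : y ∈ Q.comap (LinearMap.inr ℝ H (Lp X 2 (lebT T))) := by rw [h1]; trivial
    exact this
  refine ⟨K, hK, fun u₀ h => ?_⟩
  obtain ⟨⟨p, hp⟩, hpu⟩ : (u₀, h) ∈ Q := by
    simpa using Q.add_mem (hQ1 u₀) (hQ2 h)
  have hpu' : p.1 = (u₀, h) := hpu
  obtain ⟨hb, hw⟩ := hclos p hp
  rw [hpu'] at hb hw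
  refine ⟨p.2.1, p.2.2, hw, hb, fun u' U' hw' => ?_⟩
  have iu (v : C(Icc (0 : ℝ) T, H)) (x : H) (t : Icc (0 : ℝ) T) :
      Integrable (fun s => inner ℝ (v s) x) ((lebT T).restrict (Iic t)) := by
    have : Integrable (fun s => inner ℝ (v s) x) (lebT T) := by
      have hc : Continuous fun s => inner ℝ (v s) x := by fun_prop
      exact hc.integrable_of_hasCompactSupport (HasCompactSupport.of_compactSpace _)
    exact this.restrict
  have := eq_zero_of_weak (𝓕 := 𝓕) hT (u' - p.2.1) (U' - p.2.2) (by
    filter_upwards [hw'.mem, hw.mem, Lp.coeFn_sub U' p.2.2] with t h1 h2 h3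
    rw [h3, Pi.sub_apply, map_sub, h1, h2, ContinuousMap.sub_apply]) (fun φ t => by
    have h1 := hw'.eqn φ t
    have h2 := hw.eqn φ t
    simp only [ContinuousMap.sub_apply, inner_sub_left]
    rw [integral_sub (iu _ _ _) (iu _ _ _)]
    linarith)
  exact ⟨sub_eq_zero.1 this.1, sub_eq_zero.1 this.2⟩

end Frame

/-! ### The weighted `L²` spaces. -/

section weighted

variable {L : ℝ} {w : ℝ → ℝ}

/-- The measure `w(x) dx` on `(0, L)`. -/
noncomputable abbrev wMeas (L : ℝ) (w : ℝ → ℝ) : Measure ℝ :=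
  (leb L).withDensity fun x => ENNReal.ofReal (w x)

lemma wMeas_absolutelyContinuous : wMeas L w ≪ leb L := withDensity_absolutelyContinuous _ _

lemma absolutelyContinuous_wMeas (hw : Measurable w) (hpos : ∀ x ∈ Ioo 0 L, 0 < w x) :
    leb L ≪ wMeas L w := by
  refine withDensity_absolutelyContinuous' (by fun_prop) ?_
  filter_upwards [ae_restrict_mem measurableSet_Ioo] with x hx
  exact (ENNReal.ofReal_pos.2 (hpos x hx)).ne'

lemma integral_wMeas (hw : Measurable w) (hpos : ∀ x ∈ Ioo 0 L, 0 < w x) (f : ℝ → ℝ) :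
    ∫ x, f x ∂wMeas L w = ∫ x in Ioo 0 L, w x * f x := by
  rw [integral_withDensity_eq_integral_toReal_smul (by fun_prop)
    (Filter.Eventually.of_forall fun x => ENNReal.ofReal_lt_top)]
  refine setIntegral_congr_fun measurableSet_Ioo fun x hx => ?_
  simp only [ENNReal.toReal_ofReal (hpos x hx).le, smul_eq_mul]

lemma integrable_wMeas_iff (hw : Measurable w) (hpos : ∀ x ∈ Ioo 0 L, 0 < w x) {f : ℝ → ℝ} :
    Integrable f (wMeas L w) ↔ IntegrableOn (fun x => w x * f x) (Ioo 0 L) := by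
  rw [integrable_withDensity_iff_integrable_smul' (by fun_prop)
    (Filter.Eventually.of_forall fun x => ENNReal.ofReal_lt_top)]
  refine integrableOn_congr_fun (fun x hx => ?_) measurableSet_Ioo
  simp only [ENNReal.toReal_ofReal (hpos x hx).le, smul_eq_mul]

lemma memLp_wMeas (hw : Measurable w) (hpos : ∀ x ∈ Ioo 0 L, 0 < w x) {f : ℝ → ℝ} {B : ℝ}
    (hf : AEStronglyMeasurable f (leb L)) (hB : ∀ x ∈ Ioo 0 L, w x * f x ^ 2 ≤ B) :
    MemLp f 2 (wMeas L w) := by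
  rw [memLp_two_iff_integrable_sq (hf.mono_ac wMeas_absolutelyContinuous),
    integrable_wMeas_iff hw hpos]
  refine IntegrableOn.of_bound (C := B) (by simp)
    (hw.aestronglyMeasurable.mul (hf.pow 2)) ?_
  filter_upwards [ae_restrict_mem measurableSet_Ioo] with x hx
  rw [Real.norm_eq_abs, abs_of_nonneg (mul_nonneg (hpos x hx).le (sq_nonneg _))]
  exact hB x hx

lemma inner_weightedL2 (hw : Measurable w) (hpos : ∀ x ∈ Ioo 0 L, 0 < w x)
    (f g : WeightedL2 L w) : inner ℝ f g = ∫ x in Ioo 0 L, w x * (f x * g x) := by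
  rw [L2.inner_def, ← integral_wMeas hw hpos]
  refine integral_congr_ae (Filter.Eventually.of_forall fun x => ?_)
  simp [mul_comm]

lemma measurable_H : Measurable fun x : ℝ => 1 / (L - x) := by fun_prop

lemma measurable_DV : Measurable fun x : ℝ => 1 / (L - x) ^ 2 := by fun_prop

lemma pos_H : ∀ x ∈ Ioo 0 L, 0 < 1 / (L - x) := fun _ hx => one_div_pos.2 (sub_pos.2 hx.2)

lemma pos_DV : ∀ x ∈ Ioo 0 L, 0 < 1 / (L - x) ^ 2 := fun _ hx =>
  one_div_pos.2 (pow_pos (sub_pos.2 hx.2) 2)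

lemma weight_H_le {M x y : ℝ} (hx : x ∈ Ioo 0 L) (hM : |y| ≤ M * (L - x)) :
    1 / (L - x) * y ^ 2 ≤ M ^ 2 * L := by
  have hp : 0 < L - x := sub_pos.2 hx.2
  rw [one_div_mul_eq_div, div_le_iff₀ hp]
  calc y ^ 2 = |y| ^ 2 := (sq_abs y).symm
    _ ≤ (M * (L - x)) ^ 2 := by gcongr
    _ = M ^ 2 * (L - x) * (L - x) := by ring
    _ ≤ M ^ 2 * L * (L - x) := by gcongr; linarith [hx.1]

lemma weight_DV_le {M x y : ℝ} (hx : x ∈ Ioo 0 L) (hM : |y| ≤ M * (L - x)) :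
    1 / (L - x) ^ 2 * y ^ 2 ≤ M ^ 2 := by
  have hp : 0 < L - x := sub_pos.2 hx.2
  rw [one_div_mul_eq_div, div_le_iff₀ (pow_pos hp 2)]
  calc y ^ 2 = |y| ^ 2 := (sq_abs y).symm
    _ ≤ (M * (L - x)) ^ 2 := by gcongr
    _ = M ^ 2 * (L - x) ^ 2 := by ring

/-- A function is `O(L - x)` on `(0, L)`. -/
def BoundedByDist (L : ℝ) (f : ℝ → ℝ) : Prop :=
  AEStronglyMeasurable f (leb L) ∧ ∃ M, ∀ x ∈ Ioo 0 L, |f x| ≤ M * (L - x)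

lemma BoundedByDist.memLp_H {f : ℝ → ℝ} (hf : BoundedByDist L f) :
    MemLp f 2 (wMeas L fun x => 1 / (L - x)) := by
  obtain ⟨M, hM⟩ := hf.2
  exact memLp_wMeas measurable_H pos_H hf.1 fun x hx => weight_H_le hx (hM x hx)

lemma BoundedByDist.memLp_DV {f : ℝ → ℝ} (hf : BoundedByDist L f) :
    MemLp f 2 (wMeas L fun x => 1 / (L - x) ^ 2) := by
  obtain ⟨M, hM⟩ := hf.2
  exact memLp_wMeas measurable_DV pos_DV hf.1 fun x hx => weight_DV_le hx (hM x hx)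

lemma ae_leb_of_ae_H {p : ℝ → Prop} (h : ∀ᵐ x ∂wMeas L fun x => 1 / (L - x), p x) :
    ∀ᵐ x ∂leb L, p x := (absolutelyContinuous_wMeas measurable_H pos_H).ae_le h

lemma ae_leb_of_ae_DV {p : ℝ → Prop} (h : ∀ᵐ x ∂wMeas L fun x => 1 / (L - x) ^ 2, p x) :
    ∀ᵐ x ∂leb L, p x := (absolutelyContinuous_wMeas measurable_DV pos_DV).ae_le h

lemma ae_wMeas_of_ae {p : ℝ → Prop} (h : ∀ᵐ x ∂leb L, p x) : ∀ᵐ x ∂wMeas L w, p x :=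
  wMeas_absolutelyContinuous.ae_le h

lemma inner_H (f g : H L) : inner ℝ f g = ∫ x in Ioo 0 L, 1 / (L - x) * (f x * g x) :=
  inner_weightedL2 measurable_H pos_H f g

lemma inner_DV (f g : DV L) : inner ℝ f g = ∫ x in Ioo 0 L, 1 / (L - x) ^ 2 * (f x * g x) :=
  inner_weightedL2 measurable_DV pos_DV f g

/-- The inner product of `H` in terms of representatives, the second of which carries a factor
`L - x`. -/
lemma inner_H_eq {f g : H L} {f' g' : ℝ → ℝ} (hf : ∀ᵐ x ∂leb L, f x = f' x)
    (hg : ∀ᵐ x ∂leb L, g x = (L - x) * g' x) :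
    inner ℝ f g = ∫ x in Ioo 0 L, f' x * g' x := by
  rw [inner_H]
  refine integral_congr_ae ?_
  filter_upwards [hf, hg, ae_restrict_mem measurableSet_Ioo] with x h1 h2 hx
  have : L - x ≠ 0 := (sub_pos.2 hx.2).ne'
  rw [h1, h2]
  field_simp

lemma norm_sq_H {f : H L} {f' : ℝ → ℝ} (hf : ∀ᵐ x ∂leb L, f x = f' x) :
    ‖f‖ ^ 2 = ∫ x in Ioo 0 L, f' x ^ 2 / (L - x) := by
  rw [← real_inner_self_eq_norm_sq, inner_H]
  refine integral_congr_ae ?_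
  filter_upwards [hf] with x h1
  rw [h1]
  ring

lemma norm_sq_DV {f : DV L} {f' : ℝ → ℝ} (hf : ∀ᵐ x ∂leb L, f x = f' x) :
    ‖f‖ ^ 2 = ∫ x in Ioo 0 L, f' x ^ 2 / (L - x) ^ 2 := by
  rw [← real_inner_self_eq_norm_sq, inner_DV]
  refine integral_congr_ae ?_
  filter_upwards [hf] with x h1
  rw [h1]
  ring

lemma coeFn_toLp_leb {f : ℝ → ℝ} (hw : Measurable w) (hpos : ∀ x ∈ Ioo 0 L, 0 < w x)
    (hf : MemLp f 2 (wMeas L w)) : ∀ᵐ x ∂leb L, hf.toLp f x = f x :=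
  (absolutelyContinuous_wMeas hw hpos).ae_le hf.coeFn_toLp

end weighted

/-! ### The energy space, realised by second derivatives. -/

section embedding

variable {L : ℝ}

lemma tailInt_congr {f g : ℝ → ℝ} (h : ∀ᵐ x ∂leb L, f x = g x) {x : ℝ} (hx : x ∈ Icc 0 L) :
    tailInt L f x = tailInt L g x := by
  refine intervalIntegral.integral_congr_ae ?_
  filter_upwards [(ae_restrict_iff' measurableSet_Ioo).1 h,
    compl_mem_ae_iff.2 (measure_singleton L)] with z hz hzL hz'
  rw [uIoc_of_le hx.2] at hz'
  exact hz ⟨hx.1.trans_lt hz'.1, lt_of_le_of_ne hz'.2 hzL⟩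

lemma tailInt_tailInt_congr {f g : ℝ → ℝ} (h : ∀ᵐ x ∂leb L, f x = g x) {x : ℝ}
    (hx : x ∈ Icc 0 L) : tailInt L (tailInt L f) x = tailInt L (tailInt L g) x := by
  refine tailInt_congr ?_ hx
  filter_upwards [ae_restrict_mem measurableSet_Ioo] with z hz
  exact tailInt_congr h (Ioo_subset_Icc_self hz)

lemma memLp_leb_of_weightedL2 {w : ℝ → ℝ} (hw : Measurable w) (hpos : ∀ x ∈ Ioo 0 L, 0 < w x)
    {B : ℝ} (hB : ∀ x ∈ Ioo 0 L, 1 ≤ B * w x) (f : WeightedL2 L w) : MemLp f 2 (leb L) := by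
  have hm : AEStronglyMeasurable f (leb L) :=
    (Lp.aestronglyMeasurable f).mono_ac (absolutelyContinuous_wMeas hw hpos)
  rw [memLp_two_iff_integrable_sq hm]
  have h := (memLp_two_iff_integrable_sq (Lp.aestronglyMeasurable f)).1 (Lp.memLp f)
  refine (((integrable_wMeas_iff hw hpos).1 h).const_mul B).mono' (hm.pow 2) ?_
  filter_upwards [ae_restrict_mem measurableSet_Ioo] with x hx
  rw [Real.norm_eq_abs, abs_of_nonneg (sq_nonneg _), ← mul_assoc]
  exact le_mul_of_one_le_left (sq_nonneg _) (hB x hx)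

lemma memLp_leb (G : DV L) : MemLp G 2 (leb L) :=
  memLp_leb_of_weightedL2 measurable_DV pos_DV (B := L ^ 2) (fun x hx => by
    have hp : 0 < L - x := sub_pos.2 hx.2
    rw [mul_one_div, one_le_div (pow_pos hp 2)]
    gcongr
    linarith [hx.1]) G

lemma memLp_leb_H (f : H L) : MemLp f 2 (leb L) :=
  memLp_leb_of_weightedL2 measurable_H pos_H (B := L) (fun x hx => by
    have hp : 0 < L - x := sub_pos.2 hx.2
    rw [mul_one_div, one_le_div hp]
    linarith [hx.1]) f

lemma intervalIntegrable_DV (hL : 0 < L) (G : DV L) : IntervalIntegrable G volume 0 L :=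
  (intervalIntegrable_iff_Ioo hL.le).2 ((memLp_leb G).integrable (by norm_num))

lemma boundedByDist_sq : BoundedByDist L fun x => (L - x) ^ 2 := by
  refine ⟨by fun_prop, L, fun x hx => ?_⟩
  have hp : 0 < L - x := sub_pos.2 hx.2
  change |(L - x) ^ 2| ≤ L * (L - x)
  rw [abs_of_pos (by positivity), sq]
  gcongr
  linarith [hx.1]

/-- The norm of the embedding of `DV` into `L¹`. -/
noncomputable def embConst (L : ℝ) : ℝ :=
  ‖(boundedByDist_sq (L := L)).memLp_DV.toLp‖

lemma embConst_nonneg (L : ℝ) : 0 ≤ embConst L := norm_nonneg _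

/-- Cauchy–Schwarz in `DV` against `(L - x)²`, which cancels the weight. -/
lemma integral_abs_le (G : DV L) : ∫ x in Ioo 0 L, |G x| ≤ embConst L * ‖G‖ := by
  have h := real_inner_le_norm ((boundedByDist_sq (L := L)).memLp_DV.toLp) |G|
  rw [norm_abs_eq_norm, inner_DV] at h
  refine le_trans (le_of_eq (integral_congr_ae ?_)) h
  filter_upwards [coeFn_toLp_leb measurable_DV pos_DV (boundedByDist_sq (L := L)).memLp_DV,
    ae_leb_of_ae_DV (Lp.coeFn_abs G), ae_restrict_mem measurableSet_Ioo] with x h1 h2 hx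
  have : L - x ≠ 0 := (sub_pos.2 hx.2).ne'
  rw [h1, h2]
  field_simp

lemma abs_tailInt_le (hL : 0 < L) (G : DV L) {x : ℝ} (hx : x ∈ Icc 0 L) :
    |tailInt L G x| ≤ embConst L * ‖G‖ := by
  refine le_trans ?_ (integral_abs_le G)
  have hi := (intervalIntegrable_DV hL G).abs
  calc |tailInt L G x| ≤ ∫ s in x..L, |G s| :=
        intervalIntegral.norm_integral_le_integral_norm (f := G) (μ := volume) hx.2
    _ ≤ ∫ s in (0 : ℝ)..L, |G s| :=
        intervalIntegral.integral_mono_interval hx.1 hx.2 le_rfl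
          (Filter.Eventually.of_forall fun _ => abs_nonneg _) hi
    _ = _ := intervalIntegral_eq_Ioo hL.le _

lemma abs_tailInt_tailInt_le (hL : 0 < L) (G : DV L) {x : ℝ} (hx : x ∈ Icc 0 L) :
    |tailInt L (tailInt L G) x| ≤ embConst L * ‖G‖ * (L - x) := by
  have := intervalIntegral.norm_integral_le_of_norm_le_const (f := tailInt L G) (a := x) (b := L)
    (C := embConst L * ‖G‖) fun s hs => by
      rw [uIoc_of_le hx.2] at hs
      exact abs_tailInt_le hL G ⟨hx.1.trans hs.1.le, hs.2⟩
  rwa [abs_of_nonneg (sub_nonneg.2 hx.2)] at this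

lemma continuousOn_tailInt_DV (hL : 0 < L) (G : DV L) : ContinuousOn (tailInt L G) (Icc 0 L) :=
  continuousOn_tailInt hL.le (intervalIntegrable_DV hL G)

lemma continuousOn_tailInt_tailInt (hL : 0 < L) (G : DV L) :
    ContinuousOn (tailInt L (tailInt L G)) (Icc 0 L) :=
  continuousOn_tailInt hL.le (ContinuousOn.intervalIntegrable
    (by rw [uIcc_of_le hL.le]; exact continuousOn_tailInt_DV hL G))

lemma boundedByDist_tailInt (hL : 0 < L) (G : DV L) :
    BoundedByDist L (tailInt L (tailInt L G)) :=
  ⟨((continuousOn_tailInt_tailInt hL G).mono Ioo_subset_Icc_self).aestronglyMeasurable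
    measurableSet_Ioo, embConst L * ‖G‖,
    fun _ hx => abs_tailInt_tailInt_le hL G (Ioo_subset_Icc_self hx)⟩

lemma tailInt_add {f g : ℝ → ℝ} (hf : IntervalIntegrable f volume 0 L)
    (hg : IntervalIntegrable g volume 0 L) {x : ℝ} (hx : x ∈ Icc 0 L) :
    tailInt L (fun s => f s + g s) x = tailInt L f x + tailInt L g x := by
  have hs : uIcc x L ⊆ uIcc 0 L := by
    rw [uIcc_of_le hx.2, uIcc_of_le (hx.1.trans hx.2)]
    exact Icc_subset_Icc hx.1 le_rfl
  exact intervalIntegral.integral_add (hf.mono_set hs) (hg.mono_set hs)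

lemma tailInt_smul {f : ℝ → ℝ} (a x : ℝ) :
    tailInt L (fun s => a * f s) x = a * tailInt L f x :=
  intervalIntegral.integral_const_mul _ _

lemma tailInt_add_DV (hL : 0 < L) (G K : DV L) {x : ℝ} (hx : x ∈ Icc 0 L) :
    tailInt L (G + K : DV L) x = tailInt L G x + tailInt L K x := by
  rw [← tailInt_add (intervalIntegrable_DV hL G) (intervalIntegrable_DV hL K) hx]
  exact tailInt_congr (ae_leb_of_ae_DV (Lp.coeFn_add G K)) hx

lemma tailInt_smul_DV (a : ℝ) (G : DV L) {x : ℝ} (hx : x ∈ Icc 0 L) :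
    tailInt L (a • G : DV L) x = a * tailInt L G x := by
  rw [← tailInt_smul]
  exact tailInt_congr (ae_leb_of_ae_DV (Lp.coeFn_smul a G)) hx

lemma tailInt_tailInt_add_DV (hL : 0 < L) (G K : DV L) {x : ℝ} (hx : x ∈ Icc 0 L) :
    tailInt L (tailInt L (G + K : DV L)) x =
      tailInt L (tailInt L G) x + tailInt L (tailInt L K) x := by
  have hi (G : DV L) : IntervalIntegrable (tailInt L G) volume 0 L :=
    ContinuousOn.intervalIntegrable (by rw [uIcc_of_le hL.le]; exact continuousOn_tailInt_DV hL G)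
  rw [← tailInt_add (hi G) (hi K) hx]
  refine tailInt_congr ?_ hx
  filter_upwards [ae_restrict_mem measurableSet_Ioo] with z hz
  exact tailInt_add_DV hL G K (Ioo_subset_Icc_self hz)

lemma tailInt_tailInt_smul_DV (a : ℝ) (G : DV L) {x : ℝ} (hx : x ∈ Icc 0 L) :
    tailInt L (tailInt L (a • G : DV L)) x = a * tailInt L (tailInt L G) x := by
  rw [← tailInt_smul]
  refine tailInt_congr ?_ hx
  filter_upwards [ae_restrict_mem measurableSet_Ioo] with z hz
  exact tailInt_smul_DV a G (Ioo_subset_Icc_self hz)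

/-- The functional `v_xx ↦ -v_x(0)`. -/
noncomputable def trace1 (hL : 0 < L) : DV L →L[ℝ] ℝ :=
  LinearMap.mkContinuous
    { toFun := fun G => tailInt L G 0
      map_add' := fun G K => tailInt_add_DV hL G K ⟨le_rfl, hL.le⟩
      map_smul' := fun a G => tailInt_smul_DV a G ⟨le_rfl, hL.le⟩ }
    (embConst L) fun G => abs_tailInt_le hL G ⟨le_rfl, hL.le⟩

/-- The functional `v_xx ↦ v(0)`. -/
noncomputable def trace0 (hL : 0 < L) : DV L →L[ℝ] ℝ :=
  LinearMap.mkContinuous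
    { toFun := fun G => tailInt L (tailInt L G) 0
      map_add' := fun G K => tailInt_tailInt_add_DV hL G K ⟨le_rfl, hL.le⟩
      map_smul' := fun a G => tailInt_tailInt_smul_DV a G ⟨le_rfl, hL.le⟩ }
    (embConst L * L) fun G => by
      have := abs_tailInt_tailInt_le hL G (x := 0) ⟨le_rfl, hL.le⟩
      rw [sub_zero] at this
      exact this.trans (le_of_eq (by ring))

/-- The space `V`, realised as the space of second derivatives. -/
noncomputable def energySpace (hL : 0 < L) : Submodule ℝ (DV L) :=
  LinearMap.ker (trace1 hL).toLinearMap ⊓ LinearMap.ker (trace0 hL).toLinearMap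

lemma mem_energySpace (hL : 0 < L) {G : DV L} :
    G ∈ energySpace hL ↔ tailInt L G 0 = 0 ∧ tailInt L (tailInt L G) 0 = 0 := Iff.rfl

instance (hL : 0 < L) : CompleteSpace (energySpace hL) := by
  have : IsClosed (energySpace hL : Set (DV L)) :=
    (trace1 hL).isClosed_ker.inter (trace0 hL).isClosed_ker
  exact this.completeSpace_coe

lemma norm_toLp_H_le (hL : 0 < L) {f : ℝ → ℝ} {M : ℝ} (hM0 : 0 ≤ M)
    (hf : BoundedByDist L f) (hM : ∀ x ∈ Ioo 0 L, |f x| ≤ M * (L - x)) :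
    ‖(hf.memLp_H.toLp : H L)‖ ≤ M * L := by
  refine abs_le_of_sq_le_sq' ?_ (by positivity) |>.2
  rw [norm_sq_H (coeFn_toLp_leb measurable_H pos_H hf.memLp_H)]
  have h : ∀ x ∈ Ioo 0 L, f x ^ 2 / (L - x) ≤ M ^ 2 * L := fun x hx => by
    rw [← one_div_mul_eq_div]
    exact weight_H_le hx (hM x hx)
  have hi : IntegrableOn (fun x => f x ^ 2 / (L - x)) (Ioo 0 L) := by
    have := (integrable_wMeas_iff measurable_H pos_H).1 hf.memLp_H.integrable_sq
    simpa only [one_div_mul_eq_div] using this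
  refine (setIntegral_mono_on hi (integrableOn_const (by simp)) measurableSet_Ioo h).trans
    (le_of_eq ?_)
  simp [hL.le]
  ring

/-- The embedding of `DV` into `H`: `v_xx ↦ v`, with `v(L) = v_x(L) = 0`. -/
noncomputable def embH (hL : 0 < L) : DV L →L[ℝ] H L :=
  LinearMap.mkContinuous
    { toFun := fun G => (boundedByDist_tailInt hL G).memLp_H.toLp
      map_add' := fun G K => by
        rw [← MemLp.toLp_add]
        refine MemLp.toLp_congr _ _ (ae_wMeas_of_ae ?_)
        filter_upwards [ae_restrict_mem measurableSet_Ioo] with x hx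
        exact tailInt_tailInt_add_DV hL G K (Ioo_subset_Icc_self hx)
      map_smul' := fun a G => by
        rw [← MemLp.toLp_const_smul]
        refine MemLp.toLp_congr _ _ (ae_wMeas_of_ae ?_)
        filter_upwards [ae_restrict_mem measurableSet_Ioo] with x hx
        exact tailInt_tailInt_smul_DV a G (Ioo_subset_Icc_self hx) }
    (embConst L * L) fun G =>
      (norm_toLp_H_le hL (mul_nonneg (embConst_nonneg L) (norm_nonneg G))
        (boundedByDist_tailInt hL G) fun x hx =>
          abs_tailInt_tailInt_le hL G (Ioo_subset_Icc_self hx)).trans (le_of_eq (by ring))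

lemma coeFn_embH (hL : 0 < L) (G : DV L) :
    ∀ᵐ x ∂leb L, embH hL G x = tailInt L (tailInt L G) x :=
  coeFn_toLp_leb measurable_H pos_H (boundedByDist_tailInt hL G).memLp_H

end embedding

/-! ### Spaces of smooth functions and the operators on them. -/

/-- A linear family of square integrable functions, as a linear map into `L²`. -/
noncomputable def liftLp {D : Type*} [AddCommMonoid D] [Module ℝ D] {μ : Measure ℝ}
    (F : D →ₗ[ℝ] ℝ → ℝ) (hF : ∀ φ, MemLp (F φ) 2 μ) : D →ₗ[ℝ] Lp ℝ 2 μ where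
  toFun φ := (hF φ).toLp
  map_add' φ ψ := by
    rw [← MemLp.toLp_add]
    exact MemLp.toLp_congr _ _ (by rw [map_add])
  map_smul' a φ := by
    rw [RingHom.id_apply, ← MemLp.toLp_const_smul]
    exact MemLp.toLp_congr _ _ (by rw [map_smul])

lemma coeFn_liftLp {D : Type*} [AddCommMonoid D] [Module ℝ D] {μ : Measure ℝ}
    (F : D →ₗ[ℝ] ℝ → ℝ) (hF : ∀ φ, MemLp (F φ) 2 μ) (φ : D) : liftLp F hF φ =ᵐ[μ] F φ :=
  (hF φ).coeFn_toLp

lemma iteratedDeriv_add_smooth {f g : ℝ → ℝ} (hf : ContDiff ℝ ∞ f) (hg : ContDiff ℝ ∞ g) (n : ℕ)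
    (x : ℝ) : iteratedDeriv n (f + g) x = iteratedDeriv n f x + iteratedDeriv n g x :=
  iteratedDeriv_add ((hf.of_le (by exact_mod_cast le_top)).contDiffAt)
    ((hg.of_le (by exact_mod_cast le_top)).contDiffAt)

/-- Smooth functions. -/
def smoothFun : Submodule ℝ (ℝ → ℝ) where
  carrier := {f | ContDiff ℝ ∞ f}
  zero_mem' := show ContDiff ℝ ∞ (fun _ : ℝ => (0 : ℝ)) from contDiff_const
  add_mem' {f g} (hf : ContDiff ℝ ∞ f) (hg : ContDiff ℝ ∞ g) := hf.add hg
  smul_mem' a f (hf : ContDiff ℝ ∞ f) := hf.const_smul a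

lemma smoothFun.contDiff (f : smoothFun) : ContDiff ℝ ∞ f.1 := f.2

/-- The `n`-th derivative, on smooth functions. -/
noncomputable def smoothDeriv (n : ℕ) : smoothFun →ₗ[ℝ] smoothFun where
  toFun f := ⟨iteratedDeriv n f, contDiff_iteratedDeriv f.2 n⟩
  map_add' f g := Subtype.ext <| funext fun x => iteratedDeriv_add_smooth f.2 g.2 n x
  map_smul' a f := Subtype.ext <| funext fun _ => iteratedDeriv_const_smul_field a f.1

/-- The test functions. -/
def testSpace (L : ℝ) : Submodule ℝ smoothFun where
  carrier := {f | IsTest L f}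
  zero_mem' := by
    change IsTest L fun _ => (0 : ℝ)
    exact ⟨contDiff_const, by simp⟩
  add_mem' := by
    rintro f g ⟨-, f0, fL, f1, f1L, f2⟩ ⟨-, g0, gL, g1, g1L, g2⟩
    refine ⟨(f + g).2, ?_, ?_, ?_, ?_, ?_⟩
    · simp [f0, g0]
    · simp [fL, gL]
    all_goals rw [Submodule.coe_add, iteratedDeriv_add_smooth f.2 g.2]
    · simp only [f1, g1, add_zero]
    · simp only [f1L, g1L, add_zero]
    · simp only [f2, g2, add_zero]
  smul_mem' := by
    rintro a f ⟨-, f0, fL, f1, f1L, f2⟩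
    refine ⟨(a • f).2, ?_, ?_, ?_, ?_, ?_⟩
    · simp [f0]
    · simp [fL]
    all_goals rw [Submodule.coe_smul, iteratedDeriv_const_smul_field]
    · simp only [f1, smul_zero]
    · simp only [f1L, smul_zero]
    · simp only [f2, smul_zero]

/-- Smooth functions with compact support in `(0, L)`. -/
def ccSpace (L : ℝ) : Submodule ℝ smoothFun where
  carrier := {f | tsupport f.1 ⊆ Ioo 0 L}
  zero_mem' := by
    change tsupport (0 : ℝ → ℝ) ⊆ _
    simp [tsupport]
  add_mem' {f g} hf hg := (tsupport_add f.1 g.1).trans (union_subset hf hg)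
  smul_mem' a f hf := (tsupport_smul_subset_right (fun _ => a) f.1).trans hf

/-- Smooth functions in the domain of the Kawahara operator. -/
def smoothDom (L : ℝ) : Submodule ℝ smoothFun where
  carrier := {f | f.1 0 = 0 ∧ f.1 L = 0 ∧ iteratedDeriv 1 f.1 0 = 0 ∧ iteratedDeriv 1 f.1 L = 0 ∧
    iteratedDeriv 2 f.1 L = 0}
  zero_mem' := by
    change _ = _ ∧ _
    simp
  add_mem' := by
    rintro f g ⟨f0, fL, f1, f1L, f2⟩ ⟨g0, gL, g1, g1L, g2⟩
    refine ⟨?_, ?_, ?_, ?_, ?_⟩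
    · simp [f0, g0]
    · simp [fL, gL]
    all_goals rw [Submodule.coe_add, iteratedDeriv_add_smooth f.2 g.2]
    · simp only [f1, g1, add_zero]
    · simp only [f1L, g1L, add_zero]
    · simp only [f2, g2, add_zero]
  smul_mem' := by
    rintro a f ⟨f0, fL, f1, f1L, f2⟩
    refine ⟨?_, ?_, ?_, ?_, ?_⟩
    · simp [f0]
    · simp [fL]
    all_goals rw [Submodule.coe_smul, iteratedDeriv_const_smul_field]
    · simp only [f1, smul_zero]
    · simp only [f1L, smul_zero]
    · simp only [f2, smul_zero]

variable {L : ℝ}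

lemma tsupport_iteratedDeriv_subset (f : ℝ → ℝ) (n : ℕ) :
    tsupport (iteratedDeriv n f) ⊆ tsupport f := by
  induction n with
  | zero => simp
  | succ n ih => rw [iteratedDeriv_succ]; exact tsupport_deriv_subset.trans ih

lemma eq_zero_of_mem_ccSpace {f : smoothFun} (hf : f ∈ ccSpace L) (n : ℕ) {x : ℝ}
    (hx : x ∉ Ioo 0 L) : iteratedDeriv n f.1 x = 0 :=
  image_eq_zero_of_notMem_tsupport fun h => hx (hf (tsupport_iteratedDeriv_subset _ n h))

lemma smoothDeriv_mem_ccSpace {f : smoothFun} (hf : f ∈ ccSpace L) (n : ℕ) :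
    smoothDeriv n f ∈ ccSpace L := (tsupport_iteratedDeriv_subset _ n).trans hf

lemma zero_notMem : (0 : ℝ) ∉ Ioo 0 L := fun h => h.1.false

lemma right_notMem : L ∉ Ioo 0 L := fun h => h.2.false

lemma ccSpace_le_smoothDom : ccSpace L ≤ smoothDom L := fun _ hf =>
  ⟨eq_zero_of_mem_ccSpace hf 0 zero_notMem, eq_zero_of_mem_ccSpace hf 0 right_notMem,
    eq_zero_of_mem_ccSpace hf 1 zero_notMem, eq_zero_of_mem_ccSpace hf 1 right_notMem,
    eq_zero_of_mem_ccSpace hf 2 right_notMem⟩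

/-- The derivative, on smooth functions with compact support. -/
noncomputable def ccDeriv (L : ℝ) (n : ℕ) : ccSpace L →ₗ[ℝ] ccSpace L :=
  (smoothDeriv n).restrict fun _ hf => smoothDeriv_mem_ccSpace hf n

lemma boundedByDist_of_smooth {f : ℝ → ℝ} (hf : ContDiff ℝ ∞ f) (hL : f L = 0) :
    BoundedByDist L f := by
  have hd (x : ℝ) : HasDerivAt f (iteratedDeriv 1 f x) x := by
    simpa using hasDerivAt_iteratedDeriv hf 0 x
  obtain ⟨M, hM⟩ := (VanishesTo.of_hasDerivAt (n := 0) hf.continuous.continuousOn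
    (fun x _ => hd x) hL (ContinuousOn.vanishesTo_zero
      (continuous_iteratedDeriv hf 1).continuousOn)).2
  exact ⟨hf.continuous.aestronglyMeasurable, M,
    fun x hx => by simpa using hM x (Ioo_subset_Icc_self hx)⟩

lemma tailInt_iteratedDeriv_succ {f : ℝ → ℝ} (hf : ContDiff ℝ ∞ f) {n : ℕ}
    (h : iteratedDeriv n f L = 0) (x : ℝ) :
    tailInt L (iteratedDeriv (n + 1) f) x = -iteratedDeriv n f x := by
  rw [tailInt, intervalIntegral.integral_eq_sub_of_hasDerivAt
    (fun x _ => hasDerivAt_iteratedDeriv hf n x)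
    ((continuous_iteratedDeriv hf _).intervalIntegrable _ _), h, zero_sub]

lemma tailInt_tailInt_iteratedDeriv {f : ℝ → ℝ} (hf : ContDiff ℝ ∞ f)
    (h : f L = 0) (h1 : iteratedDeriv 1 f L = 0) (x : ℝ) :
    tailInt L (tailInt L (iteratedDeriv 2 f)) x = f x := by
  have e : tailInt L (iteratedDeriv 2 f) = fun x => -1 * iteratedDeriv 1 f x :=
    funext fun x => by rw [tailInt_iteratedDeriv_succ hf h1, neg_one_mul]
  rw [e, tailInt_smul, tailInt_iteratedDeriv_succ hf (n := 0) (by simpa using h)]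
  simp

/-- The second derivative, as a map from the domain of the operator into `DV`. -/
noncomputable def toDV (L : ℝ) : smoothDom L →ₗ[ℝ] DV L :=
  liftLp (smoothFun.subtype ∘ₗ smoothDeriv 2 ∘ₗ (smoothDom L).subtype) fun f =>
    (boundedByDist_of_smooth (contDiff_iteratedDeriv f.1.2 2) f.2.2.2.2.2).memLp_DV

lemma coeFn_toDV (f : smoothDom L) : ∀ᵐ x ∂leb L, toDV L f x = iteratedDeriv 2 f.1.1 x :=
  ae_leb_of_ae_DV (coeFn_liftLp _ _ f)

/-- Smooth functions as elements of the energy space. -/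
noncomputable def toEnergy (hL : 0 < L) : smoothDom L →ₗ[ℝ] energySpace hL :=
  LinearMap.codRestrict (energySpace hL) (toDV L) fun f => by
    have hm : (0 : ℝ) ∈ Icc 0 L := ⟨le_rfl, hL.le⟩
    obtain ⟨h0, hl, h1, h1l, -⟩ := f.2
    rw [mem_energySpace, tailInt_congr (coeFn_toDV f) hm, tailInt_tailInt_congr (coeFn_toDV f) hm,
      tailInt_iteratedDeriv_succ f.1.2 h1l, tailInt_tailInt_iteratedDeriv f.1.2 hl h1l, h1]
    exact ⟨neg_zero, h0⟩

lemma coeFn_toEnergy (hL : 0 < L) (f : smoothDom L) :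
    ∀ᵐ x ∂leb L, (toEnergy hL f : DV L) x = iteratedDeriv 2 f.1.1 x :=
  coeFn_toDV f

/-- The embedding of the energy space into `H`. -/
noncomputable def energyEmb (hL : 0 < L) : energySpace hL →L[ℝ] H L :=
  (embH hL).comp (energySpace hL).subtypeL

lemma coeFn_energyEmb (hL : 0 < L) (G : energySpace hL) :
    ∀ᵐ x ∂leb L, energyEmb hL G x = tailInt L (tailInt L G.1) x := coeFn_embH hL G.1

lemma coeFn_energyEmb_toEnergy (hL : 0 < L) (f : smoothDom L) :
    ∀ᵐ x ∂leb L, energyEmb hL (toEnergy hL f) x = f.1.1 x := by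
  filter_upwards [coeFn_energyEmb hL (toEnergy hL f), ae_restrict_mem measurableSet_Ioo]
    with x hx hm
  rw [hx, tailInt_tailInt_congr (coeFn_toEnergy hL f) (Ioo_subset_Icc_self hm),
    tailInt_tailInt_iteratedDeriv f.1.2 f.2.2.1 f.2.2.2.2.1]

/-- Multiplication by a function that is smooth on `(0, L)`. -/
noncomputable def ccMul {ρ : ℝ → ℝ} (hρ : ContDiffOn ℝ ∞ ρ (Ioo 0 L)) :
    ccSpace L →ₗ[ℝ] ccSpace L where
  toFun f := ⟨⟨fun x => ρ x * f.1.1 x, by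
      refine (contDiff_iff_contDiffAt.2 fun x => ?_ : ContDiff ℝ ∞ fun x => ρ x * f.1.1 x)
      by_cases hx : x ∈ tsupport f.1.1
      · exact (hρ.contDiffAt (isOpen_Ioo.mem_nhds (f.2 hx))).mul (smoothFun.contDiff f.1).contDiffAt
      · refine (contDiffAt_const (c := (0 : ℝ))).congr_of_eventuallyEq ?_
        filter_upwards [(isClosed_tsupport f.1.1).isOpen_compl.mem_nhds hx] with z hz
        rw [image_eq_zero_of_notMem_tsupport hz, mul_zero]⟩,
    (tsupport_mul_subset_right (f := ρ)).trans f.2⟩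
  map_add' f g := Subtype.ext <| Subtype.ext <| funext fun x => mul_add _ _ _
  map_smul' a f := Subtype.ext <| Subtype.ext <| funext fun x => mul_left_comm _ _ _

lemma iteratedDeriv_sub_mul {f : ℝ → ℝ} (hf : ContDiff ℝ ∞ f) (n : ℕ) :
    iteratedDeriv (n + 1) (fun x => (L - x) * f x) =
      fun x => (L - x) * iteratedDeriv (n + 1) f x - (n + 1) * iteratedDeriv n f x := by
  have hy (x : ℝ) : HasDerivAt (fun x => L - x) (-1) x := by
    simpa using (hasDerivAt_id x).const_sub L
  induction n with
  | zero =>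
    funext x
    have h : HasDerivAt f (iteratedDeriv 1 f x) x := by simpa using hasDerivAt_iteratedDeriv hf 0 x
    rw [zero_add, iteratedDeriv_one, ((hy x).fun_mul h).deriv, iteratedDeriv_zero]
    push_cast
    ring
  | succ n ih =>
    funext x
    rw [iteratedDeriv_succ, ih, (((hy x).fun_mul (hasDerivAt_iteratedDeriv hf (n + 1) x)).fun_sub
      ((hasDerivAt_iteratedDeriv hf n x).const_mul _)).deriv]
    push_cast
    ring

/-- Multiplication by `L - x` takes test functions to the domain of the operator. -/
noncomputable def testMul (L : ℝ) : testSpace L →ₗ[ℝ] smoothDom L where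
  toFun ψ := ⟨⟨fun x => (L - x) * ψ.1.1 x,
      (contDiff_const.sub contDiff_id).mul (smoothFun.contDiff ψ.1)⟩, by
    obtain ⟨hs, h0, hl, h1, h1l, -⟩ := ψ.2
    have e1 := iteratedDeriv_sub_mul (L := L) hs 0
    have e2 := iteratedDeriv_sub_mul (L := L) hs 1
    rw [zero_add] at e1
    refine ⟨?_, ?_, ?_, ?_, ?_⟩
    · simp [h0]
    · simp
    · rw [e1]
      simp only [h1, iteratedDeriv_zero, h0]
      ring
    · rw [e1]
      simp only [iteratedDeriv_zero, hl]
      ring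
    · rw [e2]
      simp only [h1l]
      ring⟩
  map_add' f g := Subtype.ext <| Subtype.ext <| funext fun x => mul_add _ _ _
  map_smul' a f := Subtype.ext <| Subtype.ext <| funext fun x => mul_left_comm _ _ _

lemma coe_testMul (ψ : testSpace L) : (testMul L ψ : smoothFun).1 = fun x => (L - x) * ψ.1.1 x :=
  rfl

/-- The adjoint operator, with a factor `L - x`. -/
noncomputable def kawaharaAdjoint (L : ℝ) : testSpace L →ₗ[ℝ] H L :=
  liftLp (LinearMap.mulLeft ℝ (fun x => L - x) ∘ₗ smoothFun.subtype ∘ₗ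
      (-(smoothDeriv 1 + smoothDeriv 3 - smoothDeriv 5)) ∘ₗ (testSpace L).subtype) fun ψ =>
    (boundedByDist_of_smooth ((contDiff_const.sub contDiff_id).mul
      (smoothFun.contDiff (-(smoothDeriv 1 + smoothDeriv 3 - smoothDeriv 5) ψ.1)))
        (by simp)).memLp_H

lemma coeFn_kawaharaAdjoint (ψ : testSpace L) : ∀ᵐ x ∂leb L, kawaharaAdjoint L ψ x = (L - x) *
    -(iteratedDeriv 1 ψ.1.1 x + iteratedDeriv 3 ψ.1.1 x - iteratedDeriv 5 ψ.1.1 x) :=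
  ae_leb_of_ae_H (coeFn_liftLp _ _ ψ)

lemma memLp_leb_of_bounded {f : ℝ → ℝ} (hf : AEStronglyMeasurable f (leb L)) {B : ℝ}
    (hB : ∀ x ∈ Ioo 0 L, |f x| ≤ B) : MemLp f 2 (leb L) :=
  MemLp.of_bound hf B (by filter_upwards [ae_restrict_mem measurableSet_Ioo] with x hx using hB x hx)

lemma exists_bound_of_continuous {f : ℝ → ℝ} (hf : Continuous f) (L : ℝ) :
    ∃ B, ∀ x ∈ Ioo 0 L, |f x| ≤ B := by
  obtain ⟨B, hB⟩ := isCompact_Icc.exists_bound_of_continuousOn (s := Icc 0 L) hf.continuousOn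
  exact ⟨B, fun x hx => hB x (Ioo_subset_Icc_self hx)⟩

lemma memLp_leb_of_continuous {f : ℝ → ℝ} (hf : Continuous f) : MemLp f 2 (leb L) := by
  obtain ⟨B, hB⟩ := exists_bound_of_continuous hf L
  exact memLp_leb_of_bounded hf.aestronglyMeasurable hB

lemma IsCutoff.aestronglyMeasurable {ν : ℝ} {ρ : ℝ → ℝ} (hρ : IsCutoff L ν ρ) :
    AEStronglyMeasurable ρ (leb L) :=
  hρ.1.continuousOn.aestronglyMeasurable measurableSet_Ioo

/-- Smoothness on the open interval gives no bound by itself. The function is constant near both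
ends, and the transition zone `[L - ν, L - ν/2]` is a compact subset of `(0, L)`. -/
lemma IsCutoff.exists_bound {ν : ℝ} {ρ : ℝ → ℝ} (hν : 0 < ν) (hνL : ν < L)
    (hρ : IsCutoff L ν ρ) : ∃ B, ∀ x ∈ Ioo 0 L, |ρ x| ≤ B := by
  obtain ⟨B, hB⟩ := isCompact_Icc.exists_bound_of_continuousOn (s := Icc (L - ν) (L - ν / 2))
    (hρ.1.continuousOn.mono fun x hx => ⟨by linarith [hx.1], by linarith [hx.2]⟩)
  refine ⟨max B 1, fun x hx => ?_⟩
  rcases lt_or_ge x (L - ν) with h | h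
  · rw [hρ.2.1 x ⟨hx.1, h⟩]
    simp
  rcases lt_or_ge (L - ν / 2) x with h' | h'
  · rw [hρ.2.2 x ⟨h', hx.2⟩]
    simp
  exact (hB x ⟨h, h'⟩).trans (le_max_left _ _)

/-- The adjoint of the source operator `h ↦ (ρ h)_xx`. -/
noncomputable def sourceAdjoint {ρ : ℝ → ℝ} {B : ℝ} (hm : AEStronglyMeasurable ρ (leb L))
    (hB : ∀ x ∈ Ioo 0 L, |ρ x| ≤ B) : testSpace L →ₗ[ℝ] Lp ℝ 2 (leb L) :=
  liftLp (LinearMap.mulLeft ℝ ρ ∘ₗ smoothFun.subtype ∘ₗ smoothDeriv 2 ∘ₗ (testSpace L).subtype)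
    fun ψ => by
      obtain ⟨N, hN⟩ := exists_bound_of_continuous (continuous_iteratedDeriv ψ.1.2 2) L
      refine memLp_leb_of_bounded (B := B * N)
        (hm.mul (continuous_iteratedDeriv ψ.1.2 2).aestronglyMeasurable) fun x hx => ?_
      refine (abs_mul _ _).le.trans (mul_le_mul (hB x hx) (hN x hx) (abs_nonneg _) ?_)
      exact (abs_nonneg _).trans (hB x hx)

lemma coeFn_sourceAdjoint {ρ : ℝ → ℝ} {B : ℝ} (hm : AEStronglyMeasurable ρ (leb L))
    (hB : ∀ x ∈ Ioo 0 L, |ρ x| ≤ B) (ψ : testSpace L) :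
    ∀ᵐ x ∂leb L, sourceAdjoint hm hB ψ x = ρ x * iteratedDeriv 2 ψ.1.1 x :=
  coeFn_liftLp _ _ ψ

/-- Smooth functions with compact support as elements of `L²`. -/
noncomputable def ccToL2 (L : ℝ) : ccSpace L →ₗ[ℝ] Lp ℝ 2 (leb L) :=
  liftLp (smoothFun.subtype ∘ₗ (ccSpace L).subtype) fun f =>
    memLp_leb_of_continuous (smoothFun.contDiff f.1).continuous

lemma coeFn_ccToL2 (f : ccSpace L) : ∀ᵐ x ∂leb L, ccToL2 L f x = f.1.1 x := coeFn_liftLp _ _ f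

lemma inner_leb {f g : Lp ℝ 2 (leb L)} {f' g' : ℝ → ℝ} (hf : ∀ᵐ x ∂leb L, f x = f' x)
    (hg : ∀ᵐ x ∂leb L, g x = g' x) : inner ℝ f g = ∫ x in Ioo 0 L, f' x * g' x := by
  rw [L2.inner_def]
  refine integral_congr_ae ?_
  filter_upwards [hf, hg] with x h1 h2
  simp [h1, h2, mul_comm]

/-- Test functions as elements of the energy space, with a factor `L - x`. -/
noncomputable def testEnergy (hL : 0 < L) : testSpace L →ₗ[ℝ] energySpace hL :=
  toEnergy hL ∘ₗ testMul L

lemma coeFn_testEnergy (hL : 0 < L) (ψ : testSpace L) :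
    ∀ᵐ x ∂leb L, energyEmb hL (testEnergy hL ψ) x = (L - x) * ψ.1.1 x :=
  coeFn_energyEmb_toEnergy hL (testMul L ψ)

/-- Smooth functions with compact support as elements of the energy space. -/
noncomputable def ccEnergy (hL : 0 < L) : ccSpace L →ₗ[ℝ] energySpace hL :=
  toEnergy hL ∘ₗ Submodule.inclusion ccSpace_le_smoothDom

lemma coeFn_ccEnergy (hL : 0 < L) (c : ccSpace L) :
    ∀ᵐ x ∂leb L, energyEmb hL (ccEnergy hL c) x = c.1.1 x :=
  coeFn_energyEmb_toEnergy hL (Submodule.inclusion ccSpace_le_smoothDom c)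

/-- `IsTest.coercive` gives the constant `1/10`; half of it is given up so that the same constant
serves in the energy inequality with source. -/
lemma coercive_testEnergy (hL : 0 < L) (ψ : testSpace L) :
    1 / 20 * ‖testEnergy hL ψ‖ ^ 2 ≤
      inner ℝ (energyEmb hL (testEnergy hL ψ)) (kawaharaAdjoint L ψ) +
        ‖energyEmb hL (testEnergy hL ψ)‖ ^ 2 := by
  have h := IsTest.coercive hL ψ.2
  have hn : ‖testEnergy hL ψ‖ ^ 2 = ∫ x in Ioo 0 L, _ :=
    norm_sq_DV (coeFn_toEnergy hL (testMul L ψ))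
  have e2 := iteratedDeriv_sub_mul (L := L) (smoothFun.contDiff ψ.1) 1
  rw [inner_H_eq (coeFn_testEnergy hL ψ) (coeFn_kawaharaAdjoint ψ),
    norm_sq_H (coeFn_testEnergy hL ψ), hn, coe_testMul, e2,
    ← intervalIntegral_eq_Ioo hL.le, ← intervalIntegral_eq_Ioo hL.le,
    ← intervalIntegral_eq_Ioo hL.le]
  have e : ∫ x in (0 : ℝ)..L, ((L - x) * ψ.1.1 x) ^ 2 / (L - x) =
      ∫ x in (0 : ℝ)..L, (L - x) * ψ.1.1 x ^ 2 := by
    rw [intervalIntegral_eq_Ioo hL.le, intervalIntegral_eq_Ioo hL.le]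
    refine setIntegral_congr_fun measurableSet_Ioo fun x hx => ?_
    have : L - x ≠ 0 := (sub_pos.2 hx.2).ne'
    field_simp
  rw [e]
  refine le_trans ?_ h
  norm_num [-iteratedDeriv_one]
  have : 0 ≤ ∫ x in (0 : ℝ)..L,
      ((L - x) * iteratedDeriv 2 ψ.1.1 x - 2 * iteratedDeriv 1 ψ.1.1 x) ^ 2 / (L - x) ^ 2 :=
    intervalIntegral.integral_nonneg hL.le fun x _ => by positivity
  linarith

lemma inner_ccEnergy_testEnergy (hL : 0 < L) (c : ccSpace L) (ψ : testSpace L) :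
    inner ℝ (energyEmb hL (ccEnergy hL c)) (energyEmb hL (testEnergy hL ψ)) =
      ∫ x in (0 : ℝ)..L, c.1.1 x * ψ.1.1 x := by
  rw [inner_H_eq (coeFn_ccEnergy hL c) (coeFn_testEnergy hL ψ), intervalIntegral_eq_Ioo hL.le]

/-- The Kawahara operator on smooth functions with compact support. -/
noncomputable def kawaharaOp (L : ℝ) : ccSpace L →ₗ[ℝ] ccSpace L :=
  (smoothDeriv 1 + smoothDeriv 3 - smoothDeriv 5).restrict fun _ hc =>
    sub_mem (add_mem (smoothDeriv_mem_ccSpace hc 1) (smoothDeriv_mem_ccSpace hc 3))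
      (smoothDeriv_mem_ccSpace hc 5)

lemma inner_kawaharaOp (hL : 0 < L) (c : ccSpace L) (ψ : testSpace L) :
    inner ℝ (energyEmb hL (ccEnergy hL (kawaharaOp L c))) (energyEmb hL (testEnergy hL ψ)) =
      inner ℝ (energyEmb hL (ccEnergy hL c)) (kawaharaAdjoint L ψ) := by
  rw [inner_ccEnergy_testEnergy, inner_H_eq (coeFn_ccEnergy hL c) (coeFn_kawaharaAdjoint ψ),
    ← intervalIntegral_eq_Ioo hL.le]
  obtain ⟨hs, h0, hl, h1, h1l, h2⟩ := ψ.2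
  have hc := smoothFun.contDiff c.1
  obtain ⟨c0, cl, c1, c1l, c2l⟩ := ccSpace_le_smoothDom c.2
  have d0 {f : ℝ → ℝ} (hf : ContDiff ℝ ∞ f) (x : ℝ) : HasDerivAt f (iteratedDeriv 1 f x) x := by
    simpa using hasDerivAt_iteratedDeriv hf 0 x
  exact integral_kawahara_adjoint (d0 hc) (hasDerivAt_iteratedDeriv hc 1)
    (hasDerivAt_iteratedDeriv hc 2) (hasDerivAt_iteratedDeriv hc 3) (hasDerivAt_iteratedDeriv hc 4)
    (continuous_iteratedDeriv hc 5) (d0 hs) (hasDerivAt_iteratedDeriv hs 1)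
    (hasDerivAt_iteratedDeriv hs 2) (hasDerivAt_iteratedDeriv hs 3) (hasDerivAt_iteratedDeriv hs 4)
    (continuous_iteratedDeriv hs 5) c0 cl c1 c1l c2l h0 hl h1 h1l h2

lemma integral_ccDeriv_ccMul {ρ : ℝ → ℝ} (hρ : ContDiffOn ℝ ∞ ρ (Ioo 0 L))
    (c : ccSpace L) {p p1 p2 : ℝ → ℝ} (hp : ∀ x ∈ Ioo 0 L, HasDerivAt p (p1 x) x)
    (hp1 : ∀ x ∈ Ioo 0 L, HasDerivAt p1 (p2 x) x) (hp2 : ContinuousOn p2 (Ioo 0 L)) :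
    ∫ x in (0 : ℝ)..L, (ccDeriv L 2 (ccMul hρ c)).1.1 x * p x =
      ∫ x in (0 : ℝ)..L, ρ x * c.1.1 x * p2 x :=
  integral_deriv2_mul (smoothFun.contDiff (ccMul hρ c).1) (ccMul hρ c).2 hp hp1 hp2

lemma inner_sourceAdjoint {ρ : ℝ → ℝ} (hL : 0 < L) {B : ℝ} (hm : AEStronglyMeasurable ρ (leb L))
    (hB : ∀ x ∈ Ioo 0 L, |ρ x| ≤ B) (c : ccSpace L) (ψ : testSpace L) :
    inner ℝ (ccToL2 L c) (sourceAdjoint hm hB ψ) =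
      ∫ x in (0 : ℝ)..L, ρ x * c.1.1 x * iteratedDeriv 2 ψ.1.1 x := by
  rw [inner_leb (coeFn_ccToL2 c) (coeFn_sourceAdjoint hm hB ψ), ← intervalIntegral_eq_Ioo hL.le]
  exact intervalIntegral.integral_congr fun x _ => by ring

lemma inner_source {ρ : ℝ → ℝ} (hL : 0 < L) (hρ : ContDiffOn ℝ ∞ ρ (Ioo 0 L)) {B : ℝ}
    (hm : AEStronglyMeasurable ρ (leb L)) (hB : ∀ x ∈ Ioo 0 L, |ρ x| ≤ B) (c : ccSpace L)
    (ψ : testSpace L) :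
    inner ℝ (energyEmb hL (ccEnergy hL (ccDeriv L 2 (ccMul hρ c))))
      (energyEmb hL (testEnergy hL ψ)) = inner ℝ (ccToL2 L c) (sourceAdjoint hm hB ψ) := by
  rw [inner_ccEnergy_testEnergy, inner_sourceAdjoint hL hm hB]
  have hs := smoothFun.contDiff ψ.1
  exact integral_ccDeriv_ccMul hρ c (fun x _ => by simpa using hasDerivAt_iteratedDeriv hs 0 x)
    (fun x _ => hasDerivAt_iteratedDeriv hs 1 x) (continuous_iteratedDeriv hs 2).continuousOn

/-! ### Density of compactly supported functions and injectivity of the embedding. -/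

lemma ae_eq_zero_of_forall_ccSpace {f : ℝ → ℝ} (hf : LocallyIntegrableOn f (Ioo 0 L))
    (h : ∀ c : ccSpace L, ∫ x in Ioo 0 L, c.1.1 x * f x = 0) : ∀ᵐ x ∂leb L, f x = 0 := by
  refine (ae_restrict_iff' measurableSet_Ioo).2
    (isOpen_Ioo.ae_eq_zero_of_integral_contDiff_smul_eq_zero hf fun g hg _ hs => ?_)
  rw [← h ⟨⟨g, hg⟩, hs⟩, setIntegral_eq_integral_of_forall_compl_eq_zero]
  · rfl
  · intro x hx
    have : g x = 0 := image_eq_zero_of_notMem_tsupport fun h => hx (hs h)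
    exact mul_eq_zero_of_left this _

lemma denseRange_of_forall {D E : Type*} [AddCommMonoid D] [Module ℝ D] [NormedAddCommGroup E]
    [InnerProductSpace ℝ E] [CompleteSpace E] (f : D →ₗ[ℝ] E)
    (h : ∀ e, (∀ φ, inner ℝ (f φ) e = 0) → e = 0) : DenseRange f := by
  have : (LinearMap.range f).topologicalClosure = ⊤ := by
    rw [Submodule.topologicalClosure_eq_top_iff, Submodule.eq_bot_iff]
    exact fun e he => h e fun φ => he (f φ) ⟨φ, rfl⟩
  rw [← Submodule.dense_iff_topologicalClosure_eq_top, LinearMap.coe_range] at this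
  exact this

lemma locallyIntegrableOn_of_memLp {f : ℝ → ℝ} (hf : MemLp f 2 (leb L)) :
    LocallyIntegrableOn f (Ioo 0 L) :=
  IntegrableOn.locallyIntegrableOn (hf.integrable (by norm_num))

lemma denseRange_ccToL2 : DenseRange (ccToL2 L) := by
  refine denseRange_of_forall _ fun e he => ?_
  refine Lp.ext ?_
  have := ae_eq_zero_of_forall_ccSpace (locallyIntegrableOn_of_memLp (Lp.memLp e)) fun c => by
    exact (inner_leb (coeFn_ccToL2 c) (Filter.Eventually.of_forall fun _ => rfl)).symm.trans (he c)
  filter_upwards [this, Lp.coeFn_zero ℝ 2 (leb L)] with x h1 h2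
  rw [h1, h2, Pi.zero_apply]

lemma denseRange_ccEnergy (hL : 0 < L) : DenseRange fun c => energyEmb hL (ccEnergy hL c) := by
  refine denseRange_of_forall ((energyEmb hL).toLinearMap ∘ₗ ccEnergy hL) fun e he => ?_
  refine Lp.ext (ae_wMeas_of_ae ?_)
  have hw : ContinuousOn (fun x => 1 / (L - x)) (Ioo 0 L) :=
    ContinuousOn.div (by fun_prop) (by fun_prop) fun x hx => (sub_pos.2 hx.2).ne'
  have := ae_eq_zero_of_forall_ccSpace (f := fun x => (1 / (L - x)) * e x)
    ((locallyIntegrableOn_of_memLp (memLp_leb_H e)).continuousOn_mul hw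
      isOpen_Ioo.isLocallyClosed) fun c => by
    refine Eq.trans (integral_congr_ae ?_) ((inner_H _ _).symm.trans (he c))
    filter_upwards [coeFn_ccEnergy hL c] with x hx
    rw [LinearMap.comp_apply, ContinuousLinearMap.coe_coe, hx]
    ring
  filter_upwards [this, ae_leb_of_ae_H (Lp.coeFn_zero ℝ 2 _), ae_restrict_mem measurableSet_Ioo]
    with x h1 h2 hx
  rw [h2, Pi.zero_apply]
  exact (mul_eq_zero.1 h1).resolve_left (pos_H x hx).ne'

lemma integral_tailInt_mul_ccDeriv (hL : 0 < L) {f : ℝ → ℝ} (hf : IntervalIntegrable f volume 0 L)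
    {φ : ℝ → ℝ} (hφ : ContDiff ℝ ∞ φ) (h0 : φ 0 = 0) :
    ∫ x in Ioo 0 L, tailInt L f x * deriv φ x = ∫ x in Ioo 0 L, f x * φ x := by
  have := integral_tailInt_mul_deriv hL.le hf (hφ.of_le (by exact_mod_cast le_top))
  rw [h0, mul_zero, sub_zero, intervalIntegral_eq_Ioo hL.le, intervalIntegral_eq_Ioo hL.le] at this
  exact this

/-- If `v` vanishes almost everywhere, two integrations by parts against compactly supported
functions show that `v_xx` does too. -/
lemma energyEmb_injective (hL : 0 < L) : Function.Injective (energyEmb hL) := by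
  refine (injective_iff_map_eq_zero _).2 fun G hG => Subtype.ext (Lp.ext (ae_wMeas_of_ae ?_))
  have hz : ∀ᵐ x ∂leb L, tailInt L (tailInt L G.1) x = 0 := by
    filter_upwards [coeFn_energyEmb hL G, ae_leb_of_ae_H (Lp.coeFn_zero ℝ 2 _)] with x h1 h2
    rw [← h1, hG, h2, Pi.zero_apply]
  have := ae_eq_zero_of_forall_ccSpace (locallyIntegrableOn_of_memLp (memLp_leb G.1)) fun c => by
    have hc := smoothFun.contDiff c.1
    have i1 := continuousOn_tailInt_DV hL G.1
    have h1 := integral_tailInt_mul_ccDeriv hL (intervalIntegrable_DV hL G.1) hc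
      (eq_zero_of_mem_ccSpace c.2 0 zero_notMem)
    have h2 := integral_tailInt_mul_ccDeriv hL (f := tailInt L G.1)
      (ContinuousOn.intervalIntegrable (by rwa [uIcc_of_le hL.le]))
      (contDiff_iteratedDeriv hc 1) (eq_zero_of_mem_ccSpace c.2 1 zero_notMem)
    rw [iteratedDeriv_one, h1] at h2
    simp only [mul_comm (G.1 _)] at h2
    rw [← h2]
    refine integral_eq_zero_of_ae ?_
    filter_upwards [hz] with x hx
    rw [hx, zero_mul, Pi.zero_apply]
  filter_upwards [this, ae_leb_of_ae_DV (Lp.coeFn_zero ℝ 2 _)] with x h1 h2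
  rw [h1]
  exact h2.symm

lemma norm_sq_leb {f : Lp ℝ 2 (leb L)} {f' : ℝ → ℝ} (hf : ∀ᵐ x ∂leb L, f x = f' x) :
    ‖f‖ ^ 2 = ∫ x in Ioo 0 L, f' x ^ 2 := by
  rw [← real_inner_self_eq_norm_sq, inner_leb hf hf]
  simp only [sq]

/-! ### The source estimate and the Kawahara frame. -/

section profile

variable {v v1 v2 v3 v4 v5 : ℝ → ℝ}

/-- The second derivative of `v / (L - x)` is square integrable. -/
lemma IsProfile.integrable_deriv2_sq (hL : 0 < L) (h : IsProfile L v v1 v2 v3 v4 v5) :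
    IntegrableOn (fun x => (v2 x / (L - x) + 2 * v1 x / (L - x) ^ 2 + 2 * v x / (L - x) ^ 3) ^ 2)
      (Ioo 0 L) := by
  have hi {a b n : ℕ} {f g : ℝ → ℝ} (hf : VanishesTo L a f) (hg : VanishesTo L b g)
      (hn : n ≤ a + b) : IntegrableOn (fun x => f x * g x / (L - x) ^ n) (Ioo 0 L) :=
    (intervalIntegrable_iff_Ioo hL.le).1 (hf.intervalIntegrable_mul_div hL.le n hg hn)
  have := (((((hi (n := 2) h.o2 h.o2 (by norm_num)).add
    ((hi (n := 3) h.o2 h.o1 (by norm_num)).const_mul 4)).add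
    ((hi (n := 4) h.o2 h.o0 (by norm_num)).const_mul 4)).add
    ((hi (n := 4) h.o1 h.o1 (by norm_num)).const_mul 4)).add
    ((hi (n := 5) h.o1 h.o0 (by norm_num)).const_mul 8)).add
    ((hi (n := 6) h.o0 h.o0 (by norm_num)).const_mul 4)
  refine (integrableOn_congr_fun (fun x hx => ?_) measurableSet_Ioo).1 this
  have : L - x ≠ 0 := (sub_pos.2 hx.2).ne'
  simp only [Pi.add_apply]
  field_simp
  ring

lemma IsProfile.continuousOn_deriv2 (h : IsProfile L v v1 v2 v3 v4 v5) :
    ContinuousOn (fun x => v2 x / (L - x) + 2 * v1 x / (L - x) ^ 2 + 2 * v x / (L - x) ^ 3)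
      (Ioo 0 L) := by
  have c0 := h.c0.mono Ioo_subset_Icc_self
  have c1 := h.c1.mono Ioo_subset_Icc_self
  have c2 := h.c2.mono Ioo_subset_Icc_self
  have hy : ∀ x ∈ Ioo 0 L, L - x ≠ 0 := fun x hx => (sub_pos.2 hx.2).ne'
  refine ((c2.div (by fun_prop) hy).add ((c1.const_mul 2).div (by fun_prop) fun x hx => ?_)).add
    ((c0.const_mul 2).div (by fun_prop) fun x hx => ?_)
  · exact pow_ne_zero _ (hy x hx)
  · exact pow_ne_zero _ (hy x hx)

/-- The source term in the energy inequality. -/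
lemma IsProfile.source_le (hL : 0 < L) (h : IsProfile L v v1 v2 v3 v4 v5) {ρ : ℝ → ℝ}
    (hρ : ContDiffOn ℝ ∞ ρ (Ioo 0 L)) {B : ℝ} (hB : ∀ x ∈ Ioo 0 L, |ρ x| ≤ B) (e : ccSpace L) :
    ∫ x in Ioo 0 L, (ccDeriv L 2 (ccMul hρ e)).1.1 x * (v x / (L - x)) ≤
      50 * B ^ 2 * ‖ccToL2 L e‖ ^ 2 + 1 / 20 * ∫ x in (0 : ℝ)..L, v2 x * v2 x / (L - x) ^ 2 := by
  obtain ⟨k1, k2⟩ := hasDerivAt_div_sub h.d0 h.d1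
  have h1 := integral_ccDeriv_ccMul hρ e k1 k2 h.continuousOn_deriv2
  rw [intervalIntegral_eq_Ioo hL.le, intervalIntegral_eq_Ioo hL.le] at h1
  rw [h1]
  set p := fun x => v2 x / (L - x) + 2 * v1 x / (L - x) ^ 2 + 2 * v x / (L - x) ^ 3 with hp
  have ip : IntegrableOn (fun x => p x ^ 2) (Ioo 0 L) := h.integrable_deriv2_sq hL
  have he := smoothFun.contDiff e.1
  have ie : IntegrableOn (fun x => e.1.1 x ^ 2) (Ioo 0 L) :=
    (memLp_leb_of_continuous he.continuous).integrable_sq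
  -- Young's inequality with weights `50` and `1/200`: combined with the Hardy constant `10`, the
  -- second weight becomes `1/20`, half of the coercivity constant `1/10`.
  have hle : ∀ x ∈ Ioo 0 L, |ρ x * e.1.1 x * p x| ≤
      50 * B ^ 2 * e.1.1 x ^ 2 + 1 / 200 * p x ^ 2 := fun x hx => by
    have h2 : (ρ x * e.1.1 x) ^ 2 ≤ B ^ 2 * e.1.1 x ^ 2 := by
      rw [mul_pow]
      exact mul_le_mul_of_nonneg_right
        (sq_le_sq' (abs_le.1 (hB x hx)).1 (abs_le.1 (hB x hx)).2) (sq_nonneg _)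
    rw [abs_le]
    constructor <;>
      nlinarith [sq_nonneg (100 * (ρ x * e.1.1 x) + p x), sq_nonneg (100 * (ρ x * e.1.1 x) - p x)]
  have ir : IntegrableOn (fun x => 50 * B ^ 2 * e.1.1 x ^ 2 + 1 / 200 * p x ^ 2) (Ioo 0 L) :=
    (ie.const_mul _).add (ip.const_mul _)
  have il : IntegrableOn (fun x => ρ x * e.1.1 x * p x) (Ioo 0 L) := by
    refine Integrable.mono' ir (((hρ.continuousOn.mul he.continuous.continuousOn).mul
      h.continuousOn_deriv2).aestronglyMeasurable measurableSet_Ioo) ?_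
    filter_upwards [ae_restrict_mem measurableSet_Ioo] with x hx using hle x hx
  have h3 := setIntegral_mono_on il ir measurableSet_Ioo fun x hx =>
    (le_abs_self _).trans (hle x hx)
  rw [integral_add (ie.const_mul _) (ip.const_mul _), integral_const_mul, integral_const_mul,
    ← norm_sq_leb (coeFn_ccToL2 e)] at h3
  have h4 := h.hardy hL
  rw [intervalIntegral_eq_Ioo hL.le] at h4
  linarith

end profile

lemma inner_energyEmb (hL : 0 < L) (v g : energySpace hL) :
    inner ℝ (energyEmb hL g) (energyEmb hL v) =
      ∫ x in Ioo 0 L, tailInt L (tailInt L g.1) x * (tailInt L (tailInt L v.1) x / (L - x)) := by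
  refine inner_H_eq (coeFn_energyEmb hL g) ?_
  filter_upwards [coeFn_energyEmb hL v, ae_restrict_mem measurableSet_Ioo] with x h hx
  have : L - x ≠ 0 := (sub_pos.2 hx.2).ne'
  rw [h]
  field_simp

/-- The energy inequality for weak solutions of the stationary equation. -/
theorem energy_energySpace (hL : 0 < L) {ρ : ℝ → ℝ} (hρ : ContDiffOn ℝ ∞ ρ (Ioo 0 L)) {B : ℝ}
    (hm : AEStronglyMeasurable ρ (leb L)) (hB : ∀ x ∈ Ioo 0 L, |ρ x| ≤ B)
    (v g : energySpace hL) (e : ccSpace L)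
    (h : ∀ ψ, inner ℝ (energyEmb hL v) (kawaharaAdjoint L ψ) =
      inner ℝ (ccToL2 L e) (sourceAdjoint hm hB ψ) -
        inner ℝ (energyEmb hL g) (energyEmb hL (testEnergy hL ψ))) :
    1 / 20 * ‖v‖ ^ 2 ≤ -inner ℝ (energyEmb hL g) (energyEmb hL v) + ‖energyEmb hL v‖ ^ 2 +
      50 * B ^ 2 * ‖ccToL2 L e‖ ^ 2 := by
  set w := tailInt L (tailInt L v.1) with hw
  set k := tailInt L (tailInt L g.1) with hk
  set s := (ccDeriv L 2 (ccMul hρ e)).1.1 with hs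
  have cw : ContinuousOn w (Icc 0 L) := continuousOn_tailInt_tailInt hL v.1
  have ck : ContinuousOn k (Icc 0 L) := continuousOn_tailInt_tailInt hL g.1
  have cs : Continuous s := (smoothFun.contDiff (ccDeriv L 2 (ccMul hρ e)).1).continuous
  -- By adjointness the source is the smooth function `(ρ e)_xx`, and `g` has a continuous
  -- representative because it lies in `V`. The weak equation thus has a continuous right-hand side,
  -- and `v` is classical.
  obtain ⟨v1, v2, v3, v4, v5, hprof, h2, hf⟩ := exists_isProfile hL
    (intervalIntegrable_DV hL v.1) ((mem_energySpace hL).1 v.2).1 ((mem_energySpace hL).1 v.2).2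
    (f := fun x => s x - k x) (cs.continuousOn.sub ck) (fun ψ hψ => by
      have h1 := h ⟨⟨ψ, hψ.1⟩, hψ⟩
      rw [← inner_source hL hρ, inner_H_eq (coeFn_energyEmb hL v) (coeFn_kawaharaAdjoint _),
        inner_ccEnergy_testEnergy, inner_H_eq (coeFn_energyEmb hL g) (coeFn_testEnergy hL _),
        ← intervalIntegral_eq_Ioo hL.le, ← intervalIntegral_eq_Ioo hL.le,
        ← intervalIntegral.integral_sub] at h1
      · refine h1.trans (intervalIntegral.integral_congr fun x _ => ?_)
        exact (sub_mul _ _ _).symm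
      · exact (cs.mul hψ.1.continuous).intervalIntegrable _ _
      · refine ContinuousOn.intervalIntegrable ?_
        rw [uIcc_of_le hL.le]
        exact ck.mul hψ.1.continuous.continuousOn)
  have he := hprof.energy hL
  simp only [← hf] at he
  have hn : ‖v‖ ^ 2 = ∫ x in (0 : ℝ)..L, v2 x * v2 x / (L - x) ^ 2 := by
    rw [intervalIntegral_eq_Ioo hL.le]
    refine (norm_sq_DV (h2.mono fun x hx => hx.symm)).trans ?_
    simp only [sq]
  have hs := hprof.source_le hL hρ hB e
  rw [← hn] at he hs
  have iq {f : ℝ → ℝ} (hf : ContinuousOn f (Icc 0 L)) :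
      IntegrableOn (fun x => f x * (w x / (L - x))) (Ioo 0 L) := by
    have := (intervalIntegrable_iff_Ioo hL.le).1
      ((ContinuousOn.vanishesTo_zero hf).intervalIntegrable_mul_div hL.le 1 hprof.o0
        (by norm_num))
    simpa only [pow_one, mul_div_assoc] using this
  have e1 : ∫ x in (0 : ℝ)..L, (s x - k x) * w x / (L - x) ^ 1 =
      (∫ x in Ioo 0 L, s x * (w x / (L - x))) - inner ℝ (energyEmb hL g) (energyEmb hL v) := by
    rw [inner_energyEmb, ← integral_sub (iq cs.continuousOn) (iq ck),
      intervalIntegral_eq_Ioo hL.le]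
    refine integral_congr_ae (Filter.Eventually.of_forall fun x => ?_)
    simp only [pow_one]
    ring
  have e2 : ∫ x in (0 : ℝ)..L, w x * w x / (L - x) ^ 1 = ‖energyEmb hL v‖ ^ 2 := by
    rw [norm_sq_H (coeFn_energyEmb hL v), intervalIntegral_eq_Ioo hL.le]
    simp only [pow_one, sq, hw]
  rw [e1, e2] at he
  linarith

/-- The abstract frame of the Kawahara system. -/
noncomputable def kawaharaFrame (hL : 0 < L) {ρ : ℝ → ℝ} (hρ : ContDiffOn ℝ ∞ ρ (Ioo 0 L)) {B : ℝ}
    (hm : AEStronglyMeasurable ρ (leb L)) (hB : ∀ x ∈ Ioo 0 L, |ρ x| ≤ B) :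
    Frame (energySpace hL) (H L) (Lp ℝ 2 (leb L)) (testSpace L) (ccSpace L) where
  j := energyEmb hL
  d := testEnergy hL
  adj := kawaharaAdjoint L
  b := sourceAdjoint hm hB
  κ := ccEnergy hL
  ι := ccToL2 L
  A := kawaharaOp L
  q := ccDeriv L 2 ∘ₗ ccMul hρ
  c := 1 / 20
  M := 50 * B ^ 2
  c_pos := by norm_num
  M_nonneg := by positivity
  coercive := coercive_testEnergy hL
  adj_κ := inner_kawaharaOp hL
  q_κ := inner_source hL hρ hm hB
  energy := energy_energySpace hL hρ hm hB
  denseRange_κ := denseRange_ccEnergy hL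
  denseRange_ι := denseRange_ccToL2
  j_injective := energyEmb_injective hL

/-! ### Weak derivatives and the identification of `V`. -/

/-- The primitive from `0` vanishes at `L` by the zero mean. It is constant off the hull `[a, b]` of
the support of `f`, hence zero on both sides of it. -/
lemma exists_ccSpace_primitive {f : ℝ → ℝ} (hf : ContDiff ℝ ∞ f) (hs : tsupport f ⊆ Ioo 0 L)
    (h0 : ∫ x in (0 : ℝ)..L, f x = 0) :
    ∃ φ : ℝ → ℝ, ContDiff ℝ ∞ φ ∧ tsupport φ ⊆ Ioo 0 L ∧ deriv φ = f := by
  obtain ⟨φ, hφ, hd, hφ0⟩ := exists_smooth_primitive hf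
  have hint (a b : ℝ) : ∫ x in a..b, f x = φ b - φ a :=
    intervalIntegral.integral_eq_sub_of_hasDerivAt (fun x _ => hd x)
      (hf.continuous.intervalIntegrable _ _)
  have hφL : φ L = 0 := by linarith [hint 0 L]
  refine ⟨φ, hφ, ?_, funext fun x => (hd x).deriv⟩
  rcases (tsupport f).eq_empty_or_nonempty with he | hne
  · have hfz : f = 0 := tsupport_eq_empty_iff.1 he
    have : φ = 0 := funext fun x => by
      have := hint 0 x
      simp only [hfz, Pi.zero_apply, intervalIntegral.integral_zero] at this
      simp only [Pi.zero_apply]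
      linarith
    rw [this]
    simp [tsupport]
  have hc : IsCompact (tsupport f) :=
    isCompact_Icc.of_isClosed_subset (isClosed_tsupport f) (hs.trans Ioo_subset_Icc_self)
  obtain ⟨a, ha, ha'⟩ := hc.exists_isLeast hne
  obtain ⟨b, hb, hb'⟩ := hc.exists_isGreatest hne
  have hz {c d : ℝ} (h : ∀ x ∈ uIoc c d, x ∉ tsupport f) : φ d = φ c := by
    have : ∫ x in c..d, f x = 0 := intervalIntegral.integral_zero_ae
      (Filter.Eventually.of_forall fun x hx => image_eq_zero_of_notMem_tsupport (h x hx))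
    linarith [hint c d]
  have : tsupport φ ⊆ Icc a b := by
    refine closure_minimal (fun x hx => ?_) isClosed_Icc
    by_contra hxab
    refine hx ?_
    rw [mem_Icc, not_and_or, not_le, not_le] at hxab
    rcases hxab with h | h
    · rw [hz (c := 0), hφ0]
      intro y hy hy'
      exact (hy.2.trans_lt (max_lt (hs ha).1 h)).not_ge (ha' hy')
    · rw [hz (c := L), hφL]
      intro y hy hy'
      exact ((lt_min (hs hb).2 h).trans hy.1).not_ge (hb' hy')
  exact this.trans fun x hx => ⟨(hs ha).1.trans_le hx.1, hx.2.trans_lt (hs hb).2⟩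

/-- A continuous function with vanishing weak derivative is constant. -/
lemma eqOn_zero_of_weakDeriv (hL : 0 < L) {f : ℝ → ℝ} (hf : ContinuousOn f (Icc 0 L))
    (h : ∀ φ : ℝ → ℝ, ContDiff ℝ ∞ φ → tsupport φ ⊆ Ioo 0 L →
      ∫ x in Ioo 0 L, f x * deriv φ x = 0) (hfL : f L = 0) : ∀ x ∈ Icc 0 L, f x = 0 := by
  -- A bump function of integral one. Subtracting its multiple `m θ` from a test function of
  -- integral `m` leaves zero mean, hence the derivative of an admissible test function.
  let B : ContDiffBump (L / 2) := ⟨L / 8, L / 4, by linarith, by linarith⟩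
  set θ : ℝ → ℝ := B.normed volume with hθ
  have sθ : ContDiff ℝ ∞ θ := B.contDiff_normed
  have tθ : tsupport θ ⊆ Ioo 0 L := by
    rw [hθ, B.tsupport_normed_eq, Real.closedBall_eq_Icc]
    intro x hx
    have h1 : L / 2 - L / 4 ≤ x := hx.1
    have h2 : x ≤ L / 2 + L / 4 := hx.2
    constructor <;> linarith
  have hIoo {g : ℝ → ℝ} (hg : tsupport g ⊆ Ioo 0 L) : ∫ x in Ioo 0 L, g x = ∫ x, g x :=
    setIntegral_eq_integral_of_forall_compl_eq_zero fun x hx =>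
      image_eq_zero_of_notMem_tsupport fun h => hx (hg h)
  have iθ : ∫ x in Ioo 0 L, θ x = 1 := (hIoo tθ).trans B.integral_normed
  have ic {g : ℝ → ℝ} (hg : Continuous g) : IntegrableOn g (Ioo 0 L) :=
    (hg.continuousOn.integrableOn_compact isCompact_Icc).mono_set Ioo_subset_Icc_self
  have icf {g : ℝ → ℝ} (hg : Continuous g) : IntegrableOn (fun x => f x * g x) (Ioo 0 L) :=
    ((hf.mul hg.continuousOn).integrableOn_compact isCompact_Icc).mono_set Ioo_subset_Icc_self
  set K := ∫ x in Ioo 0 L, f x * θ x with hK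
  have key := ae_eq_zero_of_forall_ccSpace (f := fun x => f x - K)
    (((hf.sub continuousOn_const).mono Ioo_subset_Icc_self).locallyIntegrableOn measurableSet_Ioo)
    fun c => by
      have sc := smoothFun.contDiff c.1
      set m := ∫ x in Ioo 0 L, c.1.1 x with hm
      have hs : ContDiff ℝ ∞ fun x => c.1.1 x - m * θ x := sc.sub (contDiff_const.mul sθ)
      obtain ⟨φ, hφ, tφ, hd⟩ := exists_ccSpace_primitive hs (L := L)
        ((tsupport_sub _ _).trans (union_subset c.2
          ((tsupport_mul_subset_right (f := fun _ => m)).trans tθ))) (by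
          rw [intervalIntegral_eq_Ioo hL.le,
            integral_sub (ic sc.continuous) ((ic sθ.continuous).const_mul m), integral_const_mul,
            iθ, ← hm, mul_one, sub_self])
      have h1 := h φ hφ tφ
      rw [hd] at h1
      have h2 : ∫ x in Ioo 0 L, f x * (c.1.1 x - m * θ x) =
          (∫ x in Ioo 0 L, f x * c.1.1 x) - m * K := by
        rw [hK, ← integral_const_mul, ← integral_sub (icf sc.continuous)
          ((icf sθ.continuous).const_mul m)]
        exact integral_congr_ae (Filter.Eventually.of_forall fun x => by ring)
      have h3 : ∫ x in Ioo 0 L, c.1.1 x * (f x - K) = (∫ x in Ioo 0 L, f x * c.1.1 x) - K * m := by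
        rw [hm, ← integral_const_mul, ← integral_sub (icf sc.continuous)
          ((ic sc.continuous).const_mul K)]
        exact integral_congr_ae (Filter.Eventually.of_forall fun x => by ring)
      linarith
  have hE : EqOn f (fun _ => K) (Icc 0 L) := by
    refine Measure.eqOn_Icc_of_ae_eq volume hL.ne ?_ hf continuousOn_const
    rw [← Measure.restrict_congr_set Ioo_ae_eq_Icc]
    filter_upwards [key] with x hx using sub_eq_zero.1 hx
  have hK0 : K = 0 := (hE ⟨hL.le, le_rfl⟩).symm.trans hfL
  intro x hx
  rw [hE hx, hK0]

lemma hasWeakDeriv_tailInt (hL : 0 < L) {f : ℝ → ℝ} (hf : IntervalIntegrable f volume 0 L)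
    (hf' : LocallyIntegrableOn f (Ioo 0 L)) : HasWeakDeriv L (tailInt L f) fun x => -f x := by
  refine ⟨((continuousOn_tailInt hL.le hf).mono Ioo_subset_Icc_self).locallyIntegrableOn
    measurableSet_Ioo, hf'.neg, fun φ hφ _ hs => ?_⟩
  rw [integral_tailInt_mul_ccDeriv hL hf hφ
    (image_eq_zero_of_notMem_tsupport fun h => zero_notMem (hs h)), ← integral_neg]
  simp

lemma HasWeakDeriv.eqOn_tailInt (hL : 0 < L) {f g : ℝ → ℝ} (h : HasWeakDeriv L f fun x => -g x)
    (hf : ContinuousOn f (Icc 0 L)) (hfL : f L = 0) (hg : IntervalIntegrable g volume 0 L) :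
    ∀ x ∈ Icc 0 L, f x = tailInt L g x := by
  have cg := continuousOn_tailInt hL.le hg
  have ic {k φ : ℝ → ℝ} (hk : ContinuousOn k (Icc 0 L)) (hφ : Continuous φ) :
      IntegrableOn (fun x => k x * φ x) (Ioo 0 L) :=
    ((hk.mul hφ.continuousOn).integrableOn_compact isCompact_Icc).mono_set Ioo_subset_Icc_self
  have := eqOn_zero_of_weakDeriv hL (f := fun x => f x - tailInt L g x) (hf.sub cg)
    (fun φ hφ hs => by
      have hc : HasCompactSupport φ :=
        isCompact_Icc.of_isClosed_subset (isClosed_tsupport φ) (hs.trans Ioo_subset_Icc_self)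
      have hd : Continuous (deriv φ) := by
        rw [← iteratedDeriv_one]
        exact continuous_iteratedDeriv hφ 1
      simp only [sub_mul]
      rw [integral_sub (ic hf hd) (ic cg hd), h.2.2 φ hφ hc hs, integral_tailInt_mul_ccDeriv hL hg hφ
        (image_eq_zero_of_notMem_tsupport fun h => zero_notMem (hs h)), ← integral_neg]
      simp) (by simp [hfL])
  exact fun x hx => sub_eq_zero.1 (this x hx)

/-- The space `V` in terms of the second derivative. -/
theorem memH20With_iff (hL : 0 < L) (v : ℝ → ℝ) (G : DV L) :
    MemH20With L v G ↔ G ∈ energySpace hL ∧ ∀ᵐ x ∂leb L, v x = tailInt L (tailInt L G) x := by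
  have hG := intervalIntegrable_DV hL G
  have c1 := continuousOn_tailInt_DV hL G
  have i1 : IntervalIntegrable (tailInt L G) volume 0 L :=
    ContinuousOn.intervalIntegrable (by rwa [uIcc_of_le hL.le])
  have m0 : (0 : ℝ) ∈ Icc 0 L := ⟨le_rfl, hL.le⟩
  constructor
  · rintro ⟨-, w, w₁, hv, cw, cw₁, hw, hw₁, w0, wL, w₁0, w₁L⟩
    have e1 := HasWeakDeriv.eqOn_tailInt hL (f := fun x => -w₁ x) (g := G) (by
      obtain ⟨k1, k2, k3⟩ := hw₁
      refine ⟨k1.neg, k2.neg, fun φ hφ hc hs => ?_⟩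
      have := k3 φ hφ hc hs
      simp only [neg_mul, integral_neg]
      linarith) cw₁.neg (by simp [w₁L]) hG
    have e0 := HasWeakDeriv.eqOn_tailInt hL (f := w) (g := tailInt L G) (by
      obtain ⟨k1, k2, k3⟩ := hw
      refine ⟨k1, (c1.neg.mono Ioo_subset_Icc_self).locallyIntegrableOn measurableSet_Ioo,
        fun φ hφ hc hs => ?_⟩
      rw [k3 φ hφ hc hs]
      congr 1
      refine setIntegral_congr_fun measurableSet_Ioo fun x hx => ?_
      simp only [← e1 x (Ioo_subset_Icc_self hx), neg_neg]) cw wL i1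
    refine ⟨(mem_energySpace hL).2 ⟨?_, ?_⟩, ?_⟩
    · rw [← e1 0 m0, w₁0, neg_zero]
    · rw [← e0 0 m0, w0]
    · filter_upwards [hv, ae_restrict_mem measurableSet_Ioo] with x hx hm
      rw [hx, e0 x (Ioo_subset_Icc_self hm)]
  · rintro ⟨hm, hv⟩
    obtain ⟨h0, h1⟩ := (mem_energySpace hL).1 hm
    have lG : LocallyIntegrableOn G (Ioo 0 L) := locallyIntegrableOn_of_memLp (memLp_leb G)
    refine ⟨memLp_leb G, tailInt L (tailInt L G), fun x => -tailInt L G x, hv,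
      continuousOn_tailInt_tailInt hL G, c1.neg, hasWeakDeriv_tailInt hL i1
        ((c1.mono Ioo_subset_Icc_self).locallyIntegrableOn measurableSet_Ioo), ?_, h1, by simp,
      by simp [h0], by simp⟩
    obtain ⟨k1, k2, k3⟩ := hasWeakDeriv_tailInt hL hG lG
    refine ⟨k1.neg, lG, fun φ hφ hc hs => ?_⟩
    have := k3 φ hφ hc hs
    simp only [neg_mul, integral_neg] at this ⊢
    linarith

/-! ### Translation between the concrete and the abstract formulation. -/

section translation

variable {T : ℝ}

/-- The embedding of the functions with values in the energy space. -/
noncomputable def energyToDV (T : ℝ) (hL : 0 < L) (U : Lp (energySpace hL) 2 (lebT T)) :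
    L2Time T (DV L) := (energySpace hL).subtypeL.compLp U

lemma coeFn_energyToDV (hL : 0 < L) (U : Lp (energySpace hL) 2 (lebT T)) :
    ∀ᵐ t ∂lebT T, energyToDV T hL U t = (U t : DV L) := (energySpace hL).subtypeL.coeFn_compLp U

lemma norm_energyToDV (hL : 0 < L) (U : Lp (energySpace hL) 2 (lebT T)) :
    ‖energyToDV T hL U‖ = ‖U‖ := by
  refine le_antisymm (Lp.norm_le_norm_of_ae_le ?_) (Lp.norm_le_norm_of_ae_le ?_)
  all_goals
    filter_upwards [coeFn_energyToDV hL U] with t ht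
    rw [ht, Submodule.coe_norm]

lemma memL2VWith_iff (hL : 0 < L) (u : C(Icc (0 : ℝ) T, H L)) (U : L2Time T (DV L)) :
    MemL2VWith u U ↔ ∃ W : Lp (energySpace hL) 2 (lebT T), energyToDV T hL W = U ∧
      ∀ᵐ t ∂lebT T, energyEmb hL (W t) = u t := by
  have key (t : Icc (0 : ℝ) T) (G : DV L) : MemH20With L (u t) G ↔
      G ∈ energySpace hL ∧ embH hL G = u t := by
    rw [memH20With_iff hL]
    refine and_congr_right fun _ => ⟨fun h => Lp.ext (ae_wMeas_of_ae ?_), fun h => ?_⟩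
    · filter_upwards [h, coeFn_embH hL G] with x h1 h2
      rw [h1, h2]
    · rw [← h]
      exact coeFn_embH hL G
  constructor
  · intro h
    -- Composing with the orthogonal projection yields a measurable function with values in the
    -- subspace; it coincides with `U` wherever `U t` already lies there.
    let P := (energySpace hL).orthogonalProjectionOnto
    have hP : ∀ᵐ t ∂lebT T, (P.compLp U t : DV L) = U t := by
      filter_upwards [h, P.coeFn_compLp U] with t h1 h2
      rw [h2]
      exact Submodule.starProjection_eq_self_iff.2 ((key t _).1 h1).1
    refine ⟨P.compLp U, Lp.ext ?_, ?_⟩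
    · filter_upwards [coeFn_energyToDV hL (P.compLp U), hP] with t h1 h2
      rw [h1, h2]
    · filter_upwards [hP, h] with t h1 h2
      rw [← ((key t _).1 h2).2, ← h1]
      rfl
  · rintro ⟨W, rfl, hW⟩
    filter_upwards [hW, coeFn_energyToDV hL W] with t h1 h2
    rw [h2, key]
    exact ⟨(W t).2, h1⟩

/-- The factor `L - x` carried by `testEnergy` and `kawaharaAdjoint` cancels the weight of `H`, so
the abstract inner products are the unweighted integrals of the definition. -/
lemma isSolution_iff (hL : 0 < L) {ρ : ℝ → ℝ} (hρ : ContDiffOn ℝ ∞ ρ (Ioo 0 L)) {B : ℝ}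
    (hm : AEStronglyMeasurable ρ (leb L)) (hB : ∀ x ∈ Ioo 0 L, |ρ x| ≤ B) (u₀ : H L)
    (h : L2Time T (Lp ℝ 2 (leb L))) (u : C(Icc (0 : ℝ) T, H L))
    (W : Lp (energySpace hL) 2 (lebT T)) (hW : ∀ᵐ t ∂lebT T, energyEmb hL (W t) = u t) :
    IsSolution ρ u₀ h u ↔ (kawaharaFrame hL hρ hm hB).IsWeakSol u₀ h u W := by
  have e1 (v : H L) (ψ : testSpace L) : inner ℝ v (energyEmb hL (testEnergy hL ψ)) =
      ∫ x in Ioo 0 L, v x * ψ.1.1 x :=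
    inner_H_eq (Filter.Eventually.of_forall fun _ => rfl) (coeFn_testEnergy hL ψ)
  have e2 (v : H L) (ψ : testSpace L) : inner ℝ v (kawaharaAdjoint L ψ) =
      -∫ x in Ioo 0 L, v x *
        (iteratedDeriv 1 ψ.1.1 x + iteratedDeriv 3 ψ.1.1 x - iteratedDeriv 5 ψ.1.1 x) := by
    rw [inner_H_eq (Filter.Eventually.of_forall fun _ => rfl) (coeFn_kawaharaAdjoint ψ),
      ← integral_neg]
    simp only [mul_neg]
  have e3 (v : Lp ℝ 2 (leb L)) (ψ : testSpace L) : inner ℝ v (sourceAdjoint hm hB ψ) =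
      ∫ x in Ioo 0 L, ρ x * v x * iteratedDeriv 2 ψ.1.1 x := by
    rw [inner_leb (Filter.Eventually.of_forall fun _ => rfl) (coeFn_sourceAdjoint hm hB ψ)]
    exact integral_congr_ae (Filter.Eventually.of_forall fun x => by ring)
  have i1 (x : H L) (t : Icc (0 : ℝ) T) :
      Integrable (fun s => inner ℝ (u s) x) ((lebT T).restrict (Iic t)) := by
    have hc : Continuous fun s => inner ℝ (u s) x := by fun_prop
    exact (hc.integrable_of_hasCompactSupport (HasCompactSupport.of_compactSpace _)).restrict
  have i2 (x : Lp ℝ 2 (leb L)) (t : Icc (0 : ℝ) T) :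
      Integrable (fun s => inner ℝ (h s) x) ((lebT T).restrict (Iic t)) :=
    (((Lp.memLp h).integrable (by norm_num)).inner_const x).restrict
  have key (ψ : testSpace L) (t : Icc (0 : ℝ) T) :
      inner ℝ u₀ (energyEmb hL (testEnergy hL ψ)) -
        (∫ s in Iic t, inner ℝ (u s) (kawaharaAdjoint L ψ) ∂lebT T) +
        ∫ s in Iic t, inner ℝ (h s) (sourceAdjoint hm hB ψ) ∂lebT T =
      (∫ x in Ioo 0 L, u₀ x * ψ.1.1 x) +
        ∫ s in Iic t,
          ((∫ x in Ioo 0 L, u s x *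
              (iteratedDeriv 1 ψ.1.1 x + iteratedDeriv 3 ψ.1.1 x - iteratedDeriv 5 ψ.1.1 x)) +
            ∫ x in Ioo 0 L, ρ x * h s x * iteratedDeriv 2 ψ.1.1 x) ∂lebT T := by
    rw [e1, sub_add, ← integral_sub (i1 _ t) (i2 _ t), sub_eq_add_neg, ← integral_neg]
    simp only [e2, e3]
    congr 1
    exact integral_congr_ae (Filter.Eventually.of_forall fun s => by ring)
  constructor
  · rintro ⟨h1, h2⟩
    refine ⟨h1, hW, fun ψ t => ?_⟩
    exact (e1 _ ψ).trans ((h2 ψ.1.1 ψ.2 t).trans (key ψ t).symm)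
  · rintro ⟨h1, -, h3⟩
    refine ⟨h1, fun ψ hψ t => ?_⟩
    exact (e1 _ ⟨⟨ψ, hψ.1⟩, hψ⟩).symm.trans ((h3 ⟨⟨ψ, hψ.1⟩, hψ⟩ t).trans (key _ t))

end translation

end Kawahara

/-! ### The main theorem. -/

theorem mainTheorem7 (T L ν : ℝ) (hT : 0 < T) (hν : 0 < ν) (hνL : ν < L) (ρ : ℝ → ℝ)
    (hρ : Kawahara.IsCutoff L ν ρ) :
    ∃ C : ℝ, 0 < C ∧
      ∀ (u₀ : Kawahara.H L) (h : Kawahara.L2Time T (Lp ℝ 2 (Kawahara.leb L))),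
        (∃! u : C(Icc (0 : ℝ) T, Kawahara.H L),
          (∃ U : Kawahara.L2Time T (Kawahara.DV L), Kawahara.MemL2VWith u U) ∧
            Kawahara.IsSolution ρ u₀ h u) ∧
        ∀ (u : C(Icc (0 : ℝ) T, Kawahara.H L)) (U : Kawahara.L2Time T (Kawahara.DV L)),
          Kawahara.MemL2VWith u U → Kawahara.IsSolution ρ u₀ h u →
            ‖u‖ + ‖U‖ ≤ C * (‖u₀‖ + ‖h‖) := by
  have hL : 0 < L := hν.trans hνL
  obtain ⟨B, hB⟩ := hρ.exists_bound hν hνL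
  -- A finite exponent makes the source space `L²(0, L)` separable, as `wellPosed` requires.
  have : Fact ((2 : ENNReal) ≠ ⊤) := ⟨by norm_num⟩
  obtain ⟨K, hK, hwp⟩ :=
    (Kawahara.kawaharaFrame hL hρ.1 hρ.aestronglyMeasurable hB).wellPosed hT
  refine ⟨K, hK, fun u₀ h => ?_⟩
  obtain ⟨u, W, hu, hle, huniq⟩ := hwp u₀ h
  have key (u' : C(Icc (0 : ℝ) T, Kawahara.H L)) (U : Kawahara.L2Time T (Kawahara.DV L))
      (hU : Kawahara.MemL2VWith u' U) (hs : Kawahara.IsSolution ρ u₀ h u') :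
      u' = u ∧ ‖U‖ = ‖W‖ := by
    obtain ⟨W', rfl, hW'⟩ := (Kawahara.memL2VWith_iff hL u' U).1 hU
    have := huniq u' W' ((Kawahara.isSolution_iff hL hρ.1 hρ.aestronglyMeasurable hB u₀ h u' W'
      hW').1 hs)
    rw [Kawahara.norm_energyToDV, this.2]
    exact ⟨this.1, rfl⟩
  refine ⟨⟨u, ⟨⟨Kawahara.energyToDV T hL W, ?_⟩, ?_⟩, ?_⟩, ?_⟩
  · exact (Kawahara.memL2VWith_iff hL u _).2 ⟨W, rfl, hu.mem⟩
  · exact (Kawahara.isSolution_iff hL hρ.1 hρ.aestronglyMeasurable hB u₀ h u W hu.mem).2 hu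
  · rintro u' ⟨⟨U, hU⟩, hs⟩
    exact (key u' U hU hs).1
  · intro u' U hU hs
    obtain ⟨rfl, hn⟩ := key u' U hU hs
    rw [hn]
    exact hle
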